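/- Let $n\ge 2$, $\mathbb R^n_+=\{x=(x_0,x'):x_0>0,\ x'\in\mathbb R^{n-1}\}$, and let $B_r(x)$ denote Euclidean balls. **Coefficients.** Let $p>1$, $p'=p/(p-1)$, and let $A=(A_{ij})_{0\le i,j\le n-1}$ and $B=(B_i)_{0\le i\le n-1}$ be complex valued and smooth in $\mathbb R^n_+$, with $A_{00}=1$ and all $A_{0j}$ real. Assume that $A$ is $p$-elliptic with constants $\lambda_p,\Lambda$: $\lambda_p>0$ and, for a.e. $x\in\mathbb R^n_+$ and all $\xi,\eta\in\mathbb C^n$, $$\operatorname{Re}\langle A(x)\xi,\mathcal J_p\xi\rangle\ge\lambda_p|\xi|^2,\qquad |\langle A(x)\xi,\eta\rangle|\le\Lambda|\xi||\eta|,$$ where $\langle A\xi,\eta\rangle=\sum_{i,j}A_{ij}\xi_j\overline{\eta_i}$ and $\mathcal J_p(\alpha+i\beta)=\alpha/p+i\beta/p'$ for $\alpha,\beta\in\mathbb R^n$. Assume that $$d\mu(x)=\sup_{B_{x_0/2}(x)}\left[|\nabla A|^2+|B|^2\right]x_0\,dx$$ is a Carleson measure on $\mathbb R^n_+$: its Carleson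 norm $\|\mu\|_{\mathcal C}$, the least $C$ such that $\mu(\mathbb R^n_+\cap B_r((0,Q)))\le C\,|\{x'\in\mathbb R^{n-1}:|x'-Q|<r\}|$ for all $Q\in\mathbb R^{n-1}$ and $r>0$, is finite. **Solutions.** Let $h>1$ and $\Omega^h=\{0<x_0<h\}$. Let $u\in\dot W^{1,2}(\Omega^h;\mathbb C)$ be an energy solution in $\Omega^h$, that is, a weak solution of $\sum_{i,j}\partial_i(A_{ij}\partial_ju)+\sum_iB_i\partial_iu=0$ in $\Omega^h$ whose trace on $\{x_0=h\}$ is $0$ and whose trace on $\{x_0=0\}$ is some $f\in\dot B^{2,2}_{1/2}(\mathbb R^{n-1};\mathbb C)$. Extend $u$ and $\nabla u$ by $0$ to $\{x_0\ge h\}$. **Square function and maximal function.** For $a>0$ and $Q\in\mathbb R^{n-1}$ put $\Gamma_a(Q)=\{y\in\mathbb R^n_+: a\,y_0>|y'-Q|\}$ and $$S_{p,a}(u)(Q)=\left(\int_{\Gamma_a(Q)}|\nabla u|^2|u|^{p-2}x_0^{2-n}\,dx\right)^{1/p},\qquad \tilde N_{p,a}(u)(Q)=\sup_{x\in\Gamma_a(Q)}\left(\frac1{|B_{x_0/2}(x)|}\int_{B_{x_0/2}(x)}|u|^p\,dz\right)^{1/p},$$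 where $|\nabla u|^2|u|^{p-2}$ is read as $0$ wherever $\nabla u=0$. **Claim.** For all $p>1$, $0<q<\infty$ and $a>0$ there is a finite constant $C=C(\lambda_p,\Lambda,p,q,a,\|\mu\|_{\mathcal C},n)>0$ such that, for all $A,B,h,u$ as above, $$\|S_{p,a}(u)\|_{L^q(\mathbb R^{n-1})}\le C\,\|\tilde N_{p,a}(u)\|_{L^q(\mathbb R^{n-1})}$$ holds in each of the following two cases: (i) $q\ge p$ (with no a priori finiteness assumption); (ii) $q>0$ is arbitrary and $\|S_{p,a}(u)\|_{L^q(\mathbb R^{n-1})}<\infty$. The constant $C$ does not depend on $h$, on $u$, or on the degree of smoothness of $A$ and $B$, and it can be chosen uniformly for all $\mu$ whose Carleson norm is at most a given number. -/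

import Mathlib

open MeasureTheory Metric Set
open scoped ENNReal NNReal ContDiff

noncomputable section

/-- Boundary points `x' ∈ ℝ^d`, where `d = n - 1`, with the Euclidean norm. -/
abbrev Bdry (d : ℕ) : Type := EuclideanSpace ℝ (Fin d)

/-- Points `x = (x₀, x') ∈ ℝ^n = ℝ × ℝ^d`, where `n = d + 1`, with the Euclidean norm. -/
abbrev Space (d : ℕ) : Type := EuclideanSpace ℝ (Fin (d + 1))

/-- The vectors of `ℂ^n`, where `n = d + 1`, with the Euclidean norm. -/
abbrev CVec (d : ℕ) : Type := EuclideanSpace ℂ (Fin (d + 1))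

/-- The horizontal part `x'` of `x = (x₀, x')`. -/
def horiz {d : ℕ} (x : Space d) : Bdry d := WithLp.toLp 2 (fun i => x i.succ)

/-- The point `(t, x')`. -/
def atHeight {d : ℕ} (t : ℝ) (x' : Bdry d) : Space d := WithLp.toLp 2 (Fin.cons t x')

/-- The upper half-space `ℝ^n_+`; there `δ(x) = x₀`. -/
def halfSpace (d : ℕ) : Set (Space d) := {x | 0 < x 0}

/-- The strip `Ω^h = {0 < x₀ < h}`. -/
def strip (d : ℕ) (h : ℝ) : Set (Space d) := {x | 0 < x 0 ∧ x 0 < h}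

/-- The classical partial derivative `∂_i g (x)`. -/
def pderiv {d : ℕ} {F : Type*} [NormedAddCommGroup F] [NormedSpace ℝ F]
    (i : Fin (d + 1)) (g : Space d → F) (x : Space d) : F :=
  fderiv ℝ g x (EuclideanSpace.single i 1)

/-! ### Coefficients -/

/-- The sesquilinear pairing `⟨M ξ, η⟩ = ∑ M_{ij} ξ_j conj(η_i)`. -/
def sesq {d : ℕ} (M : Matrix (Fin (d + 1)) (Fin (d + 1)) ℂ) (ξ η : CVec d) : ℂ :=
  ∑ i, ∑ j, M i j * ξ j * star (η i)

/-- The `ℝ`-linear map `J_p (α + i β) = α / p + i β / p'`, `p' = p / (p - 1)`. -/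
def Jmap {d : ℕ} (p : ℝ) (ξ : CVec d) : CVec d :=
  WithLp.toLp 2 (fun i => ⟨(ξ i).re / p, (ξ i).im / p.conjExponent⟩)

/-- `A` is `p`-elliptic in the upper half-space with constants `lam = λ_p` and `Lam = Λ`. -/
structure IsPElliptic {d : ℕ} (p lam Lam : ℝ)
    (A : Space d → Matrix (Fin (d + 1)) (Fin (d + 1)) ℂ) : Prop where
  pos : 0 < lam
  lower : ∀ᵐ x ∂(volume.restrict (halfSpace d)), ∀ ξ : CVec d,
    lam * ‖ξ‖ ^ 2 ≤ (sesq (A x) ξ (Jmap p ξ)).re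
  upper : ∀ᵐ x ∂(volume.restrict (halfSpace d)), ∀ ξ η : CVec d,
    ‖sesq (A x) ξ η‖ ≤ Lam * ‖ξ‖ * ‖η‖

/-- The function `|∇A|² + |B|²`. -/
def coeffSize {d : ℕ} (A : Space d → Matrix (Fin (d + 1)) (Fin (d + 1)) ℂ)
    (B : Space d → Fin (d + 1) → ℂ) (x : Space d) : ℝ≥0∞ :=
  (∑ i, ∑ j, ∑ k, ‖pderiv k (fun z => A z i j) x‖ₑ ^ 2) + ∑ i, ‖B x i‖ₑ ^ 2

/-- The measure `dμ(x) = sup_{B_{δ(x)/2}(x)} [|∇A|² + |B|²] δ(x) dx` on the upper half-space. -/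
def coeffMeasure {d : ℕ} (A : Space d → Matrix (Fin (d + 1)) (Fin (d + 1)) ℂ)
    (B : Space d → Fin (d + 1) → ℂ) : Measure (Space d) :=
  (volume.restrict (halfSpace d)).withDensity
    (fun x => (⨆ y ∈ ball x (x 0 / 2), coeffSize A B y) * ENNReal.ofReal (x 0))

/-- The Carleson norm: the best constant `C` in `μ(T(Δ_r(Q))) ≤ C σ(Δ_r(Q))`, over all `Q ∈ ℝ^d`
and `r > 0`, where `T(Δ_r(Q)) = ℝ^n_+ ∩ B_r((0, Q))`. It is `∞` if `μ` is not Carleson. -/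
def carlesonNorm {d : ℕ} (μ : Measure (Space d)) : ℝ≥0∞ :=
  sInf {C | ∀ (Q : Bdry d) (r : ℝ), 0 < r →
    μ (halfSpace d ∩ ball (atHeight 0 Q) r) ≤ C * volume (ball Q r)}

/-! ### Energy solutions in the strip -/

/-- `G` is the weak gradient of `u` in the open set `Ω`. -/
def HasWeakGradient {d : ℕ} (Ω : Set (Space d)) (u : Space d → ℂ) (G : Space d → CVec d) :
    Prop :=
  ∀ φ : Space d → ℝ, ContDiff ℝ ∞ φ → HasCompactSupport φ → tsupport φ ⊆ Ω →
    ∀ i, ∫ x in Ω, u x * ((pderiv i φ x : ℝ) : ℂ) = - ∫ x in Ω, G x i * (φ x : ℂ)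

/-- The traces of `u` (with weak gradient `G`) on the two sides `{x₀ = 0}` and `{x₀ = h}` of the
strip are `f` and `g`: the Green formula in the direction `x₀` holds for all test functions that
need not vanish on the boundary of the strip. -/
def HasTraces {d : ℕ} (h : ℝ) (u : Space d → ℂ) (G : Space d → CVec d) (f g : Bdry d → ℂ) :
    Prop :=
  ∀ φ : Space d → ℝ, ContDiff ℝ ∞ φ → HasCompactSupport φ →
    ∫ x in strip d h, (u x * ((pderiv 0 φ x : ℝ) : ℂ) + G x 0 * (φ x : ℂ)) =
      (∫ x', g x' * (φ (atHeight h x') : ℂ)) - ∫ x', f x' * (φ (atHeight 0 x') : ℂ)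

/-- `u`, with weak gradient `G`, is a weak solution of `∂_i(A_{ij} ∂_j u) + B_i ∂_i u = 0`
in the open set `Ω`. -/
def IsWeakSolution {d : ℕ} (A : Space d → Matrix (Fin (d + 1)) (Fin (d + 1)) ℂ)
    (B : Space d → Fin (d + 1) → ℂ) (Ω : Set (Space d)) (G : Space d → CVec d) : Prop :=
  ∀ φ : Space d → ℝ, ContDiff ℝ ∞ φ → HasCompactSupport φ → tsupport φ ⊆ Ω →
    ∫ x in Ω, ((∑ i, ∑ j, A x i j * G x j * ((pderiv i φ x : ℝ) : ℂ))
      - (∑ i, B x i * G x i) * (φ x : ℂ)) = 0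

/-- The homogeneous Besov space `Ḃ^{2,2}_{1/2}(ℝ^d)`, through its Gagliardo seminorm. -/
structure MemBesovHalf {d : ℕ} (f : Bdry d → ℂ) : Prop where
  locallyIntegrable : LocallyIntegrable f volume
  seminorm_lt_top : ∫⁻ x : Bdry d, ∫⁻ y : Bdry d, ‖f x - f y‖ₑ ^ 2 / ‖x - y‖ₑ ^ (d + 1) < ⊤

/-- `u`, with weak gradient `G`, is an energy solution in the strip `Ω^h` with datum `f` on
`{x₀ = 0}` and datum `0` on `{x₀ = h}`: `u` lies in `Ẇ^{1,2}(Ω^h)`, solves the equation weakly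
and has these traces. -/
structure IsEnergySolution {d : ℕ} (A : Space d → Matrix (Fin (d + 1)) (Fin (d + 1)) ℂ)
    (B : Space d → Fin (d + 1) → ℂ) (h : ℝ) (u : Space d → ℂ) (G : Space d → CVec d)
    (f : Bdry d → ℂ) : Prop where
  memLp_loc : ∀ R : ℝ, MemLp u 2 (volume.restrict (strip d h ∩ ball 0 R))
  memLp_grad : MemLp G 2 (volume.restrict (strip d h))
  weakGradient : HasWeakGradient (strip d h) u G
  weakSolution : IsWeakSolution A B (strip d h) G
  datum : MemBesovHalf f
  traces : HasTraces h u G f 0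

/-! ### Square function and nontangential maximal function -/

/-- The cone `Γ_a(Q)` of aperture `a` with vertex `(0, Q)`. -/
def cone {d : ℕ} (a : ℝ) (Q : Bdry d) : Set (Space d) :=
  {y | 0 < y 0 ∧ ‖horiz y - Q‖ < a * y 0}

/-- The `p`-adapted square function
`S_{p,a}(u)(Q) = (∫_{Γ_a(Q)} |∇u|² |u|^{p-2} δ^{2-n} dx)^{1/p}`, with `n = d + 1`, of a function `u`
with gradient `G`. The integrand is zero where the gradient vanishes, since `0 * ∞ = 0`. -/
def squareFn {d : ℕ} (p a : ℝ) (u : Space d → ℂ) (G : Space d → CVec d) (Q : Bdry d) : ℝ≥0∞ :=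
  (∫⁻ x in cone a Q,
    ‖G x‖ₑ ^ 2 * ‖u x‖ₑ ^ (p - 2) * ENNReal.ofReal (x 0 ^ (2 - ((d : ℝ) + 1)))) ^ (1 / p)

/-- The averages `w(x) = (⨍_{B_{δ(x)/2}(x)} |u|^p)^{1/p}`. -/
def lpAverage {d : ℕ} (p : ℝ) (u : Space d → ℂ) (x : Space d) : ℝ≥0∞ :=
  (⨍⁻ z in ball x (x 0 / 2), ‖u z‖ₑ ^ p ∂volume) ^ (1 / p)

/-- The nontangential maximal function `Ñ_{p,a}(u)(Q) = sup_{Γ_a(Q)} w`. -/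
def ntMax {d : ℕ} (p a : ℝ) (u : Space d → ℂ) (Q : Bdry d) : ℝ≥0∞ :=
  ⨆ x ∈ cone a Q, lpAverage p u x

end

section

open MeasureTheory Metric Set Filter Topology
open scoped ENNReal NNReal ContDiff Convolution Pointwise Manifold

variable {d : ℕ}

/-! The p-th power of S at Q is a conical integral of g = |∇u|²|u|^{p-2}, and the p-th power of N
is, over the same cone, the supremum of the Whitney averages of |u|^p. The claim is therefore an L^s
comparison of the two with s = q/p. It rests on one local energy inequality, followed by
real-variable arguments that no longer see the equation.

Energy inequality (`IsExtendedSolution.lintegral_energy_le`). Extended by zero above the strip, u is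
weakly differentiable in the half-space. The equation is tested with the conjugate of |u|^{p-2}u
times x₀η², and p-ellipticity bounds the principal term below by |∇u|²|u|^{p-2}x₀η². The only
dangerous term comes from ∂₀ falling on x₀: it is the real part of Σ_j A_{0j} ∂_j u times the
conjugate of |u|^{p-2}u, times η², and it carries no power of x₀. As the A_{0j} are real, it equals
½ Σ_j A_{0j} ∂_jΦ η², where Φ is a primitive evaluated at |u|² and comparable to |u|^p. For j ≠ 0
the identity ∫ (∂_jΦ ∂₀ψ − ∂₀Φ ∂_jψ) = 0 with ψ = A_{0j}x₀η² trades it for terms that do carry x₀.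
For j = 0 the condition A₀₀ = 1 makes it a pure derivative. Young's inequality absorbs the cross
terms. What remains is |u|^p against x₀|∇η|² + |η||∇η| + x₀(|∇A|² + |B|²)η². The power |u|^{p-2} is
first regularised (`regPow`), and the regularisation is removed at the end.

Sawtooth estimate (`exists_lintegral_energy_localSawtooth_le`). For η a cutoff to the region between
two Lipschitz graphs, this weight consists of 1/x₀ on two thin layers around the graphs and of the
coefficient density. Both are Carleson. After |u|^p has been replaced by its Whitney averages, the
Carleson embedding bounds the energy over a sawtooth region by the integral of a nontangential
supremum taken over a slightly larger sawtooth region (`SawtoothBound`).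

From sawtooth estimates to L^s (`exists_lintegral_coneIntegral_rpow_le`). For s = 1 the region is
the whole half-space. For s < 1 the region lies above the set where the maximal function is at most
l, which gives a distributional inequality to be integrated in l. For s > 1 one dualises: g x₀ dx is
Carleson relative to the Hardy–Littlewood maximal function of the nontangential one, and Hölder's
inequality with the maximal theorem concludes. Apertures are interchanged by a Vitali covering
argument. -/

/-! ### Mollification in L² -/

theorem eLpNorm_two_sq {α E : Type*} [MeasurableSpace α] [NormedAddCommGroup E] (μ : Measure α)
    (f : α → E) : eLpNorm f 2 μ ^ 2 = ∫⁻ x, ‖f x‖ₑ ^ 2 ∂μ := by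
  rw [eLpNorm_eq_lintegral_rpow_enorm_toReal two_ne_zero (by simp)]
  simp only [ENNReal.toReal_ofNat, ENNReal.rpow_ofNat]
  rw [← ENNReal.rpow_natCast, ← ENNReal.rpow_mul]
  simp

/-- Cauchy–Schwarz for the splitting f g = f^{1/2} (f g²)^{1/2}. When f is a probability density
this is Jensen's inequality for the square, the form needed for mollifiers. -/
theorem lintegral_mul_sq_le {α : Type*} [MeasurableSpace α] {μ : Measure α} {f g : α → ℝ≥0∞}
    (hf : AEMeasurable f μ) (hg : AEMeasurable g μ) :
    (∫⁻ x, f x * g x ∂μ) ^ 2 ≤ (∫⁻ x, f x ∂μ) * ∫⁻ x, f x * g x ^ 2 ∂μ := by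
  have h := ENNReal.lintegral_mul_norm_pow_le (f := f) (g := fun x => f x * g x ^ 2) hf
    (hf.mul (hg.pow_const 2)) (p := 1/2) (q := 1/2) (by norm_num) (by norm_num) (by norm_num)
  have e : ∀ x, f x ^ (1/2:ℝ) * (f x * g x ^ 2) ^ (1/2:ℝ) = f x * g x := by
    intro x
    rw [ENNReal.mul_rpow_of_nonneg _ _ (by norm_num), ← mul_assoc,
      ← ENNReal.rpow_add_of_nonneg _ _ (by norm_num) (by norm_num), ← ENNReal.rpow_natCast,
      ← ENNReal.rpow_mul]
    norm_num
  simp only [e] at h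
  calc _ ≤ ((∫⁻ x, f x ∂μ) ^ (1/2:ℝ) * (∫⁻ x, f x * g x ^ 2 ∂μ) ^ (1/2:ℝ)) ^ 2 := by gcongr
    _ = _ := by
      rw [mul_pow, ← ENNReal.rpow_natCast, ← ENNReal.rpow_natCast, ← ENNReal.rpow_mul,
        ← ENNReal.rpow_mul]
      norm_num

/-- Translations are a continuous family of measure preserving maps, and composition with such a
family is continuous in L². -/
theorem exists_eLpNorm_translate_sub_le {f : Space d → ℂ} (hf : MemLp f 2 volume) {η : ℝ≥0∞}
    (hη : η ≠ 0) :
    ∃ δ : ℝ, 0 < δ ∧ ∀ y : Space d, ‖y‖ ≤ δ →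
      eLpNorm (fun x => f (x - y) - f x) 2 volume ≤ η := by
  let g : C(Space d, C(Space d, Space d)) :=
    (ContinuousMap.mk (fun a : Space d × Space d => a.2 - a.1) (by fun_prop)).curry
  have hg : ∀ y, MeasurePreserving (g y) (volume : Measure (Space d)) volume :=
    fun y => measurePreserving_sub_right volume y
  have hc : ContinuousAt (fun y => Lp.compMeasurePreserving (g y) (hg y) (hf.toLp f)) 0 :=
    ContinuousAt.compMeasurePreservingLp continuousAt_const g.continuous.continuousAt hg (by simp)
  have := hc.tendsto.eventually (Metric.eventually_nhds_iff_ball.2 ?_ :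
    ∀ᶠ z in 𝓝 _, edist z (Lp.compMeasurePreserving (g 0) (hg 0) (hf.toLp f)) ≤ η)
  · obtain ⟨δ, hδ, h⟩ := Metric.eventually_nhds_iff.1 this
    refine ⟨δ / 2, by positivity, fun y hy => ?_⟩
    have := h (y := y) (by rw [dist_zero_right]; linarith)
    rw [Lp.edist_def] at this
    refine (eLpNorm_congr_ae ?_).trans_le this
    have h1 := Lp.coeFn_compMeasurePreserving (hf.toLp f) (hg y)
    have h2 := Lp.coeFn_compMeasurePreserving (hf.toLp f) (hg 0)
    have h3 := hf.coeFn_toLp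
    have h4 := (hg y).quasiMeasurePreserving.ae_eq_comp h3
    have h5 := (hg 0).quasiMeasurePreserving.ae_eq_comp h3
    filter_upwards [h1, h2, h4, h5] with x h1 h2 h4 h5
    simp only [Pi.sub_apply, h1, h2, h4, h5]
    simp [g]
  · rcases eq_or_ne η ⊤ with rfl | ht
    · exact ⟨1, one_pos, by simp⟩
    · refine ⟨η.toReal, ENNReal.toReal_pos hη ht, fun y hy => ?_⟩
      rw [edist_dist]
      exact ENNReal.ofReal_le_of_le_toReal (mem_ball.1 hy).le

/-- A mollification is at least as close to `f` in `L²` as the translates it averages. -/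
theorem eLpNorm_convolution_sub_le {f : Space d → ℂ} (hf : MemLp f 2 volume) {ρ : Space d → ℝ}
    (hρc : Continuous ρ) (hρs : HasCompactSupport ρ) (hρ0 : ∀ x, 0 ≤ ρ x) (hρ1 : ∫ x, ρ x = 1)
    {η : ℝ≥0∞} (h : ∀ y, ρ y ≠ 0 → eLpNorm (fun x => f (x - y) - f x) 2 volume ≤ η) :
    eLpNorm (ρ ⋆[ContinuousLinearMap.lsmul ℝ ℝ, volume] f - f) 2 volume ≤ η := by
  -- A strongly measurable representative supplies the joint measurability required by Tonelli.
  -- Neither the convolution nor the translates change their classes.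
  wlog hm : StronglyMeasurable f generalizing f
  · obtain ⟨g, hg, hfg⟩ := hf.1
    have e : ρ ⋆[ContinuousLinearMap.lsmul ℝ ℝ, volume] f - f =ᵐ[volume]
        ρ ⋆[ContinuousLinearMap.lsmul ℝ ℝ, volume] g - g := by
      filter_upwards [hfg] with x hx
      rw [Pi.sub_apply, Pi.sub_apply, convolution_congr _ (ae_eq_refl ρ) hfg, hx]
    rw [eLpNorm_congr_ae e]
    refine this (hf.ae_eq hfg) (fun y hy => ?_) hg
    refine (eLpNorm_congr_ae ?_).trans_le (h y hy)
    filter_upwards [hfg, (measurePreserving_sub_right volume y).quasiMeasurePreserving.ae_eq_comp hfg]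
      with x hx hx'
    simp only [Function.comp] at hx'
    rw [hx, hx']
  have hloc : LocallyIntegrable f volume := hf.locallyIntegrable (by norm_num)
  have hρi : Integrable ρ volume := hρc.integrable_of_hasCompactSupport hρs
  have hρ1' : ∫⁻ x, ‖ρ x‖ₑ = 1 := by
    rw [← ofReal_integral_norm_eq_lintegral_enorm hρi]
    simp [Real.norm_of_nonneg (hρ0 _), hρ1]
  have hpt : ∀ x, ‖(ρ ⋆[ContinuousLinearMap.lsmul ℝ ℝ, volume] f - f) x‖ₑ ^ 2 ≤
      ∫⁻ t, ‖ρ t‖ₑ * ‖f (x - t) - f x‖ₑ ^ 2 := by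
    intro x
    have e : (ρ ⋆[ContinuousLinearMap.lsmul ℝ ℝ, volume] f - f) x
        = ∫ t, ρ t • (f (x - t) - f x) := by
      have h1 := hρs.convolutionExists_left (L := ContinuousLinearMap.lsmul ℝ ℝ) hρc hloc x
      simp only [smul_sub]
      rw [integral_sub, integral_smul_const, hρ1, one_smul]
      · rfl
      · exact h1
      · exact hρi.smul_const _
    have hm1 : AEMeasurable (fun t => ‖f (x - t) - f x‖ₑ) volume :=
      ((hm.comp_measurable (measurable_const.sub measurable_id)).sub
        stronglyMeasurable_const).enorm.aemeasurable
    calc _ ≤ (∫⁻ t, ‖ρ t‖ₑ * ‖f (x - t) - f x‖ₑ) ^ 2 := by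
          rw [e]
          gcongr
          refine (enorm_integral_le_lintegral_enorm _).trans_eq ?_
          exact lintegral_congr fun t => by rw [enorm_smul]
      _ ≤ _ := by
          refine (lintegral_mul_sq_le hρc.enorm.aemeasurable hm1).trans_eq ?_
          rw [hρ1', one_mul]
  rw [← ENNReal.pow_le_pow_left_iff (n := 2) two_ne_zero, eLpNorm_two_sq]
  calc _ ≤ ∫⁻ x, ∫⁻ t, ‖ρ t‖ₑ * ‖f (x - t) - f x‖ₑ ^ 2 := lintegral_mono hpt
    _ = ∫⁻ t, ∫⁻ x, ‖ρ t‖ₑ * ‖f (x - t) - f x‖ₑ ^ 2 := by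
      rw [lintegral_lintegral_swap]
      have : Measurable f := hm.measurable
      refine Measurable.aemeasurable ?_
      have := hρc.measurable
      fun_prop
    _ ≤ ∫⁻ t, ‖ρ t‖ₑ * η ^ 2 := by
      refine lintegral_mono fun t => ?_
      rw [lintegral_const_mul' _ _ (by simp)]
      by_cases ht : ρ t = 0
      · simp [ht]
      · gcongr
        rw [← eLpNorm_two_sq]
        gcongr
        exact h t ht
    _ = η ^ 2 := by
      rw [lintegral_mul_const _ hρc.enorm.measurable, hρ1', one_mul]

/-- A mollifier supported in a small ball and in the lower half-space. -/
theorem exists_mollifier {δ : ℝ} (hδ : 0 < δ) :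
    ∃ ρ : Space d → ℝ, ContDiff ℝ ∞ ρ ∧ HasCompactSupport ρ ∧ (∀ x, 0 ≤ ρ x) ∧ ∫ x, ρ x = 1 ∧
      ∀ y ∈ tsupport ρ, ‖y‖ ≤ δ ∧ y 0 < 0 := by
  -- Centre at height −δ/2 and radius δ/4: the support stays strictly below height 0 and inside the
  -- ball of radius δ. Convolution then pushes supports downwards, as is needed at the top of the
  -- strip.
  let c : Space d := EuclideanSpace.single 0 (-(δ / 2))
  let b : ContDiffBump c := ⟨δ / 8, δ / 4, by positivity, by linarith⟩
  refine ⟨b.normed volume, b.contDiff_normed, b.hasCompactSupport_normed, b.nonneg_normed,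
    b.integral_normed, fun y hy => ?_⟩
  rw [b.tsupport_normed_eq, mem_closedBall, dist_eq_norm] at hy
  change ‖y - c‖ ≤ δ / 4 at hy
  have hc : ‖c‖ = δ / 2 := by simp [c, abs_of_pos hδ]
  constructor
  · have := norm_add_le (y - c) c
    simp only [sub_add_cancel] at this
    linarith
  · have := (PiLp.norm_apply_le (y - c) 0 : ‖(y - c) 0‖ ≤ _).trans hy
    simp only [c, PiLp.sub_apply, PiLp.single_apply, if_true, Real.norm_eq_abs] at this
    have := (abs_le.1 this).2
    linarith

theorem eLpNorm_one_mul_le {α 𝕜 : Type*} [MeasurableSpace α] {μ : Measure α} [RCLike 𝕜]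
    {a b : α → 𝕜} (ha : AEStronglyMeasurable a μ) (hb : AEStronglyMeasurable b μ) :
    eLpNorm (a * b) 1 μ ≤ eLpNorm a 2 μ * eLpNorm b 2 μ := by
  have h := eLpNorm_smul_le_mul_eLpNorm (𝕜 := 𝕜) (p := 2) (q := 2) (r := 1) hb ha
  have e : a • b = a * b := rfl
  rwa [e] at h

theorem tendsto_eLpNorm_one_mul {α 𝕜 : Type*} [MeasurableSpace α] {μ : Measure α} [RCLike 𝕜]
    {a b : ℕ → α → 𝕜} {a' b' : α → 𝕜} (ha : ∀ n, MemLp (a n) 2 μ) (hb : ∀ n, MemLp (b n) 2 μ)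
    (ha' : MemLp a' 2 μ) (hb' : MemLp b' 2 μ)
    (hat : Tendsto (fun n => eLpNorm (a n - a') 2 μ) atTop (𝓝 0))
    (hbt : Tendsto (fun n => eLpNorm (b n - b') 2 μ) atTop (𝓝 0)) :
    Tendsto (fun n => eLpNorm (a n * b n - a' * b') 1 μ) atTop (𝓝 0) := by
  have key : ∀ n, eLpNorm (a n * b n - a' * b') 1 μ ≤
      (eLpNorm (a n - a') 2 μ + eLpNorm a' 2 μ) * eLpNorm (b n - b') 2 μ +
        eLpNorm (a n - a') 2 μ * eLpNorm b' 2 μ := by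
    intro n
    have e : a n * b n - a' * b' = a n * (b n - b') + (a n - a') * b' := by ring
    rw [e]
    refine (eLpNorm_add_le ((ha n).1.mul ((hb n).1.sub hb'.1)) (((ha n).1.sub ha'.1).mul hb'.1)
      le_rfl).trans ?_
    gcongr
    · refine (eLpNorm_one_mul_le (ha n).1 ((hb n).1.sub hb'.1)).trans ?_
      gcongr
      have := eLpNorm_add_le ((ha n).1.sub ha'.1) ha'.1 (p := 2) (by norm_num)
      simpa using this
    · exact eLpNorm_one_mul_le ((ha n).1.sub ha'.1) hb'.1
  refine tendsto_of_tendsto_of_tendsto_of_le_of_le tendsto_const_nhds ?_ (fun _ => zero_le) key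
  have h1 := ENNReal.Tendsto.mul (hat.add_const (eLpNorm a' 2 μ)) (Or.inr (by simp)) hbt
    (Or.inr (by simpa using ha'.eLpNorm_ne_top))
  have h2 := ENNReal.Tendsto.mul_const hat (b := eLpNorm b' 2 μ) (Or.inr hb'.eLpNorm_ne_top)
  simpa using h1.add h2

theorem tendsto_integral_of_eLpNorm_one {α E : Type*} [MeasurableSpace α] {μ : Measure α}
    [NormedAddCommGroup E] [NormedSpace ℝ E] {f : ℕ → α → E} {f' : α → E}
    (hf : ∀ n, Integrable (f n) μ) (hf' : Integrable f' μ)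
    (h : Tendsto (fun n => eLpNorm (f n - f') 1 μ) atTop (𝓝 0)) :
    Tendsto (fun n => ∫ x, f n x ∂μ) atTop (𝓝 (∫ x, f' x ∂μ)) :=
  tendsto_integral_of_L1' f' hf'.1 (.of_forall hf) h

theorem tendsto_integral_mul {α 𝕜 : Type*} [MeasurableSpace α] {μ : Measure α} [RCLike 𝕜]
    {a b : ℕ → α → 𝕜} {a' b' : α → 𝕜} (ha : ∀ n, MemLp (a n) 2 μ) (hb : ∀ n, MemLp (b n) 2 μ)
    (ha' : MemLp a' 2 μ) (hb' : MemLp b' 2 μ)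
    (hat : Tendsto (fun n => eLpNorm (a n - a') 2 μ) atTop (𝓝 0))
    (hbt : Tendsto (fun n => eLpNorm (b n - b') 2 μ) atTop (𝓝 0)) :
    Tendsto (fun n => ∫ x, a n x * b n x ∂μ) atTop (𝓝 (∫ x, a' x * b' x ∂μ)) :=
  tendsto_integral_of_eLpNorm_one (fun n => (ha n).integrable_mul (hb n))
    (ha'.integrable_mul hb') (tendsto_eLpNorm_one_mul ha hb ha' hb' hat hbt)

/-! ### Weak derivatives and chain rules -/

/-- `g` is the weak derivative `∂_i u` in the open set `Ω`, tested by functions supported in `Ω`. -/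
def IsWeakDeriv (Ω : Set (Space d)) (i : Fin (d + 1)) (u g : Space d → ℂ) : Prop :=
  ∀ φ : Space d → ℝ, ContDiff ℝ ∞ φ → HasCompactSupport φ → tsupport φ ⊆ Ω →
    ∫ x, u x * ((pderiv i φ x : ℝ) : ℂ) = - ∫ x, g x * (φ x : ℂ)

theorem contDiff_pderiv {F : Type*} [NormedAddCommGroup F] [NormedSpace ℝ F] {φ : Space d → F}
    (hφ : ContDiff ℝ ∞ φ) (i : Fin (d + 1)) : ContDiff ℝ ∞ (pderiv i φ) := by
  have := hφ.fderiv_right (m := ∞) (by simp)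
  exact this.clm_apply contDiff_const

theorem tsupport_pderiv_subset {F : Type*} [NormedAddCommGroup F] [NormedSpace ℝ F]
    (φ : Space d → F) (i : Fin (d + 1)) : tsupport (pderiv i φ) ⊆ tsupport φ :=
  tsupport_fderiv_apply_subset ℝ _

theorem HasCompactSupport.pderiv {F : Type*} [NormedAddCommGroup F] [NormedSpace ℝ F]
    {φ : Space d → F} (hφ : HasCompactSupport φ) (i : Fin (d + 1)) :
    HasCompactSupport (pderiv i φ) :=
  hφ.fderiv_apply (𝕜 := ℝ) _

theorem memLp_ofReal_of_hasCompactSupport {φ : Space d → ℝ} (hφ : Continuous φ)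
    (hs : HasCompactSupport φ) (p : ℝ≥0∞) : MemLp (fun x => (φ x : ℂ)) p volume :=
  (Complex.continuous_ofReal.comp hφ).memLp_of_hasCompactSupport
    (hs.comp_left (g := fun r : ℝ => (r : ℂ)) (by simp))

noncomputable abbrev mollify (ρ : Space d → ℝ) (u : Space d → ℂ) : Space d → ℂ :=
  ρ ⋆[ContinuousLinearMap.lsmul ℝ ℝ, volume] u

theorem mollify_eq_integral_sub (ρ : Space d → ℝ) (u : Space d → ℂ) (x : Space d) :
    mollify ρ u x = ∫ t, u t * (ρ (x - t) : ℂ) := by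
  rw [mollify, convolution_def, ← integral_sub_left_eq_self _ _ x]
  refine integral_congr_ae (.of_forall fun t => ?_)
  simp [mul_comm]

/-- The test function is t ↦ ρ(x − t); the reflection reverses the sign of its derivative and
cancels the sign of the weak derivative. -/
theorem pderiv_mollify {u g : Space d → ℂ} {i : Fin (d + 1)} (hu : LocallyIntegrable u volume)
    (hug : IsWeakDeriv univ i u g) {ρ : Space d → ℝ} (hρ : ContDiff ℝ ∞ ρ)
    (hρs : HasCompactSupport ρ) (x : Space d) :
    pderiv i (mollify ρ u) x = mollify ρ g x := by
  have h1 := hρs.hasFDerivAt_convolution_left (ContinuousLinearMap.lsmul ℝ ℝ : ℝ →L[ℝ] ℂ →L[ℝ] ℂ)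
    (μ := volume) (hρ.of_le (by simp)) hu x
  rw [pderiv, h1.fderiv, mollify_eq_integral_sub]
  have h2 := hug (fun t => ρ (x - t)) (hρ.comp (contDiff_const.sub contDiff_id))
    (hρs.comp_homeomorph (Homeomorph.subLeft x)) (subset_univ _)
  rw [← neg_eq_iff_eq_neg] at h2
  rw [← h2, convolution_def, ContinuousLinearMap.integral_apply, ← integral_neg,
    ← integral_sub_left_eq_self _ _ x]
  · refine integral_congr_ae (.of_forall fun t => ?_)
    have h3 : HasFDerivAt (fun t => ρ (x - t)) (-(fderiv ℝ ρ (x - t))) t := by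
      have := (hρ.differentiable (by simp) (x - t)).hasFDerivAt.comp t
        ((hasFDerivAt_id t).const_sub x)
      simpa using! this
    simp [pderiv, h3.fderiv, ContinuousLinearMap.precompL_apply, mul_comm]
  · exact (hρs.fderiv ℝ).convolutionExists_left _ (hρ.continuous_fderiv (by simp)) hu x

theorem contDiff_mollify {u : Space d → ℂ} (hu : LocallyIntegrable u volume) {ρ : Space d → ℝ}
    (hρ : ContDiff ℝ ∞ ρ) (hρs : HasCompactSupport ρ) : ContDiff ℝ ∞ (mollify ρ u) :=
  hρs.contDiff_convolution_left _ (n := ⊤) hρ hu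

/-- Simultaneous approximation in `L²` of finitely many functions by mollification, with mollifiers
supported near the origin in the lower half-space. -/
theorem exists_mollifier_eLpNorm_le {ι : Type*} [Finite ι] {f : ι → Space d → ℂ}
    (hf : ∀ k, MemLp (f k) 2 volume) {δ : ℝ} (hδ : 0 < δ) {η : ℝ≥0∞} (hη : η ≠ 0) :
    ∃ ρ : Space d → ℝ, ContDiff ℝ ∞ ρ ∧ HasCompactSupport ρ ∧
      (∀ y ∈ tsupport ρ, ‖y‖ ≤ δ ∧ y 0 < 0) ∧
      ∀ k, MemLp (mollify ρ (f k)) 2 volume ∧ eLpNorm (mollify ρ (f k) - f k) 2 volume ≤ η := by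
  -- The minimum with 1 keeps the difference in L² even for η = ∞.
  have : ∀ k, ∃ δ' : ℝ, 0 < δ' ∧ ∀ y : Space d, ‖y‖ ≤ δ' →
      eLpNorm (fun x => f k (x - y) - f k x) 2 volume ≤ min η 1 :=
    fun k => exists_eLpNorm_translate_sub_le (hf k) (by simp [hη])
  choose δ' hδ' h using this
  cases nonempty_fintype ι
  obtain ⟨ε, hε, hεle⟩ : ∃ ε : ℝ, 0 < ε ∧ ε ≤ δ ∧ ∀ k, ε ≤ δ' k := by
    have hev : ∀ᶠ ε : ℝ in 𝓝[>] 0, 0 < ε ∧ ε ≤ δ ∧ ∀ k, ε ≤ δ' k := by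
      refine (eventually_mem_nhdsWithin).and (Eventually.and ?_ (eventually_all.2 fun k => ?_)) <;>
      refine nhdsWithin_le_nhds (Iic_mem_nhds ?_)
      · exact hδ
      · exact hδ' k
    exact hev.exists
  obtain ⟨ρ, h1, h2, h3, h4, h5⟩ := exists_mollifier (d := d) hε
  refine ⟨ρ, h1, h2, fun y hy => ⟨(h5 y hy).1.trans hεle.1, (h5 y hy).2⟩, fun k => ?_⟩
  have hle : eLpNorm (mollify ρ (f k) - f k) 2 volume ≤ min η 1 :=
    eLpNorm_convolution_sub_le (hf k) h1.continuous h2 h3 h4 fun y hy =>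
      h k y ((h5 y (subset_tsupport _ hy)).1.trans (hεle.2 k))
  refine ⟨?_, hle.trans (min_le_left _ _)⟩
  have hm : MemLp (mollify ρ (f k) - f k) 2 volume :=
    ⟨((contDiff_mollify ((hf k).locallyIntegrable (by norm_num)) h1 h2).continuous.aestronglyMeasurable).sub
      (hf k).1, (hle.trans (min_le_right _ _)).trans_lt (by simp)⟩
  simpa using hm.add (hf k)

/-- A function with weak derivatives in `L²` is an `L²` limit of smooth functions, together with its
derivatives. -/
theorem exists_seq_smooth {u g : Space d → ℂ} {i : Fin (d + 1)} (hu : MemLp u 2 volume)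
    (hg : MemLp g 2 volume) (hug : IsWeakDeriv univ i u g) :
    ∃ v : ℕ → Space d → ℂ, (∀ n, ContDiff ℝ ∞ (v n)) ∧ (∀ n, MemLp (v n) 2 volume) ∧
      (∀ n, MemLp (pderiv i (v n)) 2 volume) ∧
      Tendsto (fun n => eLpNorm (v n - u) 2 volume) atTop (𝓝 0) ∧
      Tendsto (fun n => eLpNorm (pderiv i (v n) - g) 2 volume) atTop (𝓝 0) := by
  have hf : ∀ k : Bool, MemLp (cond k u g) 2 volume := by rintro (_ | _) <;> assumption
  have hη : ∀ n : ℕ, ((n : ℝ≥0∞) + 1)⁻¹ ≠ 0 := fun n => by simp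
  choose ρ h1 h2 h3 h4 using fun n : ℕ => exists_mollifier_eLpNorm_le hf one_pos (hη n)
  have ht : Tendsto (fun n : ℕ => ((n : ℝ≥0∞) + 1)⁻¹) atTop (𝓝 0) := by
    have := (tendsto_add_atTop_iff_nat 1).2 ENNReal.tendsto_inv_nat_nhds_zero
    simpa using this
  have hul := hu.locallyIntegrable (by norm_num : (1 : ℝ≥0∞) ≤ 2)
  have e : ∀ n, pderiv i (mollify (ρ n) u) = mollify (ρ n) g :=
    fun n => funext (pderiv_mollify hul hug (h1 n) (h2 n))
  refine ⟨fun n => mollify (ρ n) u, fun n => contDiff_mollify hul (h1 n) (h2 n),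
    fun n => (h4 n true).1, fun n => ?_, ?_, ?_⟩
  · rw [e]; exact (h4 n false).1
  · exact tendsto_of_tendsto_of_tendsto_of_le_of_le tendsto_const_nhds ht (fun _ => zero_le)
      fun n => (h4 n true).2
  · simp only [e]
    exact tendsto_of_tendsto_of_tendsto_of_le_of_le tendsto_const_nhds ht (fun _ => zero_le)
      fun n => (h4 n false).2

theorem pderiv_ofReal {φ : Space d → ℝ} {x : Space d} (hφ : DifferentiableAt ℝ φ x)
    (i : Fin (d + 1)) : pderiv i (fun x => (φ x : ℂ)) x = ((pderiv i φ x : ℝ) : ℂ) := by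
  have := (Complex.ofRealCLM.hasFDerivAt (x := φ x)).comp x hφ.hasFDerivAt
  have h2 : HasFDerivAt (fun x => (φ x : ℂ)) (Complex.ofRealCLM.comp (fderiv ℝ φ x)) x := this
  rw [pderiv, h2.fderiv]
  rfl

theorem isWeakDeriv_pderiv {v : Space d → ℂ} (hv : ContDiff ℝ 1 v) (i : Fin (d + 1)) :
    IsWeakDeriv univ i v (pderiv i v) := by
  intro φ hφ hs _
  have hφ' : ∀ x, pderiv i (fun x => (φ x : ℂ)) x = ((pderiv i φ x : ℝ) : ℂ) := fun x =>
    pderiv_ofReal (hφ.differentiable (by simp) x) i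
  have hc : Continuous (pderiv i v) := (hv.continuous_fderiv one_ne_zero).clm_apply continuous_const
  have hsc : HasCompactSupport (fun x => (φ x : ℂ)) :=
    hs.comp_left (g := fun r : ℝ => (r : ℂ)) (by simp)
  have hsc' : HasCompactSupport (fun x => ((pderiv i φ x : ℝ) : ℂ)) :=
    (hs.pderiv i).comp_left (g := fun r : ℝ => (r : ℂ)) (by simp)
  have hcφ : Continuous (fun x => (φ x : ℂ)) := Complex.continuous_ofReal.comp hφ.continuous
  have hcφ' : Continuous (fun x => ((pderiv i φ x : ℝ) : ℂ)) :=
    Complex.continuous_ofReal.comp (contDiff_pderiv hφ i).continuous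
  have := integral_mul_fderiv_eq_neg_fderiv_mul_of_integrable (μ := (volume : Measure (Space d)))
    (f := v) (g := fun x => (φ x : ℂ)) (v := EuclideanSpace.single i (1:ℝ))
    ((hc.mul hcφ).integrable_of_hasCompactSupport hsc.mul_left)
    ?_ ((hv.continuous.mul hcφ).integrable_of_hasCompactSupport hsc.mul_left)
    (fun x _ => hv.differentiable one_ne_zero x)
    (fun x _ => (Complex.ofRealCLM.contDiff.comp hφ).differentiable (by simp) x)
  · change ∫ x, v x * pderiv i (fun x => (φ x : ℂ)) x = _ at this
    simp only [hφ'] at this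
    exact this
  · change Integrable (fun x => v x * pderiv i (fun x => (φ x : ℂ)) x) _
    simp only [hφ']
    exact (hv.continuous.mul hcφ').integrable_of_hasCompactSupport hsc'.mul_left

theorem memLp_lipschitz_comp {α : Type*} [MeasurableSpace α] {μ : Measure α} {E F : Type*}
    [NormedAddCommGroup E] [NormedAddCommGroup F] {H : E → F}
    {K : ℝ} (hH : ∀ a b, ‖H a - H b‖ ≤ K * ‖a - b‖) (hc : Continuous H) (h0 : H 0 = 0) {u : α → E}
    (hu : MemLp u 2 μ) : MemLp (fun x => H (u x)) 2 μ :=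
  hu.of_le_mul (c := K) (hc.comp_aestronglyMeasurable hu.1)
    (.of_forall fun x => by simpa [h0] using hH (u x) 0)

theorem tendsto_eLpNorm_lipschitz_comp {α : Type*} [MeasurableSpace α] {μ : Measure α}
    {E F : Type*} [NormedAddCommGroup E] [NormedAddCommGroup F]
    {H : E → F} {K : ℝ} (hH : ∀ a b, ‖H a - H b‖ ≤ K * ‖a - b‖) {u : α → E} {v : ℕ → α → E}
    (h : Tendsto (fun n => eLpNorm (v n - u) 2 μ) atTop (𝓝 0)) :
    Tendsto (fun n => eLpNorm ((fun x => H (v n x)) - fun x => H (u x)) 2 μ) atTop (𝓝 0) := by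
  have h2 := ENNReal.Tendsto.const_mul h (a := ENNReal.ofReal K) (Or.inr (by simp))
  rw [mul_zero] at h2
  exact tendsto_of_tendsto_of_tendsto_of_le_of_le tendsto_const_nhds h2 (fun _ => zero_le)
    fun n => eLpNorm_le_mul_eLpNorm_of_ae_le_mul (.of_forall fun x => hH _ _) 2

/-- The classical chain rule holds for smooth approximations v_n of u. F is Lipschitz with F(0) = 0,
so F(v_n) → F(u) in L². In the derivative, DF(v_n)(∂v_n − g) tends to 0 because DF is bounded. The
remaining DF(v_n)g converges by dominated convergence along a subsequence with v_n → u almost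
everywhere. It is applied to the regularised power F(z) = φ(|z|²)z. -/
theorem IsWeakDeriv.comp_of_bounded {u g : Space d → ℂ} {i : Fin (d + 1)} (hu : MemLp u 2 volume)
    (hg : MemLp g 2 volume) (hug : IsWeakDeriv univ i u g) {F : ℂ → ℂ} (hF : ContDiff ℝ 1 F)
    (h0 : F 0 = 0) {K : ℝ} (hK : ∀ z, ‖fderiv ℝ F z‖ ≤ K) :
    IsWeakDeriv univ i (fun x => F (u x)) (fun x => fderiv ℝ F (u x) (g x)) := by
  intro φ hφ hs _
  obtain ⟨v, hv, hvL, hvL', hvu, hvg⟩ := exists_seq_smooth hu hg hug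
  have hlip : ∀ a b, ‖F a - F b‖ ≤ K * ‖a - b‖ := fun a b =>
    Convex.norm_image_sub_le_of_norm_fderiv_le (𝕜 := ℝ) (s := univ)
      (fun z _ => hF.differentiable one_ne_zero z)
      (fun z _ => hK z) convex_univ (mem_univ _) (mem_univ _)
  obtain ⟨ns, hns, hae⟩ := (tendstoInMeasure_of_tendsto_eLpNorm two_ne_zero
    (fun n => (hvL n).1) hu.1 hvu).exists_seq_tendsto_ae
  have hφL := memLp_ofReal_of_hasCompactSupport hφ.continuous hs 2
  have hφL' := memLp_ofReal_of_hasCompactSupport (contDiff_pderiv hφ i).continuous (hs.pderiv i) 2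
  have hDc : Continuous (fderiv ℝ F) := hF.continuous_fderiv one_ne_zero
  have heq : ∀ n, ∫ x, F (v n x) * ((pderiv i φ x : ℝ) : ℂ) =
      -∫ x, fderiv ℝ F (v n x) (pderiv i (v n) x) * (φ x : ℂ) := by
    intro n
    have := isWeakDeriv_pderiv (hF.comp ((hv n).of_le (by simp))) i φ hφ hs (subset_univ _)
    have e : ∀ x, pderiv i (F ∘ v n) x = fderiv ℝ F (v n x) (pderiv i (v n) x) := by
      intro x
      rw [pderiv, fderiv_comp x (hF.differentiable one_ne_zero _)
        ((hv n).differentiable (by simp) x)]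
      rfl
    simpa only [e] using! this
  have hzero : ∀ f : Space d → ℂ, Tendsto (fun _ : ℕ => eLpNorm (f - f) 2 volume) atTop (𝓝 0) := by
    intro f; simp
  have hL : Tendsto (fun n => ∫ x, F (v n x) * ((pderiv i φ x : ℝ) : ℂ)) atTop
      (𝓝 (∫ x, F (u x) * ((pderiv i φ x : ℝ) : ℂ))) :=
    tendsto_integral_mul (fun n => memLp_lipschitz_comp hlip hF.continuous h0 (hvL n))
      (fun _ => hφL') (memLp_lipschitz_comp hlip hF.continuous h0 hu) hφL'
      (tendsto_eLpNorm_lipschitz_comp hlip hvu) (hzero _)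
  have hmeas : ∀ {w f : Space d → ℂ}, AEStronglyMeasurable w volume →
      AEStronglyMeasurable f volume →
      AEStronglyMeasurable (fun x => fderiv ℝ F (w x) (f x)) volume := fun {w f} hw hf =>
    (ContinuousLinearMap.id ℝ (ℂ →L[ℝ] ℂ)).aestronglyMeasurable_comp₂
      (hDc.comp_aestronglyMeasurable hw) hf
  have hDL : ∀ {w f : Space d → ℂ}, AEStronglyMeasurable w volume →
      MemLp f 2 volume → MemLp (fun x => fderiv ℝ F (w x) (f x)) 2 volume := fun {w f} hw hf =>
    hf.of_le_mul (hmeas hw hf.1) (.of_forall fun x => ContinuousLinearMap.le_of_opNorm_le _ (hK _) _)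
  have hR1 : Tendsto (fun n => ∫ x, fderiv ℝ F (v (ns n) x) (g x) * (φ x : ℂ)) atTop
      (𝓝 (∫ x, fderiv ℝ F (u x) (g x) * (φ x : ℂ))) := by
    refine tendsto_integral_of_dominated_convergence (fun x => K * ‖g x‖ * ‖(φ x : ℂ)‖)
      (fun n => (hmeas (hvL _).1 hg.1).mul hφL.1) ?_ (fun n => .of_forall fun x => ?_) ?_
    · have := (hg.norm.const_mul K).integrable_mul hφL.norm
      exact this
    · rw [norm_mul]
      gcongr
      exact ContinuousLinearMap.le_of_opNorm_le _ (hK _) _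
    · filter_upwards [hae] with x hx
      refine Tendsto.mul_const _ ?_
      exact ((ContinuousLinearMap.apply ℝ ℂ (g x)).continuous.tendsto _).comp ((hDc.tendsto _).comp hx)
  have hR2 : Tendsto (fun n => ∫ x, fderiv ℝ F (v n x) (pderiv i (v n) x - g x) * (φ x : ℂ)) atTop
      (𝓝 0) := by
    have h1 : Tendsto (fun n => eLpNorm ((fun x => fderiv ℝ F (v n x) (pderiv i (v n) x - g x)) - 0)
        2 volume) atTop (𝓝 0) := by
      have h2 := ENNReal.Tendsto.const_mul hvg (a := ENNReal.ofReal K) (Or.inr (by simp))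
      rw [mul_zero] at h2
      refine tendsto_of_tendsto_of_tendsto_of_le_of_le tendsto_const_nhds h2 (fun _ => zero_le)
        fun n => eLpNorm_le_mul_eLpNorm_of_ae_le_mul (.of_forall fun x => ?_) 2
      simp only [Pi.sub_apply, Pi.zero_apply, sub_zero]
      exact ContinuousLinearMap.le_of_opNorm_le _ (hK _) _
    have := tendsto_integral_mul (fun n => hDL (hvL n).1 ((hvL' n).sub hg)) (fun _ => hφL)
      (MemLp.zero' (p := 2)) hφL h1 (hzero _)
    simpa using! this
  have hR : Tendsto (fun n => ∫ x, fderiv ℝ F (v (ns n) x) (pderiv i (v (ns n)) x) * (φ x : ℂ)) atTop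
      (𝓝 (∫ x, fderiv ℝ F (u x) (g x) * (φ x : ℂ))) := by
    have := (hR2.comp hns.tendsto_atTop).add hR1
    rw [zero_add] at this
    refine this.congr fun n => ?_
    rw [Function.comp, ← integral_add]
    · refine integral_congr_ae (.of_forall fun x => ?_)
      simp only [map_sub]; ring
    · exact (hDL (hvL _).1 ((hvL' _).sub hg)).integrable_mul hφL
    · exact (hDL (hvL _).1 hg).integrable_mul hφL
  refine tendsto_nhds_unique (hL.comp hns.tendsto_atTop) ?_
  simp only [Function.comp_def, heq]
  exact hR.neg

/-- This variant serves F(z) = Φ(|z|²), whose derivative grows linearly, so that F(u) lies only in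
L¹. The derivative is a product of the Lipschitz function H(u) with g, and products of L²-convergent
sequences converge in L¹. -/
theorem IsWeakDeriv.comp_of_lipschitz_fderiv {u g : Space d → ℂ} {i : Fin (d + 1)}
    (hu : MemLp u 2 volume)
    (hg : MemLp g 2 volume) (hug : IsWeakDeriv univ i u g) {F : ℂ → ℝ} (hF : ContDiff ℝ 1 F)
    (h0 : F 0 = 0) {H : ℂ → ℂ} (hFH : ∀ z w, fderiv ℝ F z w = 2 * (star (H z) * w).re)
    (hH0 : H 0 = 0) (hHc : Continuous H) {K : ℝ} (hK : ∀ a b, ‖H a - H b‖ ≤ K * ‖a - b‖) :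
    IsWeakDeriv univ i (fun x => (F (u x) : ℂ))
      (fun x => ((2 * (star (H (u x)) * g x).re : ℝ) : ℂ)) := by
  intro φ hφ hs _
  obtain ⟨v, hv, hvL, hvL', hvu, hvg⟩ := exists_seq_smooth hu hg hug
  have hKn : 0 ≤ K := by simpa using (norm_nonneg _).trans (hK 1 0)
  have hφL := memLp_ofReal_of_hasCompactSupport hφ.continuous hs ⊤
  have hφL' := memLp_ofReal_of_hasCompactSupport (contDiff_pderiv hφ i).continuous (hs.pderiv i) ⊤
  -- Mean value inequality on the ball of radius ‖a‖ + ‖b‖, which contains both points and on which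
  -- the derivative is at most 2K(‖a‖ + ‖b‖).
  have hFlip : ∀ a b, ‖F a - F b‖ ≤ 2 * K * ((‖a‖ + ‖b‖) * ‖a - b‖) := by
    intro a b
    have := Convex.norm_image_sub_le_of_norm_fderiv_le (𝕜 := ℝ) (s := closedBall 0 (‖a‖ + ‖b‖))
      (f := F) (C := 2 * K * (‖a‖ + ‖b‖)) (x := b) (y := a)
      (fun z _ => hF.differentiable one_ne_zero z)
      (fun z hz => ?_) (convex_closedBall _ _) (by simp) (by simp)
    · linarith
    · refine ContinuousLinearMap.opNorm_le_bound _ (by positivity) fun w => ?_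
      rw [hFH, Real.norm_eq_abs, abs_mul]
      have h1 : |(star (H z) * w).re| ≤ ‖H z‖ * ‖w‖ := by
        refine (Complex.abs_re_le_norm _).trans_eq ?_
        simp
      have h2 : ‖H z‖ ≤ K * (‖a‖ + ‖b‖) := by
        have := hK z 0
        simp only [hH0, sub_zero] at this
        refine this.trans ?_
        gcongr
        simpa using hz
      calc |(2:ℝ)| * |(star (H z) * w).re| ≤ 2 * (K * (‖a‖ + ‖b‖) * ‖w‖) := by
            rw [abs_two]; gcongr; exact h1.trans (by gcongr)
        _ = _ := by ring
  have heq : ∀ n, ∫ x, (F (v n x) : ℂ) * ((pderiv i φ x : ℝ) : ℂ) =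
      -∫ x, ((2 * (star (H (v n x)) * pderiv i (v n) x).re : ℝ) : ℂ) * (φ x : ℂ) := by
    intro n
    have hFv : ContDiff ℝ 1 (F ∘ v n) := hF.comp ((hv n).of_le (by simp))
    have := isWeakDeriv_pderiv (Complex.ofRealCLM.contDiff.comp hFv) i φ hφ hs (subset_univ _)
    have e : ∀ x, pderiv i (Complex.ofRealCLM ∘ F ∘ v n) x
        = ((2 * (star (H (v n x)) * pderiv i (v n) x).re : ℝ) : ℂ) := by
      intro x
      have := pderiv_ofReal (hFv.differentiable one_ne_zero x) i
      refine this.trans ?_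
      rw [pderiv, fderiv_comp x (hF.differentiable one_ne_zero _)
        ((hv n).differentiable (by simp) x), ← hFH]
      rfl
    simpa only [e] using! this
  have hFm : ∀ {w : Space d → ℂ}, MemLp w 2 volume → MemLp (fun x => (F (w x) : ℂ)) 1 volume := by
    intro w hw
    have h1 : MemLp (fun x => ‖w x‖ * ‖w x‖) 1 volume := hw.norm.mul' hw.norm
    refine h1.of_le_mul (c := 2 * K) ((Complex.continuous_ofReal.comp
      hF.continuous).comp_aestronglyMeasurable hw.1) (.of_forall fun x => ?_)
    have := hFlip (w x) 0
    simpa [h0] using this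
  have hL : Tendsto (fun n => ∫ x, (F (v n x) : ℂ) * ((pderiv i φ x : ℝ) : ℂ)) atTop
      (𝓝 (∫ x, (F (u x) : ℂ) * ((pderiv i φ x : ℝ) : ℂ))) := by
    have h1 : Tendsto (fun n => eLpNorm ((fun x => (F (v n x) : ℂ)) - fun x => (F (u x) : ℂ)) 1 volume)
        atTop (𝓝 0) := by
      have h2 := tendsto_eLpNorm_one_mul (𝕜 := ℝ) (μ := (volume : Measure (Space d)))
        (a := fun n x => ‖v n x‖ + ‖u x‖) (b := fun n x => ‖v n x - u x‖)
        (a' := fun x => ‖u x‖ + ‖u x‖) (b' := 0) (fun n => (hvL n).norm.add hu.norm)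
        (fun n => ((hvL n).sub hu).norm) (hu.norm.add hu.norm) MemLp.zero ?_ ?_
      · rw [mul_zero] at h2
        have h3 := ENNReal.Tendsto.const_mul h2 (a := ENNReal.ofReal (2 * K)) (Or.inr ENNReal.ofReal_ne_top)
        rw [mul_zero] at h3
        refine tendsto_of_tendsto_of_tendsto_of_le_of_le tendsto_const_nhds h3 (fun _ => zero_le)
          fun n => eLpNorm_le_mul_eLpNorm_of_ae_le_mul (.of_forall fun x => ?_) 1
        have := hFlip (v n x) (u x)
        simp only [Pi.sub_apply, ← Complex.ofReal_sub, Complex.norm_real]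
        refine this.trans_eq ?_
        simp [abs_of_nonneg (add_nonneg (norm_nonneg (v n x)) (norm_nonneg (u x)))]
      · refine tendsto_of_tendsto_of_tendsto_of_le_of_le tendsto_const_nhds hvu (fun _ => zero_le)
          fun n => eLpNorm_mono fun x => ?_
        simpa using abs_norm_sub_norm_le (v n x) (u x)
      · refine hvu.congr fun n => ?_
        rw [sub_zero]
        exact (eLpNorm_norm (v n - u)).symm
    have hb := ENNReal.Tendsto.mul_const h1 (b := eLpNorm (fun x => ((pderiv i φ x : ℝ) : ℂ)) ⊤ volume)
      (Or.inr hφL'.eLpNorm_ne_top)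
    rw [zero_mul] at hb
    refine tendsto_integral_of_eLpNorm_one (fun n => ?_) ?_ ?_
    · exact memLp_one_iff_integrable.1 (hφL'.mul (p := 1) (hFm (hvL n)))
    · exact memLp_one_iff_integrable.1 (hφL'.mul (p := 1) (hFm hu))
    · refine tendsto_of_tendsto_of_tendsto_of_le_of_le tendsto_const_nhds hb (fun _ => zero_le)
          fun n => ?_
      have := eLpNorm_smul_le_mul_eLpNorm (𝕜 := ℂ) (p := 1) (q := ⊤) (r := 1) hφL'.1
        ((hFm (hvL n)).1.sub (hFm hu).1)
      refine (eLpNorm_congr_ae (.of_forall fun x => ?_)).trans_le this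
      simp [sub_mul]
  have hR : Tendsto (fun n => ∫ x, ((2 * (star (H (v n x)) * pderiv i (v n) x).re : ℝ) : ℂ) * (φ x : ℂ))
      atTop (𝓝 (∫ x, ((2 * (star (H (u x)) * g x).re : ℝ) : ℂ) * (φ x : ℂ))) := by
    have hsH : ∀ a b, ‖star (H a) - star (H b)‖ ≤ K * ‖a - b‖ := fun a b => by
      rw [← star_sub, norm_star]; exact hK a b
    have hsc : Continuous fun z => star (H z) := continuous_star.comp hHc
    have hs0 : star (H 0) = 0 := by simp [hH0]
    have hmul : ∀ {f : Space d → ℂ}, MemLp f 2 volume → MemLp (fun x => f x * (φ x : ℂ)) 2 volume :=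
      fun hf => hφL.mul' hf
    have ht := tendsto_integral_mul (μ := (volume : Measure (Space d)))
      (fun n => memLp_lipschitz_comp hsH hsc hs0 (hvL n))
      (fun n => hmul (hvL' n)) (memLp_lipschitz_comp hsH hsc hs0 hu) (hmul hg)
      (tendsto_eLpNorm_lipschitz_comp hsH hvu) ?_
    · have e : ∀ w f : Space d → ℂ, MemLp w 2 volume → MemLp f 2 volume →
          ∫ x, ((2 * (star (H (w x)) * f x).re : ℝ) : ℂ) * (φ x : ℂ) =
          ((2 * (∫ x, star (H (w x)) * (f x * (φ x : ℂ))).re : ℝ) : ℂ) := by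
        intro w f hw hf
        have hi : Integrable (fun x => star (H (w x)) * (f x * (φ x : ℂ))) volume :=
          (memLp_lipschitz_comp hsH hsc hs0 hw).integrable_mul (hmul hf)
        have h1 := integral_re hi
        simp only [RCLike.re_to_complex] at h1
        rw [← h1, ← integral_const_mul, ← integral_complex_ofReal]
        refine integral_congr_ae (.of_forall fun x => ?_)
        simp only [← Complex.ofReal_mul, ← mul_assoc, Complex.re_mul_ofReal]
      simp only [e _ _ (hvL _) (hvL' _), e _ _ hu hg]
      exact ((Complex.continuous_ofReal.comp (continuous_const.mul Complex.continuous_re)).tendsto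
        _).comp ht
    · have hb := ENNReal.Tendsto.mul_const hvg (b := eLpNorm (fun x => (φ x : ℂ)) ⊤ volume)
        (Or.inr hφL.eLpNorm_ne_top)
      rw [zero_mul] at hb
      refine tendsto_of_tendsto_of_tendsto_of_le_of_le tendsto_const_nhds hb (fun _ => zero_le)
          fun n => ?_
      have := eLpNorm_smul_le_mul_eLpNorm (𝕜 := ℂ) (p := 2) (q := ⊤) (r := 2) hφL.1
        ((hvL' n).1.sub hg.1)
      refine (eLpNorm_congr_ae (.of_forall fun x => ?_)).trans_le this
      simp [sub_mul]
  refine tendsto_nhds_unique hL ?_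
  simp only [heq]
  exact hR.neg

/-! ### Cutoffs and localisation of weak derivatives -/

theorem isOpen_halfSpace : IsOpen (halfSpace d) :=
  isOpen_lt continuous_const (by fun_prop)

theorem isOpen_strip (h : ℝ) : IsOpen (strip d h) :=
  (isOpen_halfSpace (d := d)).inter
    (isOpen_lt (f := fun x : Space d => x 0) (by fun_prop) continuous_const)

theorem exists_smooth_cutoff {K Ω : Set (Space d)} (hK : IsCompact K) (hΩ : IsOpen Ω)
    (hKΩ : K ⊆ Ω) :
    ∃ χ : Space d → ℝ, ContDiff ℝ ∞ χ ∧ HasCompactSupport χ ∧ tsupport χ ⊆ Ω ∧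
      ∀ᶠ x in 𝓝ˢ K, χ x = 1 := by
  obtain ⟨K', hK', hKK', hK'Ω⟩ := exists_compact_between hK hΩ hKΩ
  obtain ⟨f, hf1, hf0, hf⟩ := exists_contMDiffMap_one_nhds_of_subset_interior 𝓘(ℝ, Space d)
    (n := (⊤ : ℕ∞)) hK.isClosed hKK'
  have hs : tsupport f ⊆ K' := closure_minimal (fun x hx => by
    by_contra h
    exact hx (hf0 x h)) hK'.isClosed
  exact ⟨f, f.contMDiff.contDiff, hK'.of_isClosed_subset (isClosed_tsupport _) hs, hs.trans hK'Ω,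
    hf1⟩

theorem pderiv_mul {φ ψ : Space d → ℝ} (hφ : ContDiff ℝ ∞ φ) (hψ : ContDiff ℝ ∞ ψ)
    (i : Fin (d + 1)) (x : Space d) :
    pderiv i (fun x => φ x * ψ x) x = φ x * pderiv i ψ x + pderiv i φ x * ψ x := by
  rw [pderiv, fderiv_fun_mul (hφ.differentiable (by simp) x) (hψ.differentiable (by simp) x)]
  simp [pderiv, mul_comm]

theorem LocallyIntegrable.integrable_mul_ofReal {w : Space d → ℂ}
    (hw : LocallyIntegrable w volume) {φ : Space d → ℝ} (hφ : Continuous φ)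
    (hs : HasCompactSupport φ) : Integrable (fun x => w x * (φ x : ℂ)) volume := by
  have := hw.integrable_smul_right_of_hasCompactSupport
    (Complex.continuous_ofReal.comp hφ) (hs.comp_left (g := fun r : ℝ => (r : ℂ)) (by simp))
  exact this

/-- The pair (w, g) is tested with ψφ, which is supported in Ω for every φ. Multiplying by a cutoff
thus turns a derivative in Ω into one on the whole space, where mollification is available. -/
theorem IsWeakDeriv.mul_smooth {Ω : Set (Space d)} {i : Fin (d + 1)} {w g : Space d → ℂ}
    (h : IsWeakDeriv Ω i w g) (hw : LocallyIntegrable w volume) (hg : LocallyIntegrable g volume)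
    {ψ : Space d → ℝ} (hψ : ContDiff ℝ ∞ ψ) (hs : HasCompactSupport ψ) (hψΩ : tsupport ψ ⊆ Ω) :
    IsWeakDeriv univ i (fun x => w x * (ψ x : ℂ))
      (fun x => g x * (ψ x : ℂ) + w x * ((pderiv i ψ x : ℝ) : ℂ)) := by
  intro φ hφ hφs _
  have h1 := h (fun x => ψ x * φ x) (hψ.mul hφ) hs.mul_right
    ((tsupport_mul_subset_left).trans hψΩ)
  have hψ' := contDiff_pderiv hψ i
  have hφ' := contDiff_pderiv hφ i
  have i1 := LocallyIntegrable.integrable_mul_ofReal hw (φ := fun x => ψ x * pderiv i φ x)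
    (hψ.continuous.mul hφ'.continuous) hs.mul_right
  have i2 := LocallyIntegrable.integrable_mul_ofReal hw (φ := fun x => pderiv i ψ x * φ x)
    (hψ'.continuous.mul hφ.continuous) hφs.mul_left
  have i3 := LocallyIntegrable.integrable_mul_ofReal hg (φ := fun x => ψ x * φ x)
    (hψ.continuous.mul hφ.continuous) hs.mul_right
  simp only [pderiv_mul hψ hφ, Complex.ofReal_add, Complex.ofReal_mul, mul_add] at h1 i1 i2 i3
  rw [integral_add i1 i2] at h1
  have e1 : ∫ x, w x * (ψ x : ℂ) * ((pderiv i φ x : ℝ) : ℂ) =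
      ∫ x, w x * ((ψ x : ℂ) * ((pderiv i φ x : ℝ) : ℂ)) := by simp only [mul_assoc]
  have e2 : ∫ x, (g x * (ψ x : ℂ) + w x * ((pderiv i ψ x : ℝ) : ℂ)) * (φ x : ℂ) =
      (∫ x, g x * ((ψ x : ℂ) * (φ x : ℂ))) + ∫ x, w x * (((pderiv i ψ x : ℝ) : ℂ) * (φ x : ℂ)) := by
    rw [← integral_add i3 i2]
    simp only [add_mul, mul_assoc]
  rw [e1, e2, eq_sub_of_add_eq h1]
  ring

theorem memLp_mul_smooth {w : Space d → ℂ}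
    (hw : ∀ R : ℝ, MemLp w 2 (volume.restrict (ball 0 R)))
    {ψ : Space d → ℝ} (hψ : Continuous ψ) (hs : HasCompactSupport ψ) :
    MemLp (fun x => w x * (ψ x : ℂ)) 2 volume := by
  obtain ⟨R, hR⟩ := hs.isCompact.isBounded.subset_ball (0 : Space d)
  have h1 := (memLp_ofReal_of_hasCompactSupport hψ hs ⊤)
  have h2 : MemLp (fun x => w x * (ψ x : ℂ)) 2 (volume.restrict (ball 0 R)) :=
    (h1.restrict _).mul' (hw R)
  have h3 := (memLp_indicator_iff_restrict measurableSet_ball).2 h2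
  refine h3.ae_eq (.of_forall fun x => ?_)
  by_cases hx : x ∈ ball 0 R
  · simp [indicator_of_mem hx]
  · simp [indicator_of_notMem hx, image_eq_zero_of_notMem_tsupport (fun h => hx (hR h))]

theorem locallyIntegrable_of_memLp_ball {w : Space d → ℂ}
    (hw : ∀ R : ℝ, MemLp w 2 (volume.restrict (ball 0 R))) : LocallyIntegrable w volume := by
  intro x
  refine ⟨ball 0 (‖x‖ + 1), isOpen_ball.mem_nhds (by simp), ?_⟩
  have : IsFiniteMeasure (volume.restrict (ball (0 : Space d) (‖x‖ + 1))) :=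
    ⟨by simpa using measure_ball_lt_top⟩
  exact (hw _).integrable (by norm_num)

/-- Localisation principle for nonlinear chain rules: if `T` maps globally weakly differentiable pairs
to weakly differentiable pairs, it does so for locally `L²` pairs. -/
theorem IsWeakDeriv.localize {Ω : Set (Space d)} (hΩ : IsOpen Ω) {i : Fin (d + 1)}
    {u g : Space d → ℂ} (hu : ∀ R : ℝ, MemLp u 2 (volume.restrict (ball 0 R)))
    (hg : MemLp g 2 volume) (hug : IsWeakDeriv Ω i u g) (T : ℂ → ℂ) (T' : ℂ → ℂ → ℂ)
    (hT : ∀ v k : Space d → ℂ, MemLp v 2 volume → MemLp k 2 volume → IsWeakDeriv univ i v k →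
      IsWeakDeriv univ i (fun x => T (v x)) (fun x => T' (v x) (k x))) :
    IsWeakDeriv Ω i (fun x => T (u x)) (fun x => T' (u x) (g x)) := by
  intro φ hφ hs hφΩ
  -- The cutoff is 1 in a neighbourhood of the support of φ, so its gradient vanishes there, and
  -- replacing u by χu changes neither side of the identity tested by φ.
  obtain ⟨χ, hχ, hχs, hχΩ, hχ1⟩ := exists_smooth_cutoff hs hΩ hφΩ
  have hχ' : ∀ x ∈ tsupport φ, χ x = 1 ∧ pderiv i χ x = 0 := by
    intro x hx
    have h1 : χ =ᶠ[𝓝 x] fun _ => 1 := (eventually_nhdsSet_iff_forall.1 hχ1) x hx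
    refine ⟨h1.eq_of_nhds, ?_⟩
    rw [pderiv, h1.fderiv_eq]
    simp
  have hgl := hg.locallyIntegrable (by norm_num : (1 : ℝ≥0∞) ≤ 2)
  have hgr : ∀ R : ℝ, MemLp g 2 (volume.restrict (ball 0 R)) := fun R => hg.restrict _
  have := hT _ _ (memLp_mul_smooth hu hχ.continuous hχs) ((memLp_mul_smooth hgr hχ.continuous hχs).add
    (memLp_mul_smooth hu (contDiff_pderiv hχ i).continuous (hχs.pderiv i)))
    (hug.mul_smooth (locallyIntegrable_of_memLp_ball hu) hgl hχ hχs hχΩ) φ hφ hs (subset_univ _)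
  convert this using 1
  · refine integral_congr_ae (.of_forall fun x => ?_)
    by_cases hx : x ∈ tsupport φ
    · simp [(hχ' x hx).1]
    · simp [image_eq_zero_of_notMem_tsupport (fun h => hx (tsupport_pderiv_subset φ i h))]
  · congr 1
    refine integral_congr_ae (.of_forall fun x => ?_)
    by_cases hx : x ∈ tsupport φ
    · simp [(hχ' x hx).1, (hχ' x hx).2]
    · simp [image_eq_zero_of_notMem_tsupport hx]

/-! ### Extension of the solution by zero above the strip -/

/-- The extension by zero of an energy solution to the half-space. -/
structure IsExtendedSolution (A : Space d → Matrix (Fin (d + 1)) (Fin (d + 1)) ℂ)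
    (B : Space d → Fin (d + 1) → ℂ) (h : ℝ) (U : Space d → ℂ) (G : Space d → CVec d) : Prop where
  contDiffOn_A : ∀ i j, ContDiffOn ℝ ∞ (fun x => A x i j) (halfSpace d)
  contDiffOn_B : ∀ i, ContDiffOn ℝ ∞ (fun x => B x i) (halfSpace d)
  measurable : Measurable U
  measurable_grad : Measurable G
  memLp_loc : ∀ R : ℝ, MemLp U 2 (volume.restrict (ball 0 R))
  memLp_grad : MemLp G 2 volume
  eq_zero : ∀ x ∉ strip d h, U x = 0 ∧ G x = 0
  weakDeriv : ∀ i, IsWeakDeriv (halfSpace d) i U (fun x => G x i)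
  weakSolution : IsWeakSolution A B (strip d h) G

namespace IsExtendedSolution

variable {A : Space d → Matrix (Fin (d + 1)) (Fin (d + 1)) ℂ} {B : Space d → Fin (d + 1) → ℂ}
  {h : ℝ} {U : Space d → ℂ} {G : Space d → CVec d}

theorem memLp_grad_apply (hU : IsExtendedSolution A B h U G) (i : Fin (d + 1)) :
    MemLp (fun x => G x i) 2 volume :=
  hU.memLp_grad.of_le ((by fun_prop : Continuous fun v : CVec d => v i).comp_aestronglyMeasurable
    hU.memLp_grad.1) (.of_forall fun x => PiLp.norm_apply_le _ _)

theorem isWeakDeriv_comp_of_bounded (hU : IsExtendedSolution A B h U G) (i : Fin (d + 1))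
    {F : ℂ → ℂ} (hF : ContDiff ℝ 1 F) (h0 : F 0 = 0) {K : ℝ} (hK : ∀ z, ‖fderiv ℝ F z‖ ≤ K) :
    IsWeakDeriv (halfSpace d) i (fun x => F (U x)) (fun x => fderiv ℝ F (U x) (G x i)) :=
  (hU.weakDeriv i).localize isOpen_halfSpace hU.memLp_loc (hU.memLp_grad_apply i) F
    (fun z w => fderiv ℝ F z w) fun _ _ hv hk hvk => hvk.comp_of_bounded hv hk hF h0 hK

theorem isWeakDeriv_comp_of_lipschitz_fderiv (hU : IsExtendedSolution A B h U G) (i : Fin (d + 1))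
    {F : ℂ → ℝ} (hF : ContDiff ℝ 1 F)
    (h0 : F 0 = 0) {H : ℂ → ℂ} (hFH : ∀ z w, fderiv ℝ F z w = 2 * (star (H z) * w).re)
    (hH0 : H 0 = 0) (hHc : Continuous H) {K : ℝ} (hK : ∀ a b, ‖H a - H b‖ ≤ K * ‖a - b‖) :
    IsWeakDeriv (halfSpace d) i (fun x => (F (U x) : ℂ))
      (fun x => ((2 * (star (H (U x)) * G x i).re : ℝ) : ℂ)) :=
  (hU.weakDeriv i).localize isOpen_halfSpace hU.memLp_loc (hU.memLp_grad_apply i)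
    (fun z => (F z : ℂ)) (fun z w => ((2 * (star (H z) * w).re : ℝ) : ℂ))
    fun _ _ hv hk hvk => hvk.comp_of_lipschitz_fderiv hv hk hF h0 hFH hH0 hHc hK

end IsExtendedSolution

theorem setIntegral_eq_integral_indicator_mul {s : Set (Space d)} (hs : MeasurableSet s)
    (u w : Space d → ℂ) : ∫ x, s.indicator u x * w x = ∫ x in s, u x * w x := by
  rw [← integral_indicator hs]
  congr 1
  ext x
  by_cases hx : x ∈ s <;> simp [hx]

/-- Tangential derivatives cross the top of the strip without any trace condition: cutoffs near {x₀
= h} can be chosen to depend on x₀ only, so that ∂_i does not see them for i ≠ 0. -/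
theorem isWeakDeriv_succ_of_strip {h : ℝ} {u g : Space d → ℂ} {i : Fin (d + 1)} (hi : i ≠ 0)
    (hu : LocallyIntegrable ((strip d h).indicator u) volume)
    (hg : LocallyIntegrable ((strip d h).indicator g) volume)
    (hw : IsWeakDeriv (strip d h) i ((strip d h).indicator u) ((strip d h).indicator g)) :
    IsWeakDeriv (halfSpace d) i ((strip d h).indicator u) ((strip d h).indicator g) := by
  intro φ hφ hs hφΩ
  -- θ_n vanishes within distance 1/n of the top or above it, and is 1 at depth at least 2/n.
  let θ : ℕ → Space d → ℝ := fun n x => Real.smoothTransition (n * (h - x 0) - 1)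
  have hθ : ∀ n, ContDiff ℝ ∞ (θ n) := fun n =>
    Real.smoothTransition.contDiff.comp (by fun_prop)
  have hθ' : ∀ n x, pderiv i (θ n) x = 0 := by
    intro n x
    have : HasFDerivAt (fun x : Space d => n * (h - x 0) - 1)
        (-((n : ℝ) • (EuclideanSpace.proj (0 : Fin (d + 1)) : Space d →L[ℝ] ℝ))) x := by
      have h1 := (EuclideanSpace.proj (𝕜 := ℝ) (0 : Fin (d + 1))).hasFDerivAt (x := x)
      have h2 := ((h1.const_sub h).const_mul (n : ℝ)).sub_const 1
      convert! h2 using 1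
      simp
    have h3 := ((Real.smoothTransition.contDiff (n := 1)).differentiable one_ne_zero _).hasFDerivAt.comp x this
    have h4 : HasFDerivAt (θ n) _ x := h3
    rw [pderiv, h4.fderiv]
    simp [hi.symm]
  have hθ1 : ∀ n x, |θ n x| ≤ 1 := fun n x => by
    rw [abs_of_nonneg (Real.smoothTransition.nonneg _)]; exact Real.smoothTransition.le_one _
  have hlim : ∀ x ∈ strip d h, Tendsto (fun n => θ n x) atTop (𝓝 1) := by
    intro x hx
    obtain ⟨N, hN⟩ := exists_nat_gt (2 / (h - x 0))
    have hpos : 0 < h - x 0 := sub_pos.2 hx.2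
    refine tendsto_const_nhds.congr' ?_
    filter_upwards [eventually_ge_atTop N] with n hn
    refine (Real.smoothTransition.one_of_one_le ?_).symm
    have : 2 ≤ (N : ℝ) * (h - x 0) := by
      rw [div_lt_iff₀ hpos] at hN; exact hN.le
    have : (N : ℝ) * (h - x 0) ≤ n * (h - x 0) := by gcongr
    linarith
  have hlim' : ∀ (w : Space d → ℂ) (ψ : Space d → ℝ), Continuous ψ → HasCompactSupport ψ →
      LocallyIntegrable ((strip d h).indicator w) volume →
      Tendsto (fun n => ∫ x, (strip d h).indicator w x * ((ψ x * θ n x : ℝ) : ℂ)) atTop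
        (𝓝 (∫ x, (strip d h).indicator w x * (ψ x : ℂ))) := by
    intro w ψ hψ hψs hwl
    have hint := LocallyIntegrable.integrable_mul_ofReal hwl hψ hψs
    refine tendsto_integral_of_dominated_convergence (fun x => ‖(strip d h).indicator w x * (ψ x : ℂ)‖)
      (fun n => (LocallyIntegrable.integrable_mul_ofReal hwl (hψ.mul (hθ n).continuous)
        hψs.mul_right).1) hint.norm (fun n => .of_forall fun x => ?_) (.of_forall fun x => ?_)
    · simp only [norm_mul, Complex.norm_real, Real.norm_eq_abs]
      rw [← mul_assoc]
      exact mul_le_of_le_one_right (by positivity) (hθ1 n x)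
    · by_cases hx : x ∈ strip d h
      · refine Tendsto.const_mul _ ((Complex.continuous_ofReal.tendsto _).comp ?_)
        simpa using (hlim x hx).const_mul (ψ x)
      · simp [hx]
  refine tendsto_nhds_unique (hlim' u _ (contDiff_pderiv hφ i).continuous (hs.pderiv i) hu)
    (Tendsto.congr' ?_ (hlim' g φ hφ.continuous hs hg).neg)
  filter_upwards [eventually_gt_atTop 0] with n hn
  have := hw (fun x => φ x * θ n x) (hφ.mul (hθ n)) hs.mul_right ?_
  · rw [← this]
    refine integral_congr_ae (.of_forall fun x => ?_)
    simp [pderiv_mul hφ (hθ n), hθ']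
  · intro x hx
    refine ⟨hφΩ (tsupport_mul_subset_left hx), ?_⟩
    have hcl : IsClosed {x : Space d | 1 ≤ n * (h - x 0)} := isClosed_le continuous_const (by fun_prop)
    have hsub : tsupport (fun x => φ x * θ n x) ⊆ {x : Space d | 1 ≤ n * (h - x 0)} := by
      refine closure_minimal (fun y hy => ?_) hcl
      by_contra hlt
      simp only [mem_ofPred_eq, not_le] at hlt
      exact hy (by simp [θ, Real.smoothTransition.zero_of_nonpos (by linarith : (n:ℝ) * (h - y 0) - 1 ≤ 0)])
    have h1 : 1 ≤ n * (h - x 0) := hsub hx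
    have hn' : (0:ℝ) < n := by exact_mod_cast hn
    by_contra hge
    have : (n:ℝ) * (h - x 0) ≤ 0 := mul_nonpos_of_nonneg_of_nonpos hn'.le (by linarith)
    linarith

/-- For the derivative in x₀, Green's formula has no contribution from the top because the datum
there is 0, and none from the bottom because the test functions are supported in the open
half-space. Passing to measurable representatives also makes the vanishing outside the strip hold at
every point. -/
theorem IsEnergySolution.exists_isExtendedSolution
    {A : Space d → Matrix (Fin (d + 1)) (Fin (d + 1)) ℂ}
    {B : Space d → Fin (d + 1) → ℂ} {h : ℝ} {u : Space d → ℂ} {G : Space d → CVec d}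
    {f : Bdry d → ℂ}
    (hA : ∀ i j, ContDiffOn ℝ ∞ (fun x => A x i j) (halfSpace d))
    (hB : ∀ i, ContDiffOn ℝ ∞ (fun x => B x i) (halfSpace d))
    (hu : IsEnergySolution A B h u G f) :
    ∃ U' G', IsExtendedSolution A B h U' G' ∧ U' =ᵐ[volume] (strip d h).indicator u ∧
      G' =ᵐ[volume] (strip d h).indicator G := by
  have hms : MeasurableSet (strip d h) := (isOpen_strip h).measurableSet
  have hum : AEStronglyMeasurable u (volume.restrict (strip d h)) := by
    have h1 := (aestronglyMeasurable_iUnion_iff (f := u) (μ := (volume : Measure (Space d)))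
      (s := fun n : ℕ => strip d h ∩ ball 0 n)).2 fun n => (hu.memLp_loc n).1
    rwa [← inter_iUnion, iUnion_ball_nat, inter_univ] at h1
  have hGm := hu.memLp_grad.1
  set U' := (strip d h).indicator (hum.mk u) with hU'
  set G' := (strip d h).indicator (hGm.mk G) with hG'
  have eU : U' =ᵐ[volume] (strip d h).indicator u :=
    ((ae_eq_restrict_iff_indicator_ae_eq hms).1 hum.ae_eq_mk).symm
  have eG : G' =ᵐ[volume] (strip d h).indicator G :=
    ((ae_eq_restrict_iff_indicator_ae_eq hms).1 hGm.ae_eq_mk).symm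
  have hloc : ∀ R : ℝ, MemLp ((strip d h).indicator u) 2 (volume.restrict (ball 0 R)) := fun R => by
    rw [memLp_indicator_iff_restrict hms, Measure.restrict_restrict hms]
    exact hu.memLp_loc R
  have hgrad : MemLp ((strip d h).indicator G) 2 volume :=
    (memLp_indicator_iff_restrict hms).2 hu.memLp_grad
  have hgradi : ∀ i, MemLp ((strip d h).indicator fun x => G x i) 2 volume := fun i => by
    refine (memLp_indicator_iff_restrict hms).2 (hu.memLp_grad.of_le
      ((by fun_prop : Continuous fun v : CVec d => v i).comp_aestronglyMeasurable hGm)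
      (.of_forall fun x => PiLp.norm_apply_le _ _))
  have hul := locallyIntegrable_of_memLp_ball hloc
  have hgl := fun i => (hgradi i).locallyIntegrable (by norm_num : (1 : ℝ≥0∞) ≤ 2)
  have hstrip : ∀ i, IsWeakDeriv (strip d h) i ((strip d h).indicator u)
      ((strip d h).indicator fun x => G x i) := by
    intro i φ hφ hs hφΩ
    rw [setIntegral_eq_integral_indicator_mul hms, setIntegral_eq_integral_indicator_mul hms]
    exact hu.weakGradient φ hφ hs hφΩ i
  have hweak : ∀ i, IsWeakDeriv (halfSpace d) i ((strip d h).indicator u)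
      ((strip d h).indicator fun x => G x i) := by
    intro i
    rcases eq_or_ne i 0 with rfl | hi
    · intro φ hφ hs hφΩ
      have h1 := hu.traces φ hφ hs
      have h0 : ∀ x' : Bdry d, φ (atHeight 0 x') = 0 := fun x' =>
        image_eq_zero_of_notMem_tsupport fun hx => by
          have := hφΩ hx
          simp [halfSpace, atHeight] at this
      simp only [Pi.zero_apply, zero_mul, integral_zero, h0, Complex.ofReal_zero, mul_zero,
        sub_zero] at h1
      rw [setIntegral_eq_integral_indicator_mul hms, setIntegral_eq_integral_indicator_mul hms,
        eq_neg_iff_add_eq_zero, ← integral_add, h1]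
      · have := LocallyIntegrable.integrable_mul_ofReal hul (contDiff_pderiv hφ 0).continuous (hs.pderiv 0)
        rw [← integrableOn_univ] at this
        have := this.mono_set (subset_univ (strip d h))
        refine this.congr_fun (fun x hx => ?_) hms
        simp [hx]
      · have := LocallyIntegrable.integrable_mul_ofReal (hgl 0) hφ.continuous hs
        rw [← integrableOn_univ] at this
        have := this.mono_set (subset_univ (strip d h))
        refine this.congr_fun (fun x hx => ?_) hms
        simp [hx]
    · exact isWeakDeriv_succ_of_strip hi hul (hgl i) (hstrip i)
  refine ⟨U', G', ⟨hA, hB, hum.stronglyMeasurable_mk.measurable.indicator hms,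
    hGm.stronglyMeasurable_mk.measurable.indicator hms,
    fun R => (hloc R).ae_eq (ae_restrict_of_ae eU.symm), hgrad.ae_eq eG.symm,
    fun x hx => by simp [hU', hG', hx], fun i φ hφ hs hφΩ => ?_, fun φ hφ hs hφΩ => ?_⟩, eU, eG⟩
  · have := hweak i φ hφ hs hφΩ
    rw [integral_congr_ae (g := fun x => (strip d h).indicator u x * ((pderiv i φ x : ℝ) : ℂ))
      (eU.mono fun x hx => by simp only [hx]), this,
      integral_congr_ae (eG.mono fun x hx => ?_)]
    simp only [hx]
    by_cases hx : x ∈ strip d h <;> simp [hx]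
  · rw [← hu.weakSolution φ hφ hs hφΩ]
    refine setIntegral_congr_ae hms (eG.mono fun x hx hxs => ?_)
    simp only [hx, indicator_of_mem hxs]

/-! ### Admissible test functions for the equation -/

theorem memLp_indicator_mul {Ω K : Set (Space d)} (hK : IsCompact K) (hKΩ : K ⊆ Ω)
    {c g : Space d → ℂ} (hc : ContinuousOn c Ω) (hg : MemLp g 2 volume) :
    MemLp (K.indicator fun x => c x * g x) 2 volume := by
  have hcK := hc.mono hKΩ
  obtain ⟨C, hC⟩ := hK.exists_bound_of_continuousOn hcK
  have h1 : MemLp (K.indicator c) ⊤ volume := by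
    refine memLp_top_of_bound ((aestronglyMeasurable_indicator_iff hK.measurableSet).2
      (hcK.aestronglyMeasurable hK.measurableSet)) (max C 0) (.of_forall fun x => ?_)
    by_cases hx : x ∈ K
    · simpa [hx] using Or.inl (hC x hx)
    · simp [hx]
  refine (h1.mul' (r := 2) hg).ae_eq (.of_forall fun x => ?_)
  by_cases hx : x ∈ K <;> simp [hx, mul_comm]

theorem pderiv_re {φ : Space d → ℂ} {x : Space d} (hφ : DifferentiableAt ℝ φ x)
    (i : Fin (d + 1)) : pderiv i (fun x => (φ x).re) x = (pderiv i φ x).re := by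
  have h2 : HasFDerivAt (fun x => (φ x).re) (Complex.reCLM.comp (fderiv ℝ φ x)) x :=
    (Complex.reCLM.hasFDerivAt (x := φ x)).comp x hφ.hasFDerivAt
  rw [pderiv, h2.fderiv]
  rfl

theorem pderiv_im {φ : Space d → ℂ} {x : Space d} (hφ : DifferentiableAt ℝ φ x)
    (i : Fin (d + 1)) : pderiv i (fun x => (φ x).im) x = (pderiv i φ x).im := by
  have h2 : HasFDerivAt (fun x => (φ x).im) (Complex.imCLM.comp (fderiv ℝ φ x)) x :=
    (Complex.imCLM.hasFDerivAt (x := φ x)).comp x hφ.hasFDerivAt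
  rw [pderiv, h2.fderiv]
  rfl

theorem tsupport_mollify_subset {ρ : Space d → ℝ} {V : Space d → ℂ} {L : Set (Space d)}
    (hρs : HasCompactSupport ρ) (hL : IsClosed L) (hV : ∀ x ∉ L, V x = 0) :
    tsupport (mollify ρ V) ⊆ tsupport ρ + L := by
  refine closure_minimal ((support_convolution_subset _).trans
    (add_subset_add subset_closure fun x hx => ?_)) (hL.add_left_of_isCompact hρs.isCompact)
  by_contra h
  exact hx (hV x h)

namespace IsExtendedSolution

variable {A : Space d → Matrix (Fin (d + 1)) (Fin (d + 1)) ℂ} {B : Space d → Fin (d + 1) → ℂ}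
  {h : ℝ} {U : Space d → ℂ} {G : Space d → CVec d}

theorem memLp_flux (hU : IsExtendedSolution A B h U G) {K : Set (Space d)} (hK : IsCompact K)
    (hKΩ : K ⊆ halfSpace d) (i : Fin (d + 1)) :
    MemLp (K.indicator fun x => ∑ j, A x i j * G x j) 2 volume := by
  have := memLp_finsetSum Finset.univ fun j _ => memLp_indicator_mul hK hKΩ
    (hU.contDiffOn_A i j).continuousOn (hU.memLp_grad_apply j)
  refine this.ae_eq (.of_forall fun x => ?_)
  by_cases hx : x ∈ K <;> simp [hx]

theorem memLp_drift (hU : IsExtendedSolution A B h U G) {K : Set (Space d)} (hK : IsCompact K)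
    (hKΩ : K ⊆ halfSpace d) :
    MemLp (K.indicator fun x => ∑ j, B x j * G x j) 2 volume := by
  have := memLp_finsetSum Finset.univ fun j _ => memLp_indicator_mul hK hKΩ
    (hU.contDiffOn_B j).continuousOn (hU.memLp_grad_apply j)
  refine this.ae_eq (.of_forall fun x => ?_)
  by_cases hx : x ∈ K <;> simp [hx]

theorem integral_test_real (hU : IsExtendedSolution A B h U G) {K : Set (Space d)}
    {φ : Space d → ℝ}
    (hφ : ContDiff ℝ ∞ φ) (hs : HasCompactSupport φ) (hφΩ : tsupport φ ⊆ strip d h)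
    (hφK : tsupport φ ⊆ K) :
    ∫ x, ((∑ i, K.indicator (fun x => ∑ j, A x i j * G x j) x * ((pderiv i φ x : ℝ) : ℂ)) -
      K.indicator (fun x => ∑ i, B x i * G x i) x * (φ x : ℂ)) = 0 := by
  rw [← hU.weakSolution φ hφ hs hφΩ, ← integral_indicator (isOpen_strip h).measurableSet]
  refine integral_congr_ae (.of_forall fun x => ?_)
  by_cases hx : x ∈ tsupport φ
  · simp [hφΩ hx, hφK hx, Finset.sum_mul]
  · have h1 : ∀ i, pderiv i φ x = 0 := fun i =>
      image_eq_zero_of_notMem_tsupport fun h => hx (tsupport_pderiv_subset φ i h)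
    by_cases hxs : x ∈ strip d h <;> simp [h1, image_eq_zero_of_notMem_tsupport hx, hxs]

theorem integral_test_complex (hU : IsExtendedSolution A B h U G) {K : Set (Space d)}
    (hK : IsCompact K) (hKΩ : K ⊆ halfSpace d) {φ : Space d → ℂ}
    (hφ : ContDiff ℝ ∞ φ) (hφΩ : tsupport φ ⊆ strip d h) (hφK : tsupport φ ⊆ K) :
    ∫ x, ((∑ i, K.indicator (fun x => ∑ j, A x i j * G x j) x * pderiv i φ x) -
      K.indicator (fun x => ∑ i, B x i * G x i) x * φ x) = 0 := by
  have hs : HasCompactSupport φ := hK.of_isClosed_subset (isClosed_tsupport _) hφK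
  have hi : ∀ ψ : Space d → ℝ, ContDiff ℝ ∞ ψ → HasCompactSupport ψ →
      Integrable (fun x => (∑ i, K.indicator (fun x => ∑ j, A x i j * G x j) x *
        ((pderiv i ψ x : ℝ) : ℂ)) - K.indicator (fun x => ∑ i, B x i * G x i) x * (ψ x : ℂ))
        volume := fun ψ hψ hψs => by
    refine Integrable.sub (integrable_finsetSum _ fun i _ => ?_) ?_
    · exact (hU.memLp_flux hK hKΩ i).integrable_mul
        (memLp_ofReal_of_hasCompactSupport (contDiff_pderiv hψ i).continuous (hψs.pderiv i) 2)
    · exact (hU.memLp_drift hK hKΩ).integrable_mul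
        (memLp_ofReal_of_hasCompactSupport hψ.continuous hψs 2)
  have hre : ContDiff ℝ ∞ (fun x => (φ x).re) := Complex.reCLM.contDiff.comp hφ
  have him : ContDiff ℝ ∞ (fun x => (φ x).im) := Complex.imCLM.contDiff.comp hφ
  have tre : tsupport (fun x => (φ x).re) ⊆ tsupport φ := tsupport_comp_subset Complex.zero_re φ
  have tim : tsupport (fun x => (φ x).im) ⊆ tsupport φ := tsupport_comp_subset Complex.zero_im φ
  have sre : HasCompactSupport (fun x => (φ x).re) := hs.comp_left Complex.zero_re
  have sim : HasCompactSupport (fun x => (φ x).im) := hs.comp_left Complex.zero_im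
  have h1 := hU.integral_test_real hre sre (tre.trans hφΩ) (tre.trans hφK)
  have h2 := hU.integral_test_real him sim (tim.trans hφΩ) (tim.trans hφK)
  have h3 : ∀ x, (∑ i, K.indicator (fun x => ∑ j, A x i j * G x j) x * pderiv i φ x) -
      K.indicator (fun x => ∑ i, B x i * G x i) x * φ x =
      ((∑ i, K.indicator (fun x => ∑ j, A x i j * G x j) x *
        ((pderiv i (fun x => (φ x).re) x : ℝ) : ℂ)) -
        K.indicator (fun x => ∑ i, B x i * G x i) x * ((φ x).re : ℂ)) +
      ((∑ i, K.indicator (fun x => ∑ j, A x i j * G x j) x *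
        ((pderiv i (fun x => (φ x).im) x : ℝ) : ℂ)) -
        K.indicator (fun x => ∑ i, B x i * G x i) x * ((φ x).im : ℂ)) * Complex.I := by
    intro x
    have e : ∀ i, K.indicator (fun x => ∑ j, A x i j * G x j) x * pderiv i φ x =
        K.indicator (fun x => ∑ j, A x i j * G x j) x * ((pderiv i (fun x => (φ x).re) x : ℝ) : ℂ) +
        K.indicator (fun x => ∑ j, A x i j * G x j) x *
          ((pderiv i (fun x => (φ x).im) x : ℝ) : ℂ) * Complex.I := by
      intro i
      rw [pderiv_re (hφ.differentiable (by simp) x), pderiv_im (hφ.differentiable (by simp) x)]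
      conv_lhs => rw [← Complex.re_add_im (pderiv i φ x)]
      ring
    simp only [e, Finset.sum_add_distrib, ← Finset.sum_mul]
    conv_lhs => rw [← Complex.re_add_im (φ x)]
    ring
  simp only [h3]
  rw [integral_add (hi _ hre sre) ((hi _ him sim).mul_const _), integral_mul_const, h1, h2]
  simp

/-- The equation may be tested by weakly differentiable functions with compact support in the open
half-space which vanish above the strip. -/
theorem integral_test (hU : IsExtendedSolution A B h U G) {K : Set (Space d)}
    (hK : IsCompact K) (hKΩ : K ⊆ halfSpace d) {V : Space d → ℂ} {W : Fin (d + 1) → Space d → ℂ}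
    (hV : MemLp V 2 volume) (hW : ∀ i, MemLp (W i) 2 volume)
    (hVW : ∀ i, IsWeakDeriv univ i V (W i)) (hVK : ∀ x ∉ K, V x = 0) (hWK : ∀ i, ∀ x ∉ K, W i x = 0)
    (hVh : ∀ x, h < x 0 → V x = 0) :
    ∫ x, ((∑ i, (∑ j, A x i j * G x j) * W i x) - (∑ i, B x i * G x i) * V x) = 0 := by
  -- A compact neighbourhood of K inside the half-space holds the supports of all mollifications.
  -- The coefficients are bounded on it.
  obtain ⟨δ₀, hδ₀, hδK⟩ := hK.exists_cthickening_subset_open isOpen_halfSpace hKΩ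
  set K' := cthickening δ₀ K
  have hK' : IsCompact K' := hK.cthickening
  have hKK' : K ⊆ K' := self_subset_cthickening K
  let f : Option (Fin (d + 1)) → Space d → ℂ := fun o => o.elim V W
  have hf : ∀ o, MemLp (f o) 2 volume := by rintro (_ | i) <;> simp [f, hV, hW]
  have hη : ∀ n : ℕ, ((n : ℝ≥0∞) + 1)⁻¹ ≠ 0 := fun n => by simp
  choose ρ h1 h2 h3 h4 using fun n : ℕ => exists_mollifier_eLpNorm_le hf hδ₀ (hη n)
  have ht : Tendsto (fun n : ℕ => ((n : ℝ≥0∞) + 1)⁻¹) atTop (𝓝 0) := by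
    have := (tendsto_add_atTop_iff_nat 1).2 ENNReal.tendsto_inv_nat_nhds_zero
    simpa using this
  have ht' : ∀ o, Tendsto (fun n => eLpNorm (mollify (ρ n) (f o) - f o) 2 volume) atTop (𝓝 0) :=
    fun o => tendsto_of_tendsto_of_tendsto_of_le_of_le tendsto_const_nhds ht (fun _ => zero_le)
      fun n => (h4 n o).2
  have hul := hV.locallyIntegrable (by norm_num : (1 : ℝ≥0∞) ≤ 2)
  have hsup : ∀ n, tsupport (mollify (ρ n) V) ⊆ tsupport (ρ n) + (K ∩ {x | x 0 ≤ h}) := fun n => by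
    refine tsupport_mollify_subset (h2 n)
      (hK.isClosed.inter (isClosed_le (f := fun x : Space d => x 0) (by fun_prop) continuous_const)) fun x hx => ?_
    by_cases hxK : x ∈ K
    · exact hVh x (not_le.1 fun hle => hx ⟨hxK, hle⟩)
    · exact hVK x hxK
  have hsupK : ∀ n, tsupport (mollify (ρ n) V) ⊆ K' := fun n x hx => by
    obtain ⟨y, hy, z, hz, rfl⟩ := hsup n hx
    refine mem_cthickening_of_dist_le _ z _ _ hz.1 ?_
    rw [dist_eq_norm]
    simpa using ((h3 n) y hy).1
  -- V may be nonzero up to height h. Since the mollifiers live at negative heights, the mollified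
  -- functions are supported strictly below h and are legitimate test functions in the strip.
  have hsupS : ∀ n, tsupport (mollify (ρ n) V) ⊆ strip d h := fun n x hx => by
    refine ⟨hδK (hsupK n hx), ?_⟩
    obtain ⟨y, hy, z, hz, rfl⟩ := hsup n hx
    have h5 := ((h3 n) y hy).2
    have h6 : z 0 ≤ h := hz.2
    simp only [PiLp.add_apply]
    linarith
  have hzero : ∀ n, (∑ i, ∫ x, K'.indicator (fun x => ∑ j, A x i j * G x j) x *
      mollify (ρ n) (W i) x) - ∫ x, K'.indicator (fun x => ∑ i, B x i * G x i) x *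
      mollify (ρ n) V x = 0 := by
    intro n
    have h5 := hU.integral_test_complex hK' hδK (contDiff_mollify hul (h1 n) (h2 n)) (hsupS n)
      (hsupK n)
    have hi : ∀ i, Integrable (fun x => K'.indicator (fun x => ∑ j, A x i j * G x j) x *
      mollify (ρ n) (W i) x) volume := fun i =>
        (hU.memLp_flux hK' hδK i).integrable_mul (h4 n (some i)).1
    rw [← h5, ← integral_finsetSum _ fun i _ => hi i, ← integral_sub]
    · simp only [fun i => pderiv_mollify hul (hVW i) (h1 n) (h2 n)]
    · exact integrable_finsetSum _ fun i _ => hi i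
    · exact (hU.memLp_drift hK' hδK).integrable_mul (h4 n none).1
  have hc : ∀ g : Space d → ℂ, Tendsto (fun _ : ℕ => eLpNorm (g - g) 2 volume) atTop (𝓝 0) := by
    intro g; simp
  have hlim := (tendsto_finsetSum Finset.univ fun i _ => tendsto_integral_mul
    (fun _ => hU.memLp_flux hK' hδK i) (fun n => (h4 n (some i)).1) (hU.memLp_flux hK' hδK i)
    (hW i) (hc _) (ht' (some i))).sub (tendsto_integral_mul
    (fun _ => hU.memLp_drift hK' hδK) (fun n => (h4 n none).1) (hU.memLp_drift hK' hδK)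
    hV (hc _) (ht' none))
  have := tendsto_nhds_unique hlim ((tendsto_const_nhds (x := (0:ℂ))).congr fun n => (hzero n).symm)
  have hi : ∀ i, Integrable (fun x => K'.indicator (fun x => ∑ j, A x i j * G x j) x *
      W i x) volume := fun i => (hU.memLp_flux hK' hδK i).integrable_mul (hW i)
  rw [← integral_finsetSum _ fun i _ => hi i, ← integral_sub] at this
  · rw [← this]
    refine integral_congr_ae (.of_forall fun x => ?_)
    by_cases hx : x ∈ K
    · simp [hKK' hx]
    · simp [hVK x hx, fun i => hWK i x hx]
  · exact integrable_finsetSum _ fun i _ => hi i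
  · exact (hU.memLp_drift hK' hδK).integrable_mul hV

end IsExtendedSolution

/-! ### Consequences of `p`-ellipticity -/

theorem sesq_add_right (M : Matrix (Fin (d + 1)) (Fin (d + 1)) ℂ) (ξ η ζ : CVec d) :
    sesq M ξ (η + ζ) = sesq M ξ η + sesq M ξ ζ := by
  simp [sesq, mul_add, Finset.sum_add_distrib]

theorem sesq_smul_right (M : Matrix (Fin (d + 1)) (Fin (d + 1)) ℂ) (ξ η : CVec d) (c : ℂ) :
    sesq M ξ (c • η) = star c * sesq M ξ η := by
  simp only [sesq, Finset.mul_sum, PiLp.smul_apply, smul_eq_mul, star_mul']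
  exact Finset.sum_congr rfl fun i _ => Finset.sum_congr rfl fun j _ => by ring

theorem sesq_smul_left (M : Matrix (Fin (d + 1)) (Fin (d + 1)) ℂ) (ξ η : CVec d) (c : ℂ) :
    sesq M (c • ξ) η = c * sesq M ξ η := by
  simp only [sesq, Finset.mul_sum, PiLp.smul_apply, smul_eq_mul]
  exact Finset.sum_congr rfl fun i _ => Finset.sum_congr rfl fun j _ => by ring

/-- `p`-ellipticity of a single matrix interpolates between ellipticity and `p'`-ellipticity. -/
theorem le_re_sesq_interpolate {M : Matrix (Fin (d + 1)) (Fin (d + 1)) ℂ} {p lam : ℝ} (hp : 1 < p)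
    (hlam : 0 < lam) (hM : ∀ ξ : CVec d, lam * ‖ξ‖ ^ 2 ≤ (sesq M ξ (Jmap p ξ)).re)
    {τ : ℝ} (hτ0 : 0 ≤ τ) (hτ1 : τ ≤ 1) (ζ : CVec d) :
    lam * ‖ζ‖ ^ 2 ≤
      (sesq M ζ (WithLp.toLp 2 fun i => ζ i + (((p - 2) * τ * (ζ i).re : ℝ) : ℂ))).re := by
  have hp0 : p ≠ 0 := by linarith
  -- For ζ = α + iβ, −i J_p(iζ) is α/p' + iβ/p. The vector ζ + (p−2)τ Re ζ is the combination of J_p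
  -- ζ and −i J_p(iζ) with the nonnegative weights 1 − τ and 1 − τ + τp. Their sum 2(1 − τ) + τp is
  -- at least 1, so `hM` at ζ and at iζ yields the constant `lam`.
  have e : (WithLp.toLp 2 fun i => ζ i + (((p - 2) * τ * (ζ i).re : ℝ) : ℂ) : CVec d) =
      ((1 - τ : ℝ) : ℂ) • Jmap p ζ +
        ((1 - τ + τ * p : ℝ) : ℂ) • ((-Complex.I) • Jmap p (Complex.I • ζ)) := by
    ext i
    simp only [Jmap, PiLp.add_apply, PiLp.smul_apply, smul_eq_mul, Real.conjExponent]
    apply Complex.ext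
    · simp only [Complex.add_re, Complex.ofReal_re, Complex.ofReal_im, Complex.neg_re,
        Complex.mul_re, Complex.neg_im, Complex.I_re, Complex.I_im, Complex.mul_im]
      have : p - 1 ≠ 0 := by linarith
      field_simp
      ring
    · simp only [Complex.add_im, Complex.ofReal_im, Complex.ofReal_re, Complex.neg_re,
        Complex.mul_re, Complex.neg_im, Complex.I_re, Complex.I_im, Complex.mul_im]
      have : p - 1 ≠ 0 := by linarith
      field_simp
      ring
  have h1 := hM ζ
  have h2 := hM (Complex.I • ζ)
  have h3 : sesq M (Complex.I • ζ) (Jmap p (Complex.I • ζ)) =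
      sesq M ζ ((-Complex.I) • Jmap p (Complex.I • ζ)) := by
    rw [sesq_smul_left, sesq_smul_right]; simp
  rw [h3] at h2
  have h4 : ‖Complex.I • ζ‖ = ‖ζ‖ := by rw [norm_smul]; simp
  rw [h4] at h2
  rw [e, sesq_add_right, sesq_smul_right, sesq_smul_right, Complex.add_re]
  simp only [RCLike.star_def, Complex.conj_ofReal, Complex.re_ofReal_mul]
  have hn : 0 ≤ lam * ‖ζ‖ ^ 2 := by positivity
  have h5 : (1 - τ) * (lam * ‖ζ‖ ^ 2) ≤ (1 - τ) * (sesq M ζ (Jmap p ζ)).re :=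
    mul_le_mul_of_nonneg_left h1 (by linarith)
  have h6 := mul_le_mul_of_nonneg_left h2 (by nlinarith : 0 ≤ 1 - τ + τ * p)
  nlinarith [mul_nonneg hτ0 hn]

/-- The coercivity behind the test function `|u|^{p-2} u`: here `φ` and `φ'` stand for the values of
`φ(|z|²)` and `φ'(|z|²)`, and `φ w + 2 φ' Re(z̄ w) z` is the derivative of `φ(|z|²) z`. -/
theorem le_re_sesq_fderiv {M : Matrix (Fin (d + 1)) (Fin (d + 1)) ℂ} {p lam : ℝ} (hp : 1 < p)
    (hlam : 0 < lam) (hM : ∀ ξ : CVec d, lam * ‖ξ‖ ^ 2 ≤ (sesq M ξ (Jmap p ξ)).re)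
    {φ φ' τ : ℝ} (hφ : 0 ≤ φ) (hτ0 : 0 ≤ τ) (hτ1 : τ ≤ 1) (z : ℂ)
    (hφ' : 2 * φ' * ‖z‖ ^ 2 = (p - 2) * τ * φ) (ξ : CVec d) :
    φ * (lam * ‖ξ‖ ^ 2) ≤ (sesq M ξ (WithLp.toLp 2 fun i =>
      (φ : ℂ) * ξ i + ((φ' * (2 * (star z * ξ i).re) : ℝ) : ℂ) * z)).re := by
  -- Rotation by the phase κ₀ of z reduces to the case z ≥ 0, where Re(z̄ξ) becomes |z| Re ζ. At z =
  -- 0 any phase will do.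
  obtain ⟨κ₀, hκ₀, hz⟩ : ∃ κ₀ : ℂ, ‖κ₀‖ = 1 ∧ z = ‖z‖ * κ₀ := by
    rcases eq_or_ne z 0 with rfl | hz
    · exact ⟨1, by simp, by simp⟩
    · refine ⟨z / ‖z‖, by simp [hz], ?_⟩
      have : (‖z‖ : ℂ) ≠ 0 := by simpa using hz
      field_simp
  have hκ₀κ₀ : κ₀ * star κ₀ = 1 := by
    rw [RCLike.star_def, Complex.mul_conj, Complex.normSq_eq_norm_sq, hκ₀]; simp
  set ζ : CVec d := star κ₀ • ξ with hζ
  have hξ : ξ = κ₀ • ζ := by rw [hζ, smul_smul, hκ₀κ₀, one_smul]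
  have hnorm : ‖ξ‖ = ‖ζ‖ := by rw [hξ, norm_smul, hκ₀, one_mul]
  have e : (WithLp.toLp 2 fun i =>
      (φ : ℂ) * ξ i + ((φ' * (2 * (star z * ξ i).re) : ℝ) : ℂ) * z : CVec d) =
      κ₀ • ((φ : ℂ) • (WithLp.toLp 2 fun i => ζ i + (((p - 2) * τ * (ζ i).re : ℝ) : ℂ) : CVec d)) := by
    ext i
    simp only [PiLp.smul_apply, smul_eq_mul]
    have h1 : star z * ξ i = ‖z‖ * ζ i := by
      conv_lhs => rw [hz]
      simp only [hζ, star_mul', RCLike.star_def, Complex.conj_ofReal, PiLp.smul_apply, smul_eq_mul]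
      ring
    have h2 : ξ i = κ₀ * ζ i := by rw [hξ]; rfl
    rw [h1, h2, Complex.re_ofReal_mul]
    have h3 : ((φ' * (2 * (‖z‖ * (ζ i).re)) : ℝ) : ℂ) * z =
        κ₀ * (φ * (((p - 2) * τ * (ζ i).re : ℝ) : ℂ)) := by
      conv_lhs => rw [hz]
      have h5 : ((φ' * (2 * (‖z‖ * (ζ i).re)) : ℝ) : ℂ) * (‖z‖ * κ₀) =
        ((2 * φ' * ‖z‖ ^ 2 * (ζ i).re : ℝ) : ℂ) * κ₀ := by push_cast; ring
      simp only [Complex.norm_mul, Complex.norm_real, norm_norm, hκ₀, mul_one]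
      rw [h5, hφ']
      push_cast
      ring
    rw [h3]
    ring
  rw [e, hξ, sesq_smul_left, sesq_smul_right, sesq_smul_right, norm_smul, hκ₀, one_mul,
    ← mul_assoc κ₀, hκ₀κ₀, one_mul, RCLike.star_def, Complex.conj_ofReal, Complex.re_ofReal_mul]
  gcongr
  exact le_re_sesq_interpolate hp hlam hM hτ0 hτ1 ζ

/-! ### Regularised powers -/

/-- A regularisation of `t ^ ((p - 2) / 2)` which is smooth, bounded above and below on `[0, ∞)`. -/
noncomputable def regPow (p ε t : ℝ) : ℝ := ((ε + t) / (1 + ε * (ε + t))) ^ ((p - 2) / 2)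

/-- The logarithmic derivative in t of the base (ε + t)/(1 + ε(ε + t)) of `regPow`. The number t ·
`regRate ε t` lies in [0, 1] and is the interpolation parameter τ of `le_re_sesq_fderiv`; it would
be 1 without regularisation. -/
noncomputable def regRate (ε t : ℝ) : ℝ := 1 / ((ε + t) * (1 + ε * (ε + t)))

section regPow

variable {p ε t : ℝ}

theorem regPow_pos (hε : 0 < ε) (ht : 0 ≤ t) : 0 < regPow p ε t := by
  unfold regPow; positivity

theorem regRate_nonneg (hε : 0 < ε) (ht : 0 ≤ t) : 0 ≤ t * regRate ε t := by
  unfold regRate; positivity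

theorem regRate_le_one (hε : 0 < ε) (ht : 0 ≤ t) : t * regRate ε t ≤ 1 := by
  unfold regRate
  rw [mul_one_div, div_le_one (by positivity)]
  have : 0 ≤ ε * (ε + t) := by positivity
  nlinarith

theorem hasDerivAt_regPow (hε : 0 < ε) (ht : 0 ≤ t) :
    HasDerivAt (regPow p ε) ((p - 2) / 2 * regRate ε t * regPow p ε t) t := by
  have h1 : HasDerivAt (fun t : ℝ => ε + t) 1 t := by simpa using (hasDerivAt_id t).const_add ε
  have h2 : HasDerivAt (fun t : ℝ => 1 + ε * (ε + t)) (ε * 1) t := (h1.const_mul ε).const_add 1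
  have hpos : 0 < ε + t := by linarith
  have hpos2 : 0 < 1 + ε * (ε + t) := by positivity
  have h3 := (h1.div h2 hpos2.ne').rpow_const (p := (p - 2) / 2) (Or.inl (div_pos hpos hpos2).ne')
  unfold regPow
  refine h3.congr_deriv ?_
  simp only [Pi.div_apply]
  rw [Real.rpow_sub_one (div_pos hpos hpos2).ne', regRate]
  field_simp
  ring

theorem continuousOn_regPow (hε : 0 < ε) : ContinuousOn (regPow p ε) (Ici 0) :=
  fun _ ht => (hasDerivAt_regPow hε ht).continuousAt.continuousWithinAt

/-- The base of the power stays between ε/(1 + ε²) and 1/ε, and the sign of p − 2 decides which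
endpoint is the relevant one. -/
theorem exists_regPow_le (p : ℝ) (hε : 0 < ε) : ∃ K, 0 ≤ K ∧ ∀ t, 0 ≤ t → regPow p ε t ≤ K := by
  refine ⟨(1 / ε) ^ ((p - 2) / 2) + (ε / (1 + ε * ε)) ^ ((p - 2) / 2), by positivity,
    fun t ht => ?_⟩
  have hpos : 0 < ε + t := by linarith
  have hpos2 : 0 < 1 + ε * (ε + t) := by positivity
  unfold regPow
  rcases le_total 0 ((p - 2) / 2) with hs | hs
  · refine (Real.rpow_le_rpow (by positivity) ?_ hs).trans (le_add_of_nonneg_right (by positivity))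
    rw [div_le_div_iff₀ hpos2 hε]
    linarith
  · refine (Real.rpow_le_rpow_of_nonpos (by positivity) ?_ hs).trans
      (le_add_of_nonneg_left (by positivity))
    rw [div_le_div_iff₀ (by positivity) hpos2]
    nlinarith

/-- A bound uniform in ε ≤ 1, used to dominate the limit ε → 0. For p ≥ 2 the base is at most 1 + t.
For p ≤ 2 its reciprocal is at most (1 + t)/t, a number ≥ 1 that is raised to a power at most 1. -/
theorem mul_regPow_le (hp : 1 < p) (hε : 0 < ε) (hε1 : ε ≤ 1) (ht : 0 ≤ t) :
    t * regPow p ε t ≤ (1 + t) + (1 + t) ^ (p / 2) := by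
  have hpos : 0 < ε + t := by linarith
  have hpos2 : 0 < 1 + ε * (ε + t) := by positivity
  rcases ht.eq_or_lt with rfl | ht0
  · simp
  rcases le_total 2 p with hp2 | hp2
  · have h1 : regPow p ε t ≤ (1 + t) ^ ((p - 2) / 2) := by
      unfold regPow
      refine Real.rpow_le_rpow (by positivity) ?_ (by linarith)
      rw [div_le_iff₀ hpos2]
      have : 0 ≤ ε * (ε + t) := by positivity
      nlinarith
    calc t * regPow p ε t ≤ (1 + t) * (1 + t) ^ ((p - 2) / 2) :=
          mul_le_mul (by linarith) h1 (regPow_pos hε ht).le (by linarith)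
      _ = (1 + t) ^ (p / 2) := by
          rw [← Real.rpow_one_add' (by linarith) (by linarith)]; congr 1; ring
      _ ≤ _ := le_add_of_nonneg_left (by linarith)
  · have h1 : regPow p ε t ≤ (1 + t) / t := by
      unfold regPow
      have e : ((ε + t) / (1 + ε * (ε + t))) ^ ((p - 2) / 2) =
          ((1 + ε * (ε + t)) / (ε + t)) ^ ((2 - p) / 2) := by
        rw [← inv_div, Real.inv_rpow (by positivity), ← Real.rpow_neg (by positivity)]
        congr 1; ring
      have hb : (1 + ε * (ε + t)) / (ε + t) ≤ (1 + t) / t := by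
        rw [div_le_div_iff₀ hpos ht0]
        nlinarith [mul_nonneg (mul_nonneg hε.le ht) (sub_nonneg.2 hε1),
          mul_nonneg (sq_nonneg t) (sub_nonneg.2 hε1)]
      rw [e]
      refine (Real.rpow_le_rpow (by positivity) hb (by linarith)).trans ?_
      have h1b : 1 ≤ (1 + t) / t := by rw [le_div_iff₀ ht0]; linarith
      exact (Real.rpow_le_rpow_of_exponent_le h1b (by linarith : (2 - p) / 2 ≤ 1)).trans_eq
        (Real.rpow_one _)
    calc t * regPow p ε t ≤ t * ((1 + t) / t) := by gcongr
      _ = 1 + t := by field_simp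
      _ ≤ _ := le_add_of_nonneg_right (by positivity)

theorem tendsto_regPow (ht : 0 < t) :
    Tendsto (fun ε => regPow p ε t) (𝓝[>] 0) (𝓝 (t ^ ((p - 2) / 2))) := by
  have h : ContinuousAt (fun ε : ℝ => ((ε + t) / (1 + ε * (ε + t))) ^ ((p - 2) / 2)) 0 := by
    refine ContinuousAt.rpow_const ?_ (Or.inl (by simp [ht.ne']))
    exact ContinuousAt.div (by fun_prop) (by fun_prop) (by simp)
  have := h.tendsto.mono_left (nhdsWithin_le_nhds (s := Ioi 0))
  simpa [regPow] using this

/-- The primitive of `regPow`. -/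
noncomputable def regInt (p ε t : ℝ) : ℝ := ∫ s in (0 : ℝ)..t, regPow p ε |s|

theorem continuous_regPow_abs (hε : 0 < ε) : Continuous fun s => regPow p ε |s| :=
  (continuousOn_regPow hε).comp_continuous continuous_abs fun s => mem_Ici.2 (abs_nonneg s)

theorem hasDerivAt_regInt (hε : 0 < ε) (t : ℝ) :
    HasDerivAt (regInt p ε) (regPow p ε |t|) t :=
  ((continuous_regPow_abs hε).integral_hasStrictDerivAt 0 t).hasDerivAt

theorem regInt_nonneg (hε : 0 < ε) (ht : 0 ≤ t) : 0 ≤ regInt p ε t :=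
  intervalIntegral.integral_nonneg ht fun _ _ => (regPow_pos hε (abs_nonneg _)).le

/-- The derivative of 2tφ(t) − Φ(t) is (1 + (p−2)τ)φ(t) with τ = t · `regRate ε t` in [0, 1]. It is
nonnegative because p > 1. The factor 2 thus serves all p > 1 at once. -/
theorem regInt_le (hp : 1 < p) (hε : 0 < ε) (ht : 0 ≤ t) :
    regInt p ε t ≤ 2 * (t * regPow p ε t) := by
  have hmono : MonotoneOn (fun t => 2 * (t * regPow p ε t) - regInt p ε t) (Ici 0) := by
    have hd : ∀ s, 0 ≤ s → HasDerivAt (fun t => 2 * (t * regPow p ε t) - regInt p ε t)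
        (2 * (1 * regPow p ε s + s * ((p - 2) / 2 * regRate ε s * regPow p ε s)) -
          regPow p ε |s|) s := fun s hs =>
      (((hasDerivAt_id s).mul (hasDerivAt_regPow hε hs)).const_mul 2).sub (hasDerivAt_regInt hε s)
    refine monotoneOn_of_hasDerivWithinAt_nonneg (convex_Ici 0)
      (fun s hs => (hd s hs).continuousAt.continuousWithinAt)
      (fun s hs => (hd s (interior_subset hs)).hasDerivWithinAt) fun s hs => ?_
    have hs0 : 0 ≤ s := interior_subset hs
    rw [abs_of_nonneg hs0]
    have h1 := regRate_nonneg hε hs0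
    have h2 := regRate_le_one hε hs0
    have h3 := (regPow_pos (p := p) hε hs0).le
    have e : 2 * (1 * regPow p ε s + s * ((p - 2) / 2 * regRate ε s * regPow p ε s)) -
          regPow p ε s = (1 + (p - 2) * (s * regRate ε s)) * regPow p ε s := by ring
    rw [e]
    refine mul_nonneg ?_ h3
    nlinarith
  have := hmono (mem_Ici.2 le_rfl) (mem_Ici.2 ht) ht
  simp [regInt] at this
  simpa [regInt] using this

end regPow

/-- The regularisation `φ(|z|²) z` of `|z|^{p-2} z`. -/
noncomputable def regFun (p ε : ℝ) (z : ℂ) : ℂ := (regPow p ε (‖z‖ ^ 2) : ℂ) * z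

section regFun

variable {p ε : ℝ}

noncomputable def regFunDeriv (p ε : ℝ) (z : ℂ) : ℂ →L[ℝ] ℂ :=
  (regPow p ε (‖z‖ ^ 2)) • ContinuousLinearMap.id ℝ ℂ +
    (((p - 2) / 2 * regRate ε (‖z‖ ^ 2) * regPow p ε (‖z‖ ^ 2)) •
      ((2 : ℝ) • innerSL ℝ z)).smulRight z

theorem regFunDeriv_apply (z w : ℂ) : regFunDeriv p ε z w = (regPow p ε (‖z‖ ^ 2) : ℂ) * w +
    (((p - 2) / 2 * regRate ε (‖z‖ ^ 2) * regPow p ε (‖z‖ ^ 2) * (2 * (star z * w).re) : ℝ) : ℂ)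
      * z := by
  have : inner ℝ z w = (star z * w).re := by
    rw [Complex.inner]; simp [mul_comm]
  simp [regFunDeriv, this]

theorem hasFDerivAt_regFun (hε : 0 < ε) (z : ℂ) :
    HasFDerivAt (regFun p ε) (regFunDeriv p ε z) z := by
  have h1 : HasFDerivAt (fun z : ℂ => ‖z‖ ^ 2) ((2 : ℝ) • innerSL ℝ z) z := by
    refine (hasStrictFDerivAt_norm_sq z).hasFDerivAt.congr_fderiv ?_
    ext; simp [mul_add]
  have h2 := (hasDerivAt_regPow (p := p) hε (sq_nonneg ‖z‖)).comp_hasFDerivAt z h1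
  have h3 := h2.smul (hasFDerivAt_id z)
  have e : regFun p ε = fun z => regPow p ε (‖z‖ ^ 2) • z := by
    ext z; simp [regFun]
  rw [e]
  exact h3

theorem continuous_regFunDeriv (hε : 0 < ε) : Continuous (regFunDeriv p ε) := by
  have h1 : Continuous fun z : ℂ => regPow p ε (‖z‖ ^ 2) :=
    (continuousOn_regPow hε).comp_continuous (by fun_prop) fun z => sq_nonneg ‖z‖
  have h2 : Continuous fun z : ℂ => regRate ε (‖z‖ ^ 2) := by
    unfold regRate
    refine Continuous.div continuous_const (by fun_prop) fun z => ?_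
    positivity
  have h3 : Continuous fun z : ℂ => innerSL ℝ z := (innerSL ℝ).continuous
  unfold regFunDeriv
  refine (h1.smul continuous_const).add ?_
  exact ((ContinuousLinearMap.smulRightL ℝ ℂ ℂ).continuous.comp
    (((continuous_const.mul h2).mul h1).smul (h3.const_smul (2:ℝ)))).clm_apply continuous_id

theorem contDiff_regFun (hε : 0 < ε) : ContDiff ℝ 1 (regFun p ε) :=
  contDiff_one_iff_hasFDerivAt.2 ⟨_, continuous_regFunDeriv hε, hasFDerivAt_regFun hε⟩

/-- The second term of the derivative has size |p−2| φ · |z|² `regRate`, and the last factor is at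
most 1. The growth in z is cancelled. -/
theorem exists_norm_regFunDeriv_le (p : ℝ) (hε : 0 < ε) : ∃ K, 0 ≤ K ∧ ∀ z, ‖regFunDeriv p ε z‖ ≤ K := by
  obtain ⟨K, hK0, hK⟩ := exists_regPow_le p hε
  refine ⟨K * (1 + |p - 2|), by positivity, fun z => ?_⟩
  refine ContinuousLinearMap.opNorm_le_bound _ (by positivity) fun w => ?_
  rw [regFunDeriv_apply]
  have h0 := regPow_pos (p := p) hε (sq_nonneg ‖z‖)
  have h1 := hK _ (sq_nonneg ‖z‖)
  have h2 := regRate_nonneg hε (sq_nonneg ‖z‖)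
  have h3 := regRate_le_one hε (sq_nonneg ‖z‖)
  have h4 : |(star z * w).re| ≤ ‖z‖ * ‖w‖ := by
    refine (Complex.abs_re_le_norm _).trans_eq ?_
    simp
  set R := regPow p ε (‖z‖ ^ 2)
  set κ := regRate ε (‖z‖ ^ 2)
  have hκ : 0 ≤ κ := by simp only [κ, regRate]; positivity
  calc _ ≤ R * ‖w‖ + |(p - 2) / 2| * κ * R * (2 * (‖z‖ * ‖w‖)) * ‖z‖ := by
        refine (norm_add_le _ _).trans ?_
        rw [norm_mul, norm_mul, Complex.norm_real, Complex.norm_real, Real.norm_of_nonneg h0.le,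
          Real.norm_eq_abs, abs_mul, abs_mul, abs_mul, abs_mul, abs_two, abs_of_nonneg h0.le,
          abs_of_nonneg hκ]
        gcongr
    _ = R * (1 + |p - 2| * (‖z‖ ^ 2 * κ)) * ‖w‖ := by
        rw [abs_div, abs_two]; ring
    _ ≤ K * (1 + |p - 2|) * ‖w‖ := by
        gcongr
        exact mul_le_of_le_one_right (abs_nonneg _) h3

theorem hasFDerivAt_regInt_normSq (hε : 0 < ε) (z : ℂ) :
    HasFDerivAt (fun z : ℂ => regInt p ε (‖z‖ ^ 2))
      (regPow p ε (‖z‖ ^ 2) • ((2 : ℝ) • innerSL ℝ z)) z := by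
  have h1 : HasFDerivAt (fun z : ℂ => ‖z‖ ^ 2) ((2 : ℝ) • innerSL ℝ z) z := by
    refine (hasStrictFDerivAt_norm_sq z).hasFDerivAt.congr_fderiv ?_
    ext; simp [mul_add]
  have h2 := (hasDerivAt_regInt (p := p) hε (‖z‖ ^ 2)).comp_hasFDerivAt z h1
  rw [abs_of_nonneg (sq_nonneg ‖z‖)] at h2
  exact h2

theorem contDiff_regInt_normSq (hε : 0 < ε) :
    ContDiff ℝ 1 (fun z : ℂ => regInt p ε (‖z‖ ^ 2)) := by
  refine contDiff_one_iff_hasFDerivAt.2 ⟨_, ?_, hasFDerivAt_regInt_normSq hε⟩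
  have h1 : Continuous fun z : ℂ => regPow p ε (‖z‖ ^ 2) :=
    (continuousOn_regPow hε).comp_continuous (by fun_prop) fun z => sq_nonneg ‖z‖
  exact h1.smul ((innerSL ℝ).continuous.const_smul (2:ℝ))

theorem fderiv_regInt_normSq (hε : 0 < ε) (z w : ℂ) :
    fderiv ℝ (fun z : ℂ => regInt p ε (‖z‖ ^ 2)) z w = 2 * (star (regFun p ε z) * w).re := by
  rw [(hasFDerivAt_regInt_normSq hε z).fderiv]
  have : inner ℝ z w = (star z * w).re := by
    rw [Complex.inner]; simp [mul_comm]
  simp only [smul_apply, innerSL_apply_apply, this, regFun, star_mul',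
    RCLike.star_def, Complex.conj_ofReal, smul_eq_mul, mul_assoc, Complex.re_ofReal_mul]
  ring

end regFun

/-! ### The energy inequality -/

theorem norm_single_one (i : Fin (d + 1)) : ‖(EuclideanSpace.single i 1 : CVec d)‖ = 1 := by simp

theorem sesq_single_right (M : Matrix (Fin (d + 1)) (Fin (d + 1)) ℂ) (ξ : CVec d)
    (i : Fin (d + 1)) : sesq M ξ (EuclideanSpace.single i 1) = ∑ j, M i j * ξ j := by
  simp only [sesq]
  rw [Finset.sum_eq_single i]
  · simp
  · intro k _ hk
    simp [hk]
  · simp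

theorem sesq_single_single (M : Matrix (Fin (d + 1)) (Fin (d + 1)) ℂ) (i j : Fin (d + 1)) :
    sesq M (EuclideanSpace.single j 1) (EuclideanSpace.single i 1) = M i j := by
  rw [sesq_single_right, Finset.sum_eq_single j]
  · simp
  · intro k _ hk
    simp [hk]
  · simp

theorem norm_sum_le_of_forall_le {ι : Type*} [Fintype ι] {f : ι → ℂ} {c : ℝ} (h : ∀ i, ‖f i‖ ≤ c) :
    ‖∑ i, f i‖ ≤ Fintype.card ι * c := by
  have := norm_sum_le_of_le Finset.univ fun i _ => h i
  simpa using this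

/-- With x = |∇u| and y = |u|, the mixed product xy is split so that its gradient part costs exactly
half of the elliptic term. The rest carries y² only, that is, |u|^p up to regularisation. -/
theorem young_absorb {t R x y e N s lam C : ℝ} (hlam : 0 < lam) (ht : 0 ≤ t) (hR : 0 ≤ R) :
    C * (R * y * x) * t * (|e| * (N + s * |e|)) ≤ lam / 2 * (R * x ^ 2 * (t * e ^ 2)) +
      R * y ^ 2 * (C ^ 2 / lam * (t * (N ^ 2 + s ^ 2 * e ^ 2))) := by
  have h8 : C * (y * x) * (|e| * (N + s * |e|)) ≤ lam / 2 * (x * |e|) ^ 2 +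
      C ^ 2 / (2 * lam) * (y * (N + s * |e|)) ^ 2 := by
    have h1 : lam / 2 * (x * |e|) ^ 2 + C ^ 2 / (2 * lam) * (y * (N + s * |e|)) ^ 2 -
        C * (y * x) * (|e| * (N + s * |e|)) =
        lam / 2 * (x * |e| - C / lam * (y * (N + s * |e|))) ^ 2 := by
      field_simp
      ring
    have h2 : 0 ≤ lam / 2 * (x * |e| - C / lam * (y * (N + s * |e|))) ^ 2 := by positivity
    linarith
  have h9 : (N + s * |e|) ^ 2 ≤ 2 * (N ^ 2 + s ^ 2 * e ^ 2) := by
    have hde : e ^ 2 = |e| ^ 2 := (sq_abs e).symm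
    rw [hde]
    nlinarith [sq_nonneg (N - s * |e|)]
  have h10 : C ^ 2 / (2 * lam) * (y * (N + s * |e|)) ^ 2 ≤
      y ^ 2 * (C ^ 2 / lam * (N ^ 2 + s ^ 2 * e ^ 2)) := by
    calc _ = y ^ 2 * (C ^ 2 / (2 * lam)) * (N + s * |e|) ^ 2 := by ring
      _ ≤ y ^ 2 * (C ^ 2 / (2 * lam)) * (2 * (N ^ 2 + s ^ 2 * e ^ 2)) := by gcongr
      _ = _ := by field_simp
  rw [mul_pow, sq_abs] at h8
  have := mul_le_mul_of_nonneg_left (h8.trans (add_le_add_right h10 _)) (mul_nonneg hR ht)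
  calc _ = R * t * (C * (y * x) * (|e| * (N + s * |e|))) := by ring
    _ ≤ _ := this
    _ = _ := by ring

/-- The pointwise form of the energy inequality. Here `e`, `ν` are the values of the cutoff and its
gradient, `R`, `Φ` those of the regularised power and its primitive at `|z|²`, and `α k j` is
`∂_k A_{0j}`. -/
theorem energy_pointwise {M : Matrix (Fin (d + 1)) (Fin (d + 1)) ℂ} {b : Fin (d + 1) → ℂ}
    {ξ L : CVec d} {z : ℂ} {t e R Φ N s lam Lam : ℝ} {ν : Fin (d + 1) → ℝ}
    {α : Fin (d + 1) → Fin (d + 1) → ℝ} (ht : 0 < t) (hlam : 0 < lam) (hLam : 0 ≤ Lam)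
    (hM00 : M 0 0 = 1) (hM0 : ∀ j, (M 0 j).im = 0)
    (hM : ∀ ξ η : CVec d, ‖sesq M ξ η‖ ≤ Lam * ‖ξ‖ * ‖η‖)
    (hell : R * (lam * ‖ξ‖ ^ 2) ≤ (sesq M ξ L).re)
    (hR : 0 ≤ R) (hΦ0 : 0 ≤ Φ) (hΦ : Φ ≤ 2 * (‖z‖ ^ 2 * R)) (hν : ∀ i, |ν i| ≤ N) (hs : 0 ≤ s)
    (hb : ∀ i, ‖b i‖ ≤ s) (hα : ∀ k j, |α k j| ≤ s) {D : Fin (d + 1) → ℝ}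
    (hD : ∀ j, D j = 2 * (star ((R : ℂ) * z) * ξ j).re) :
    lam / 2 * (R * ‖ξ‖ ^ 2 * (t * e ^ 2)) ≤
      ((∑ i, (∑ j, M i j * ξ j) * (star (L i) * ((t * e ^ 2 : ℝ) : ℂ) + star ((R : ℂ) * z) *
          (((if i = 0 then e ^ 2 else 0) + 2 * t * e * ν i : ℝ) : ℂ))) -
        (∑ i, b i * ξ i) * (star ((R : ℂ) * z) * ((t * e ^ 2 : ℝ) : ℂ))).re
      - 1 / 2 * ((∑ j, (D j * ((M 0 j).re * e ^ 2 + t * α 0 j * e ^ 2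
          + 2 * t * (M 0 j).re * e * ν 0) -
          D 0 * ((if j = 0 then (M 0 j).re * e ^ 2 else 0) + t * α j j * e ^ 2 +
            2 * t * (M 0 j).re * e * ν j))) + (D 0 * e ^ 2 + Φ * (2 * e * ν 0)))
      + R * ‖z‖ ^ 2 * ((6 * (d + 1) * (Lam + 1)) ^ 2 / lam * (t * (N ^ 2 + s ^ 2 * e ^ 2)) +
          2 * |e| * N) := by
  have hN : 0 ≤ N := (abs_nonneg _).trans (hν 0)
  set w : ℂ := star ((R : ℂ) * z) with hw
  have hwn : ‖w‖ = R * ‖z‖ := by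
    rw [hw, norm_star, norm_mul, Complex.norm_real, Real.norm_of_nonneg hR]
  set X : ℝ := R * ‖z‖ * ‖ξ‖ with hX
  have hX0 : 0 ≤ X := by positivity
  have hξ : ∀ j, ‖ξ j‖ ≤ ‖ξ‖ := fun j => PiLp.norm_apply_le ξ j
  have hwξ : ∀ j, |(w * ξ j).re| ≤ X := fun j => by
    refine (Complex.abs_re_le_norm _).trans ?_
    rw [norm_mul, hwn, hX]
    gcongr
    exact hξ j
  have hDle : ∀ j, |D j| ≤ 2 * X := fun j => by
    rw [hD, abs_mul, abs_two]
    exact mul_le_mul_of_nonneg_left (hwξ j) two_pos.le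
  have ha : ∀ j, |(M 0 j).re| ≤ Lam := fun j => by
    have := hM (EuclideanSpace.single j 1) (EuclideanSpace.single 0 1)
    rw [sesq_single_single, norm_single_one, norm_single_one] at this
    refine (Complex.abs_re_le_norm _).trans ?_
    linarith
  have hm : ∀ i, ‖∑ j, M i j * ξ j‖ ≤ Lam * ‖ξ‖ := fun i => by
    have := hM ξ (EuclideanSpace.single i 1)
    rwa [sesq_single_right, norm_single_one, mul_one] at this
  -- decomposition of the tested equation
  have e1 : (∑ i, (∑ j, M i j * ξ j) * (star (L i) * ((t * e ^ 2 : ℝ) : ℂ) + w *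
          (((if i = 0 then e ^ 2 else 0) + 2 * t * e * ν i : ℝ) : ℂ))) =
      sesq M ξ L * ((t * e ^ 2 : ℝ) : ℂ) + (∑ j, M 0 j * ξ j) * w * ((e ^ 2 : ℝ) : ℂ) +
        (∑ i, (∑ j, M i j * ξ j) * w * (ν i : ℂ)) * ((2 * t * e : ℝ) : ℂ) := by
    have : ∀ i, (∑ j, M i j * ξ j) * (star (L i) * ((t * e ^ 2 : ℝ) : ℂ) + w *
          (((if i = 0 then e ^ 2 else 0) + 2 * t * e * ν i : ℝ) : ℂ)) =
        (∑ j, M i j * ξ j * star (L i)) * ((t * e ^ 2 : ℝ) : ℂ) +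
        (if i = 0 then (∑ j, M i j * ξ j) * w * ((e ^ 2 : ℝ) : ℂ) else 0) +
        (∑ j, M i j * ξ j) * w * (ν i : ℂ) * ((2 * t * e : ℝ) : ℂ) := by
      intro i
      rw [← Finset.sum_mul]
      split_ifs <;> push_cast <;> ring
    simp only [this, Finset.sum_add_distrib, ← Finset.sum_mul, Finset.sum_ite_eq', sesq,
      Finset.mem_univ, if_true]
  -- The reality of A_{0j} is decisive here: the real part passes to D_j, an exact derivative.
  have e2 : ((∑ j, M 0 j * ξ j) * w).re = 1 / 2 * ∑ j, (M 0 j).re * D j := by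
    rw [Finset.sum_mul, Complex.re_sum, Finset.mul_sum]
    refine Finset.sum_congr rfl fun j _ => ?_
    have h1 : M 0 j = ((M 0 j).re : ℂ) := Complex.ext (by simp) (by simp [hM0 j])
    rw [hD, mul_assoc, mul_comm (ξ j) w]
    conv_lhs => rw [h1]
    rw [Complex.re_ofReal_mul]
    ring
  set P : ℂ := ∑ i, (∑ j, M i j * ξ j) * w * (ν i : ℂ) with hP
  have hPle : |P.re| ≤ (d + 1) * (Lam * X * N) := by
    refine (Complex.abs_re_le_norm _).trans ?_
    have := norm_sum_le_of_forall_le (f := fun i => (∑ j, M i j * ξ j) * w * (ν i : ℂ))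
      (c := Lam * X * N) fun i => by
        rw [norm_mul, norm_mul, hwn, Complex.norm_real, Real.norm_eq_abs]
        calc _ ≤ (Lam * ‖ξ‖) * (R * ‖z‖) * N := by gcongr; exacts [hm i, hν i]
          _ = _ := by rw [hX]; ring
    simpa using this
  set E : ℂ := (∑ i, b i * ξ i) * w with hE
  have hEle : |E.re| ≤ (d + 1) * (s * X) := by
    refine (Complex.abs_re_le_norm _).trans ?_
    have := norm_sum_le_of_forall_le (f := fun i => b i * ξ i) (c := s * ‖ξ‖) fun i => by
        rw [norm_mul]; gcongr; exacts [hb i, hξ i]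
    rw [hE, norm_mul, hwn]
    calc _ ≤ (Fintype.card (Fin (d + 1)) * (s * ‖ξ‖)) * (R * ‖z‖) := by gcongr
      _ = _ := by rw [hX]; push_cast [Fintype.card_fin]; ring
  set Q : ℝ := ∑ j, (D j * (α 0 j * e ^ 2 + 2 * (M 0 j).re * e * ν 0) -
    D 0 * (α j j * e ^ 2 + 2 * (M 0 j).re * e * ν j)) with hQ
  -- The antisymmetric expressions reproduce e² Σ A_{0j}D_j up to terms with a factor t. The summand
  -- j = 0 is zero; since A₀₀ = 1 this leaves −D₀e², which the separate term D₀e² of the statement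
  -- compensates.
  have e3 : (∑ j, (D j * ((M 0 j).re * e ^ 2 + t * α 0 j * e ^ 2
          + 2 * t * (M 0 j).re * e * ν 0) -
          D 0 * ((if j = 0 then (M 0 j).re * e ^ 2 else 0) + t * α j j * e ^ 2 +
            2 * t * (M 0 j).re * e * ν j))) =
      e ^ 2 * (∑ j, (M 0 j).re * D j) + t * Q - D 0 * e ^ 2 := by
    have : ∀ j, D j * ((M 0 j).re * e ^ 2 + t * α 0 j * e ^ 2
          + 2 * t * (M 0 j).re * e * ν 0) -
          D 0 * ((if j = 0 then (M 0 j).re * e ^ 2 else 0) + t * α j j * e ^ 2 +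
            2 * t * (M 0 j).re * e * ν j) =
        e ^ 2 * ((M 0 j).re * D j) + t * (D j * (α 0 j * e ^ 2 + 2 * (M 0 j).re * e * ν 0) -
    D 0 * (α j j * e ^ 2 + 2 * (M 0 j).re * e * ν j)) -
        (if j = 0 then D 0 * (M 0 j).re * e ^ 2 else 0) := by
      intro j
      split_ifs <;> ring
    simp only [this, Finset.sum_add_distrib, Finset.sum_sub_distrib, ← Finset.mul_sum,
      Finset.sum_ite_eq', Finset.mem_univ, if_true, hM00, Complex.one_re, mul_one, hQ]
  have hQle : |Q| ≤ (d + 1) * (4 * X * (s * e ^ 2 + 2 * Lam * |e| * N)) := by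
    have hin : ∀ k j l, |α k j * e ^ 2 + 2 * (M 0 j).re * e * ν l| ≤ s * e ^ 2 + 2 * Lam * |e| * N := by
      intro k j l
      refine (abs_add_le _ _).trans ?_
      rw [abs_mul, abs_mul, abs_mul, abs_mul, abs_two, abs_of_nonneg (sq_nonneg e)]
      gcongr
      exacts [hα k j, ha j, hν l]
    have hb0 : 0 ≤ s * e ^ 2 + 2 * Lam * |e| * N := by positivity
    have := Finset.abs_sum_le_sum_abs (fun j => D j * (α 0 j * e ^ 2 + 2 * (M 0 j).re * e * ν 0) -
      D 0 * (α j j * e ^ 2 + 2 * (M 0 j).re * e * ν j)) Finset.univ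
    refine this.trans ((Finset.sum_le_card_nsmul _ _ (4 * X * (s * e ^ 2 + 2 * Lam * |e| * N))
      fun j _ => ?_).trans_eq (by simp))
    refine (abs_sub _ _).trans ?_
    rw [abs_mul, abs_mul]
    have h1 := mul_le_mul (hDle j) (hin 0 j 0) (abs_nonneg _) (by positivity)
    have h2 := mul_le_mul (hDle 0) (hin j j j) (abs_nonneg _) (by positivity)
    linarith
  rw [e1, e3, Complex.sub_re, Complex.add_re, Complex.add_re, ← mul_assoc (∑ i, b i * ξ i), ← hE,
    Complex.re_mul_ofReal, Complex.re_mul_ofReal, Complex.re_mul_ofReal, Complex.re_mul_ofReal, e2]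
  have h1 : R * (lam * ‖ξ‖ ^ 2) * (t * e ^ 2) ≤ (sesq M ξ L).re * (t * e ^ 2) := by gcongr
  have h2 : -(P.re * (2 * t * e)) ≤ (d + 1) * (Lam * X * N) * (2 * t * |e|) := by
    refine (neg_le_abs _).trans ?_
    rw [abs_mul, abs_mul, abs_mul, abs_two, abs_of_pos ht]
    gcongr
  have h3 : E.re * (t * e ^ 2) ≤ (d + 1) * (s * X) * (t * e ^ 2) := by
    gcongr
    exact (le_abs_self _).trans hEle
  have h4 : t * Q ≤ t * ((d + 1) * (4 * X * (s * e ^ 2 + 2 * Lam * |e| * N))) := by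
    gcongr
    exact (le_abs_self _).trans hQle
  have h5 : Φ * (e * ν 0) ≤ 2 * (‖z‖ ^ 2 * R) * (|e| * N) := by
    calc Φ * (e * ν 0) ≤ Φ * |e * ν 0| := mul_le_mul_of_nonneg_left (le_abs_self _) hΦ0
      _ ≤ _ := by
        rw [abs_mul]
        gcongr
        exact hν 0
  -- The three cross terms add up to (d+1) X t |e| (6ΛN + 3s|e|), whence the constant 6(d+1)(Λ+1).
  have h6 : (d + 1) * (Lam * X * N) * (2 * t * |e|) + (d + 1) * (s * X) * (t * e ^ 2) +
      1 / 2 * (t * ((d + 1) * (4 * X * (s * e ^ 2 + 2 * Lam * |e| * N)))) ≤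
      6 * (d + 1) * (Lam + 1) * X * t * (|e| * (N + s * |e|)) := by
    have hde : e ^ 2 = |e| * |e| := by rw [← sq, sq_abs]
    rw [hde]
    have h7 : 0 ≤ (d + 1) * X * t * |e| * (6 * N + 3 * s * |e| + 6 * Lam * (s * |e|)) := by
      positivity
    linarith
  have h7 := young_absorb (C := 6 * (d + 1) * (Lam + 1)) (x := ‖ξ‖) (y := ‖z‖) (e := e) (N := N)
    (s := s) hlam ht.le hR
  linarith

theorem IsWeakDeriv.star {Ω : Set (Space d)} {i : Fin (d + 1)} {u g : Space d → ℂ}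
    (h : IsWeakDeriv Ω i u g) : IsWeakDeriv Ω i (fun x => star (u x)) (fun x => star (g x)) := by
  intro φ hφ hs hφΩ
  have := congrArg (starRingEnd ℂ) (h φ hφ hs hφΩ)
  rw [map_neg, ← integral_conj, ← integral_conj] at this
  simpa using this

theorem ContDiffOn.mul_of_tsupport_subset {Ω : Set (Space d)} (hΩ : IsOpen Ω) {f η : Space d → ℝ}
    (hf : ContDiffOn ℝ ∞ f Ω) (hη : ContDiff ℝ ∞ η) (hs : tsupport η ⊆ Ω) :
    ContDiff ℝ ∞ fun x => f x * η x := by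
  rw [contDiff_iff_contDiffAt]
  intro x
  by_cases hx : x ∈ tsupport η
  · exact (hf.contDiffAt (hΩ.mem_nhds (hs hx))).mul hη.contDiffAt
  · have h0 : η =ᶠ[𝓝 x] 0 := notMem_tsupport_iff_eventuallyEq.1 hx
    have : (fun x => f x * η x) =ᶠ[𝓝 x] fun _ => 0 := h0.mono fun y hy => by simp [hy]
    exact contDiffAt_const.congr_of_eventuallyEq this

theorem pderiv_comm {ψ : Space d → ℝ} (hψ : ContDiff ℝ ∞ ψ) (i j : Fin (d + 1)) :
    pderiv i (pderiv j ψ) = pderiv j (pderiv i ψ) := by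
  ext x
  have h2 : IsSymmSndFDerivAt ℝ ψ x :=
    ((contDiff_infty.1 hψ 2).contDiffAt (x := x)).isSymmSndFDerivAt (by simp)
  have hd : DifferentiableAt ℝ (fderiv ℝ ψ) x :=
    (hψ.fderiv_right (m := ∞) (by simp)).differentiable (by simp) x
  have e : ∀ k l : Fin (d + 1), pderiv k (pderiv l ψ) x =
      fderiv ℝ (fderiv ℝ ψ) x (EuclideanSpace.single k 1) (EuclideanSpace.single l 1) := by
    intro k l
    have h3 := hd.hasFDerivAt.clm_apply
      (hasFDerivAt_const (EuclideanSpace.single l (1:ℝ) : Space d) x)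
    change fderiv ℝ (fun x => fderiv ℝ ψ x (EuclideanSpace.single l 1)) x _ = _
    rw [h3.fderiv]
    simp
  rw [e, e, h2.eq]

theorem hasFDerivAt_coord_zero (x : Space d) : HasFDerivAt (fun x : Space d => x 0)
    (EuclideanSpace.proj (𝕜 := ℝ) (0 : Fin (d + 1)) : Space d →L[ℝ] ℝ) x :=
  (EuclideanSpace.proj (𝕜 := ℝ) (0 : Fin (d + 1))).hasFDerivAt

theorem pderiv_sq {η : Space d → ℝ} (hη : ContDiff ℝ ∞ η) (k : Fin (d + 1)) (x : Space d) :
    pderiv k (fun x => η x ^ 2) x = 2 * η x * pderiv k η x := by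
  have := ((hη.differentiable (by simp) x).hasFDerivAt.pow 2)
  rw [pderiv, this.fderiv]
  simp [pderiv]

theorem pderiv_weight {η : Space d → ℝ} (hη : ContDiff ℝ ∞ η) (k : Fin (d + 1)) (x : Space d) :
    pderiv k (fun x => x 0 * η x ^ 2) x =
      (if k = 0 then η x ^ 2 else 0) + 2 * x 0 * η x * pderiv k η x := by
  have := (hasFDerivAt_coord_zero x).fun_mul ((hη.differentiable (by simp) x).hasFDerivAt.pow 2)
  rw [pderiv, this.fderiv]
  simp only [add_apply, smul_apply, PiLp.proj_apply,
    smul_eq_mul, pderiv, PiLp.single_apply, eq_comm (a := (0 : Fin (d + 1)))]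
  split_ifs <;> simp <;> ring

theorem pderiv_coeff_weight {η a : Space d → ℝ} (hη : ContDiff ℝ ∞ η) (k : Fin (d + 1))
    {x : Space d} (ha : DifferentiableAt ℝ a x) :
    pderiv k (fun x => a x * (x 0 * η x ^ 2)) x =
      (if k = 0 then a x * η x ^ 2 else 0) + x 0 * pderiv k a x * η x ^ 2 +
        2 * x 0 * a x * η x * pderiv k η x := by
  have h1 := (hasFDerivAt_coord_zero x).fun_mul ((hη.differentiable (by simp) x).hasFDerivAt.pow 2)
  have h2 := ha.hasFDerivAt.fun_mul h1
  rw [pderiv, h2.fderiv]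
  simp only [add_apply, smul_apply, PiLp.proj_apply,
    smul_eq_mul, pderiv, PiLp.single_apply, eq_comm (a := (0 : Fin (d + 1)))]
  split_ifs <;> simp <;> ring

theorem coeffSize_ne_top (A : Space d → Matrix (Fin (d + 1)) (Fin (d + 1)) ℂ)
    (B : Space d → Fin (d + 1) → ℂ) (x : Space d) : coeffSize A B x ≠ ⊤ := by
  simp [coeffSize, ENNReal.sum_eq_top]

theorem enorm_sq_le_coeffSize_drift (A : Space d → Matrix (Fin (d + 1)) (Fin (d + 1)) ℂ)
    (B : Space d → Fin (d + 1) → ℂ) (x : Space d) (i : Fin (d + 1)) :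
    ‖B x i‖ₑ ^ 2 ≤ coeffSize A B x :=
  (Finset.single_le_sum (f := fun i => ‖B x i‖ₑ ^ 2) (fun _ _ => zero_le) (Finset.mem_univ i)).trans
    le_add_self

theorem enorm_sq_le_coeffSize_grad (A : Space d → Matrix (Fin (d + 1)) (Fin (d + 1)) ℂ)
    (B : Space d → Fin (d + 1) → ℂ) (x : Space d) (i j k : Fin (d + 1)) :
    ‖pderiv k (fun z => A z i j) x‖ₑ ^ 2 ≤ coeffSize A B x := by
  refine le_trans ?_ le_self_add
  refine le_trans ?_ (Finset.single_le_sum (fun _ _ => zero_le) (Finset.mem_univ i))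
  refine le_trans ?_ (Finset.single_le_sum (fun _ _ => zero_le) (Finset.mem_univ j))
  exact Finset.single_le_sum (f := fun k => ‖pderiv k (fun z => A z i j) x‖ₑ ^ 2)
    (fun _ _ => zero_le) (Finset.mem_univ k)

theorem norm_le_sqrt_toReal_of_enorm_sq_le {E : Type*} [NormedAddCommGroup E] {v : E} {c : ℝ≥0∞}
    (hc : c ≠ ⊤) (h : ‖v‖ₑ ^ 2 ≤ c) : ‖v‖ ≤ √c.toReal := by
  refine Real.le_sqrt_of_sq_le ?_
  have := ENNReal.toReal_mono hc h
  simpa using this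

/-- The weight multiplying `|u|^p` on the right-hand side of the energy inequality. -/
noncomputable def energyWeight (A : Space d → Matrix (Fin (d + 1)) (Fin (d + 1)) ℂ)
    (B : Space d → Fin (d + 1) → ℂ) (lam Lam : ℝ) (η : Space d → ℝ) (x : Space d) : ℝ :=
  (6 * (d + 1) * (Lam + 1)) ^ 2 / lam *
    (x 0 * (‖fderiv ℝ η x‖ ^ 2 + (√(coeffSize A B x).toReal) ^ 2 * η x ^ 2)) +
      2 * |η x| * ‖fderiv ℝ η x‖

theorem abs_pderiv_le (η : Space d → ℝ) (x : Space d) (k : Fin (d + 1)) :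
    |pderiv k η x| ≤ ‖fderiv ℝ η x‖ := by
  have := (fderiv ℝ η x).le_opNorm (EuclideanSpace.single k 1)
  simpa [pderiv] using this

theorem IsPElliptic.one_le {A : Space d → Matrix (Fin (d + 1)) (Fin (d + 1)) ℂ} {p lam Lam : ℝ}
    (hell : IsPElliptic p lam Lam A) (hA : ∀ x ∈ halfSpace d, A x 0 0 = 1) : 1 ≤ Lam := by
  have h := hell.upper
  rw [ae_restrict_iff' isOpen_halfSpace.measurableSet] at h
  have hpos : volume (halfSpace d) ≠ 0 :=
    (isOpen_halfSpace.measure_pos volume ⟨EuclideanSpace.single 0 1, by simp [halfSpace]⟩).ne'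
  obtain ⟨x, hx, hx'⟩ := ((frequently_ae_iff.2 hpos).and_eventually h).exists
  have := hx' hx (EuclideanSpace.single 0 1) (EuclideanSpace.single 0 1)
  rw [sesq_single_single, norm_single_one, hA x hx] at this
  simpa using this

theorem continuousOn_coeffSize {A : Space d → Matrix (Fin (d + 1)) (Fin (d + 1)) ℂ}
    {B : Space d → Fin (d + 1) → ℂ} (hA : ∀ i j, ContDiffOn ℝ ∞ (fun x => A x i j) (halfSpace d))
    (hB : ∀ i, ContDiffOn ℝ ∞ (fun x => B x i) (halfSpace d)) :
    ContinuousOn (coeffSize A B) (halfSpace d) := by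
  unfold coeffSize
  refine ContinuousOn.add (continuousOn_finsetSum _ fun i _ => continuousOn_finsetSum _ fun j _ =>
    continuousOn_finsetSum _ fun k _ => ?_) (continuousOn_finsetSum _ fun i _ => ?_)
  · have h1 := (hA i j).continuousOn_fderiv_of_isOpen isOpen_halfSpace (by simp)
    have h2 : ContinuousOn (pderiv k fun z => A z i j) (halfSpace d) :=
      h1.clm_apply continuousOn_const
    exact (ENNReal.continuous_pow 2).comp_continuousOn h2.enorm
  · exact (ENNReal.continuous_pow 2).comp_continuousOn (hB i).continuousOn.enorm

namespace IsExtendedSolution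

variable {A : Space d → Matrix (Fin (d + 1)) (Fin (d + 1)) ℂ} {B : Space d → Fin (d + 1) → ℂ}
  {h : ℝ} {U : Space d → ℂ} {G : Space d → CVec d}

theorem integrable_test (hU : IsExtendedSolution A B h U G) {K : Set (Space d)}
    (hK : IsCompact K) (hKΩ : K ⊆ halfSpace d) {V : Space d → ℂ} {W : Fin (d + 1) → Space d → ℂ}
    (hV : MemLp V 2 volume) (hW : ∀ i, MemLp (W i) 2 volume)
    (hVK : ∀ x ∉ K, V x = 0) (hWK : ∀ i, ∀ x ∉ K, W i x = 0) :
    Integrable (fun x => (∑ i, (∑ j, A x i j * G x j) * W i x) - (∑ i, B x i * G x i) * V x)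
      volume := by
  have h1 : Integrable (fun x => (∑ i, K.indicator (fun x => ∑ j, A x i j * G x j) x * W i x) -
      K.indicator (fun x => ∑ i, B x i * G x i) x * V x) volume :=
    (integrable_finsetSum _ fun i _ => (hU.memLp_flux hK hKΩ i).integrable_mul (hW i)).sub
      ((hU.memLp_drift hK hKΩ).integrable_mul hV)
  refine h1.congr (.of_forall fun x => ?_)
  by_cases hx : x ∈ K
  · simp [hx]
  · simp [hVK x hx, fun i => hWK i x hx]

variable {p ε : ℝ}

theorem exists_lipschitz_regFun (p : ℝ) (hε : 0 < ε) : ∃ K, 0 ≤ K ∧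
    (∀ z, ‖fderiv ℝ (regFun p ε) z‖ ≤ K) ∧
    ∀ a b, ‖regFun p ε a - regFun p ε b‖ ≤ K * ‖a - b‖ := by
  obtain ⟨K, hK0, hK⟩ := exists_norm_regFunDeriv_le p hε
  have h1 : ∀ z, ‖fderiv ℝ (regFun p ε) z‖ ≤ K := fun z => by
    rw [(hasFDerivAt_regFun hε z).fderiv]; exact hK z
  exact ⟨K, hK0, h1, fun a b => Convex.norm_image_sub_le_of_norm_fderiv_le (𝕜 := ℝ) (s := univ)
      (fun z _ => (hasFDerivAt_regFun hε z).differentiableAt)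
      (fun z _ => h1 z) convex_univ (mem_univ _) (mem_univ _)⟩

theorem memLp_regFun (hU : IsExtendedSolution A B h U G) (p : ℝ) (hε : 0 < ε) (R : ℝ) :
    MemLp (fun x => regFun p ε (U x)) 2 (volume.restrict (ball 0 R)) := by
  obtain ⟨K, -, -, hK⟩ := exists_lipschitz_regFun p hε
  exact memLp_lipschitz_comp hK (contDiff_regFun hε).continuous (by simp [regFun]) (hU.memLp_loc R)

/-- `2 Re (conj F(U) ∂_j U)`, the weak derivative of the primitive `Φ(|U|²)`. -/
noncomputable def dirDeriv (p ε : ℝ) (U : Space d → ℂ) (G : Space d → CVec d) (j : Fin (d + 1))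
    (x : Space d) : ℝ :=
  2 * (star (regFun p ε (U x)) * G x j).re

theorem isWeakDeriv_regInt (hU : IsExtendedSolution A B h U G) (p : ℝ) (hε : 0 < ε)
    (j : Fin (d + 1)) :
    IsWeakDeriv (halfSpace d) j (fun x => ((regInt p ε (‖U x‖ ^ 2) : ℝ) : ℂ))
      (fun x => ((dirDeriv p ε U G j x : ℝ) : ℂ)) := by
  obtain ⟨K, -, -, hK⟩ := exists_lipschitz_regFun p hε
  exact hU.isWeakDeriv_comp_of_lipschitz_fderiv j (contDiff_regInt_normSq hε) (by simp [regInt])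
    (fderiv_regInt_normSq hε) (by simp [regFun]) (contDiff_regFun hε).continuous hK

theorem integrable_dirDeriv_mul (hU : IsExtendedSolution A B h U G) (p : ℝ) (hε : 0 < ε)
    (j : Fin (d + 1)) {χ : Space d → ℝ} (hχ : Continuous χ) (hs : HasCompactSupport χ) :
    Integrable (fun x => dirDeriv p ε U G j x * χ x) volume := by
  have h1 := (memLp_mul_smooth (hU.memLp_regFun p hε) hχ hs).star.integrable_mul
    (hU.memLp_grad_apply j)
  refine (h1.re.const_mul 2).congr (.of_forall fun x => ?_)
  simp only [dirDeriv, RCLike.re_to_complex, Pi.mul_apply, Pi.star_apply, star_mul',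
    RCLike.star_def, Complex.conj_ofReal]
  rw [mul_right_comm, Complex.re_mul_ofReal]
  ring

theorem regInt_normSq_le {p : ℝ} (hp : 1 < p) (hε : 0 < ε) (z : ℂ) :
    regInt p ε (‖z‖ ^ 2) ≤ 2 * (‖z‖ ^ 2 * regPow p ε (‖z‖ ^ 2)) :=
  regInt_le hp hε (sq_nonneg _)

theorem integrable_regInt_mul (hU : IsExtendedSolution A B h U G) (hp : 1 < p) (hε : 0 < ε)
    {χ : Space d → ℝ} (hχ : Continuous χ) (hs : HasCompactSupport χ) :
    Integrable (fun x => regInt p ε (‖U x‖ ^ 2) * χ x) volume := by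
  obtain ⟨K, hK0, hK⟩ := exists_regPow_le p hε
  obtain ⟨R, hR⟩ := hs.isCompact.isBounded.subset_ball (0 : Space d)
  have h1 : MemLp (fun x => ‖U x‖ * ‖U x‖) 1 (volume.restrict (ball 0 R)) :=
    (hU.memLp_loc R).norm.mul' (hU.memLp_loc R).norm
  have hm : Measurable fun x => regInt p ε (‖U x‖ ^ 2) :=
    (contDiff_regInt_normSq hε).continuous.measurable.comp hU.measurable
  have h2 : MemLp (fun x => regInt p ε (‖U x‖ ^ 2)) 1 (volume.restrict (ball 0 R)) := by
    refine h1.of_le_mul (c := 2 * K) hm.aestronglyMeasurable (.of_forall fun x => ?_)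
    rw [Real.norm_of_nonneg (regInt_nonneg hε (sq_nonneg _)), Real.norm_of_nonneg (by positivity)]
    refine (regInt_normSq_le hp hε (U x)).trans ?_
    have := hK _ (sq_nonneg ‖U x‖)
    calc _ ≤ 2 * (‖U x‖ ^ 2 * K) := by gcongr
      _ = _ := by ring
  obtain ⟨C, hC⟩ := hs.exists_bound_of_continuous hχ
  have h3 : Integrable (fun x => regInt p ε (‖U x‖ ^ 2) * χ x) (volume.restrict (ball 0 R)) := by
    refine (memLp_one_iff_integrable.1 h2).mul_bdd (c := C) hχ.aestronglyMeasurable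
      (.of_forall fun x => hC x)
  have h4 : IntegrableOn (fun x => regInt p ε (‖U x‖ ^ 2) * χ x) (ball 0 R) volume := h3
  refine (integrableOn_iff_integrable_of_support_subset fun x hx => ?_).1 h4
  refine hR (subset_tsupport _ fun h0 => hx ?_)
  simp [h0]

theorem integral_dirDeriv_mul (hU : IsExtendedSolution A B h U G) (p : ℝ) (hε : 0 < ε)
    (j : Fin (d + 1)) {χ : Space d → ℝ} (hχ : ContDiff ℝ ∞ χ) (hs : HasCompactSupport χ)
    (hχΩ : tsupport χ ⊆ halfSpace d) :
    ∫ x, dirDeriv p ε U G j x * χ x = -∫ x, regInt p ε (‖U x‖ ^ 2) * pderiv j χ x := by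
  have := hU.isWeakDeriv_regInt p hε j χ hχ hs hχΩ
  simp only [← Complex.ofReal_mul, integral_complex_ofReal] at this
  rw [← Complex.ofReal_neg, Complex.ofReal_inj] at this
  linarith

/-- The regularised energy inequality. -/
theorem lintegral_energy_regularised (hU : IsExtendedSolution A B h U G) {lam Lam : ℝ} (hp : 1 < p)
    (hell : IsPElliptic p lam Lam A)
    (hA : ∀ x ∈ halfSpace d, A x 0 0 = 1 ∧ ∀ j, (A x 0 j).im = 0) (hε : 0 < ε)
    {η : Space d → ℝ} (hη : ContDiff ℝ ∞ η) (hηs : HasCompactSupport η)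
    (hηΩ : tsupport η ⊆ halfSpace d) :
    ∫⁻ x, ENNReal.ofReal (lam / 2 * (regPow p ε (‖U x‖ ^ 2) * ‖G x‖ ^ 2 * (x 0 * η x ^ 2))) ≤
      ∫⁻ x, ENNReal.ofReal (regPow p ε (‖U x‖ ^ 2) * ‖U x‖ ^ 2 * energyWeight A B lam Lam η x) := by
  obtain ⟨K, hK0, hK', hK⟩ := exists_lipschitz_regFun p hε
  have hlam := hell.pos
  have hLam : 1 ≤ Lam := hell.one_le fun x hx => (hA x hx).1
  set ψ : Space d → ℝ := fun x => x 0 * η x ^ 2 with hψdef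
  have hη2 : ContDiff ℝ ∞ (fun x => η x ^ 2) := hη.pow 2
  have hη2s : HasCompactSupport (fun x => η x ^ 2) := by
    have := hηs.mul_left (f := η)
    simpa only [sq] using! this
  have hη2t : tsupport (fun x => η x ^ 2) ⊆ tsupport η :=
    tsupport_comp_subset (g := fun r : ℝ => r ^ 2) (by simp) η
  have hψ : ContDiff ℝ ∞ ψ := (by fun_prop : ContDiff ℝ ∞ fun x : Space d => x 0).mul hη2
  have hψs : HasCompactSupport ψ := hη2s.mul_left
  have hψt : tsupport ψ ⊆ tsupport η := (tsupport_mul_subset_right).trans hη2t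
  -- the test function
  set V : Space d → ℂ := fun x => star (regFun p ε (U x)) * (ψ x : ℂ) with hV
  set W : Fin (d + 1) → Space d → ℂ := fun i x =>
    star (fderiv ℝ (regFun p ε) (U x) (G x i)) * (ψ x : ℂ) +
      star (regFun p ε (U x)) * ((pderiv i ψ x : ℝ) : ℂ) with hW
  have hstar : ∀ R : ℝ, MemLp (fun x => star (regFun p ε (U x))) 2 (volume.restrict (ball 0 R)) :=
    fun R => (hU.memLp_regFun p hε R).star
  have hDF : ∀ i, MemLp (fun x => star (fderiv ℝ (regFun p ε) (U x) (G x i))) 2 volume := by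
    intro i
    refine MemLp.star (f := fun x => fderiv ℝ (regFun p ε) (U x) (G x i)) ?_
    refine (hU.memLp_grad_apply i).of_le_mul (c := K) ?_
      (.of_forall fun x => ContinuousLinearMap.le_of_opNorm_le _ (hK' _) _)
    exact (ContinuousLinearMap.id ℝ (ℂ →L[ℝ] ℂ)).aestronglyMeasurable_comp₂
      (((contDiff_regFun hε).continuous_fderiv one_ne_zero).comp_aestronglyMeasurable
        hU.measurable.aestronglyMeasurable) (hU.memLp_grad_apply i).1
  have hVW : ∀ i, IsWeakDeriv univ i V (W i) := fun i =>
    (hU.isWeakDeriv_comp_of_bounded i (contDiff_regFun hε) (by simp [regFun]) hK').star.mul_smooth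
      (locallyIntegrable_of_memLp_ball hstar) ((hDF i).locallyIntegrable (by norm_num)) hψ hψs
      (hψt.trans hηΩ)
  have hψ0 : ∀ x ∉ tsupport η, ψ x = 0 ∧ ∀ i, pderiv i ψ x = 0 := fun x hx =>
    ⟨image_eq_zero_of_notMem_tsupport fun h => hx (hψt h), fun i =>
      image_eq_zero_of_notMem_tsupport fun h => hx (hψt (tsupport_pderiv_subset ψ i h))⟩
  have hVK : ∀ x ∉ tsupport η, V x = 0 := fun x hx => by simp [hV, (hψ0 x hx).1]
  have hWK : ∀ i, ∀ x ∉ tsupport η, W i x = 0 := fun i x hx => by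
    simp [hW, (hψ0 x hx).1, (hψ0 x hx).2]
  have hVL : MemLp V 2 volume := memLp_mul_smooth hstar hψ.continuous hψs
  have hWL : ∀ i, MemLp (W i) 2 volume := fun i =>
    (memLp_mul_smooth (fun R => (hDF i).restrict _) hψ.continuous hψs).add
      (memLp_mul_smooth hstar (contDiff_pderiv hψ i).continuous (hψs.pderiv i))
  have hVh : ∀ x, h < x 0 → V x = 0 := fun x hx => by
    have : x ∉ strip d h := fun hx' => (hx.trans hx'.2).false
    simp [hV, (hU.eq_zero x this).1, regFun]
  have hT := hU.integral_test hηs hηΩ hVL hWL hVW hVK hWK hVh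
  have hTi := hU.integrable_test hηs hηΩ hVL hWL hVK hWK
  set T : Space d → ℂ := fun x =>
    (∑ i, (∑ j, A x i j * G x j) * W i x) - (∑ i, B x i * G x i) * V x with hTdef
  -- the antisymmetric identities
  set ψc : Fin (d + 1) → Space d → ℝ := fun j x => (A x 0 j).re * ψ x with hψc
  have hre : ∀ j, ContDiffOn ℝ ∞ (fun x => (A x 0 j).re) (halfSpace d) := fun j =>
    Complex.reCLM.contDiff.comp_contDiffOn (hU.contDiffOn_A 0 j)
  have hψcd : ∀ j, ContDiff ℝ ∞ (ψc j) := fun j =>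
    (hre j).mul_of_tsupport_subset isOpen_halfSpace hψ (hψt.trans hηΩ)
  have hψcs : ∀ j, HasCompactSupport (ψc j) := fun j => hψs.mul_left
  have hψct : ∀ j, tsupport (ψc j) ⊆ tsupport η := fun j => (tsupport_mul_subset_right).trans hψt
  set S : Fin (d + 1) → Space d → ℝ := fun j x =>
    dirDeriv p ε U G j x * pderiv 0 (ψc j) x - dirDeriv p ε U G 0 x * pderiv j (ψc j) x with hS
  have hSi : ∀ j, Integrable (S j) volume := fun j =>
    (hU.integrable_dirDeriv_mul p hε j (contDiff_pderiv (hψcd j) 0).continuous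
      ((hψcs j).pderiv 0)).sub
    (hU.integrable_dirDeriv_mul p hε 0 (contDiff_pderiv (hψcd j) j).continuous
      ((hψcs j).pderiv j))
  -- Integrating by parts twice leaves Φ against ∂_j∂₀ψ_j − ∂₀∂_jψ_j = 0. Since ψ_j contains the
  -- factor x₀, the only term of ∂₀ψ_j without x₀ is A_{0j}η², the coefficient of the dangerous
  -- term.
  have hSz : ∀ j, ∫ x, S j x = 0 := fun j => by
    have h1 : ∀ k, tsupport (pderiv k (ψc j)) ⊆ halfSpace d := fun k =>
      (tsupport_pderiv_subset _ _).trans ((hψct j).trans hηΩ)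
    rw [integral_sub (hU.integrable_dirDeriv_mul p hε j (contDiff_pderiv (hψcd j) 0).continuous
      ((hψcs j).pderiv 0)) (hU.integrable_dirDeriv_mul p hε 0
      (contDiff_pderiv (hψcd j) j).continuous ((hψcs j).pderiv j)),
      hU.integral_dirDeriv_mul p hε j (contDiff_pderiv (hψcd j) 0) ((hψcs j).pderiv 0) (h1 0),
      hU.integral_dirDeriv_mul p hε 0 (contDiff_pderiv (hψcd j) j) ((hψcs j).pderiv j) (h1 j),
      pderiv_comm (hψcd j) j 0]
    ring
  -- For j = 0 the identity above is void, and D₀η² is instead integrated by parts directly onto η².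
  set S' : Space d → ℝ := fun x => dirDeriv p ε U G 0 x * η x ^ 2 +
    regInt p ε (‖U x‖ ^ 2) * pderiv 0 (fun x => η x ^ 2) x with hS'
  have hS'1 := hU.integrable_dirDeriv_mul p hε 0 hη2.continuous hη2s
  have hS'2 := hU.integrable_regInt_mul hp hε (contDiff_pderiv hη2 0).continuous (hη2s.pderiv 0)
  have hS'i : Integrable S' volume := hS'1.add hS'2
  have hS'z : ∫ x, S' x = 0 := by
    rw [integral_add hS'1 hS'2,
      hU.integral_dirDeriv_mul p hε 0 hη2 hη2s (hη2t.trans hηΩ)]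
    ring
  -- the right-hand side
  set bd : Space d → ℝ := fun x =>
    regPow p ε (‖U x‖ ^ 2) * ‖U x‖ ^ 2 * energyWeight A B lam Lam η x with hbd
  have hRc : Continuous fun z : ℂ => regPow p ε (‖z‖ ^ 2) :=
    (continuousOn_regPow hε).comp_continuous (by fun_prop) fun z => sq_nonneg ‖z‖
  have hRm : Measurable fun x => regPow p ε (‖U x‖ ^ 2) := hRc.measurable.comp hU.measurable
  have hR0 : ∀ x, 0 ≤ regPow p ε (‖U x‖ ^ 2) := fun x => (regPow_pos hε (sq_nonneg _)).le
  rcases eq_or_ne (∫⁻ x, ENNReal.ofReal (bd x)) ⊤ with htop | htop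
  · rw [htop]; exact le_top
  have hx0 : ∀ x, 0 ≤ x 0 * η x ^ 2 := fun x => by
    by_cases hx : x ∈ tsupport η
    · have : 0 < x 0 := hηΩ hx
      positivity
    · simp [image_eq_zero_of_notMem_tsupport hx]
  have hfη : ∀ x ∉ tsupport η, fderiv ℝ η x = 0 := fun x hx =>
    image_eq_zero_of_notMem_tsupport fun h => hx (tsupport_fderiv_subset ℝ h)
  have hbd0 : ∀ x, 0 ≤ bd x := fun x => by
    refine mul_nonneg (mul_nonneg (hR0 x) (sq_nonneg _)) ?_
    by_cases hx : x ∈ tsupport η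
    · have : 0 < x 0 := hηΩ hx
      unfold energyWeight
      positivity
    · simp [energyWeight, hfη x hx, image_eq_zero_of_notMem_tsupport hx]
  have hbdm : AEStronglyMeasurable bd volume := by
    have hcm : AEMeasurable (fun x => (coeffSize A B x).toReal) (volume.restrict (halfSpace d)) :=
      ((continuousOn_coeffSize hU.contDiffOn_A hU.contDiffOn_B).aemeasurable
        isOpen_halfSpace.measurableSet).ennreal_toReal
    have h1 : AEMeasurable bd (volume.restrict (halfSpace d)) := by
      have h2 : AEMeasurable (energyWeight A B lam Lam η) (volume.restrict (halfSpace d)) := by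
        have hm1 : Measurable η := hη.continuous.measurable
        have hm2 : Measurable (fderiv ℝ η) := (hη.continuous_fderiv (by simp)).measurable
        unfold energyWeight
        have hm3 : AEMeasurable (fun x => √(coeffSize A B x).toReal)
          (volume.restrict (halfSpace d)) := hcm.sqrt
        have hm4 : Measurable fun x : Space d => x 0 := by fun_prop
        fun_prop
      exact ((hRm.mul (hU.measurable.norm.pow_const 2)).aemeasurable).mul h2
    have h3 : bd = (halfSpace d).indicator bd := by
      ext x
      by_cases hx : x ∈ halfSpace d
      · simp [hx]
      · have hx' : x ∉ tsupport η := fun h => hx (hηΩ h)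
        simp [hx, hbd, energyWeight, hfη x hx', image_eq_zero_of_notMem_tsupport hx']
    rw [h3]
    exact ((aemeasurable_indicator_iff isOpen_halfSpace.measurableSet).2 h1).aestronglyMeasurable
  have hbdi : Integrable bd volume :=
    ⟨hbdm, (hasFiniteIntegral_iff_ofReal (.of_forall hbd0)).2 (lt_top_iff_ne_top.2 htop)⟩
  -- The tested equation minus half of the identities has integral zero, so it remains only to check
  -- lhs ≤ f + bd pointwise.
  set f : Space d → ℝ := fun x => (T x).re - 1 / 2 * ((∑ j, S j x) + S' x) with hf
  have hTre : Integrable (fun x => (T x).re) volume := hTi.re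
  have hSsum : Integrable (fun x => ∑ j, S j x) volume := integrable_finsetSum _ fun j _ => hSi j
  have hSS : Integrable (fun x => (∑ j, S j x) + S' x) volume := hSsum.add hS'i
  have hfi : Integrable f volume := hTre.sub (hSS.const_mul _)
  have hfz : ∫ x, f x = 0 := by
    have h1 := integral_re hTi
    simp only [RCLike.re_to_complex] at h1
    simp only [hf]
    rw [integral_sub hTre (hSS.const_mul _), integral_const_mul,
      integral_add hSsum hS'i, integral_finsetSum _ fun j _ => hSi j, h1, hT, hS'z]
    simp [hSz]
  set lhs : Space d → ℝ := fun x =>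
    lam / 2 * (regPow p ε (‖U x‖ ^ 2) * ‖G x‖ ^ 2 * (x 0 * η x ^ 2)) with hlhs
  have hlhs0 : ∀ x, 0 ≤ lhs x := fun x =>
    mul_nonneg (by positivity) (mul_nonneg (mul_nonneg (hR0 x) (sq_nonneg _)) (hx0 x))
  have hpt : ∀ᵐ x ∂volume, lhs x ≤ f x + bd x := by
    have e1 := (ae_restrict_iff' isOpen_halfSpace.measurableSet).1 hell.lower
    have e2 := (ae_restrict_iff' isOpen_halfSpace.measurableSet).1 hell.upper
    filter_upwards [e1, e2] with x h1 h2
    by_cases hx : x ∈ tsupport η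
    · have hxΩ := hηΩ hx
      have hda : ∀ j, DifferentiableAt ℝ (fun x => (A x 0 j).re) x := fun j =>
        ((hre j).contDiffAt (isOpen_halfSpace.mem_nhds hxΩ)).differentiableAt (by simp)
      have hdA : ∀ j, DifferentiableAt ℝ (fun x => A x 0 j) x := fun j =>
        ((hU.contDiffOn_A 0 j).contDiffAt (isOpen_halfSpace.mem_nhds hxΩ)).differentiableAt (by simp)
      have hxpos : 0 < x 0 := hxΩ
      have hrate0 : 0 ≤ regRate ε (‖U x‖ ^ 2) := by unfold regRate; positivity
      have hcoer := le_re_sesq_fderiv hp hlam (h1 hxΩ) (hR0 x)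
        (regRate_nonneg hε (sq_nonneg ‖U x‖)) (regRate_le_one hε (sq_nonneg ‖U x‖)) (U x)
        (φ' := (p - 2) / 2 * regRate ε (‖U x‖ ^ 2) * regPow p ε (‖U x‖ ^ 2)) (by ring) (G x)
      have key := energy_pointwise (M := A x) (b := B x) (ξ := G x) (z := U x) (t := x 0) (e := η x)
        (R := regPow p ε (‖U x‖ ^ 2)) (Φ := regInt p ε (‖U x‖ ^ 2)) (N := ‖fderiv ℝ η x‖)
        (s := √(coeffSize A B x).toReal) (ν := fun i => pderiv i η x)
        (α := fun k j => pderiv k (fun x => (A x 0 j).re) x)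
        (D := fun j => dirDeriv p ε U G j x) hxpos hlam (by linarith) (hA x hxΩ).1
        (hA x hxΩ).2 (h2 hxΩ) hcoer (hR0 x) (regInt_nonneg hε (sq_nonneg _))
        (regInt_normSq_le hp hε _) (abs_pderiv_le η x) (Real.sqrt_nonneg _)
        (fun i => norm_le_sqrt_toReal_of_enorm_sq_le (coeffSize_ne_top A B x)
          (enorm_sq_le_coeffSize_drift A B x i))
        (fun k j => by
          rw [pderiv_re (hdA j)]
          exact (Complex.abs_re_le_norm _).trans (norm_le_sqrt_toReal_of_enorm_sq_le
            (coeffSize_ne_top A B x) (enorm_sq_le_coeffSize_grad A B x 0 j k)))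
        (fun j => rfl)
      refine key.trans_eq ?_
      simp only [hf, hbd, hTdef, hW, hV, hS, hS', hψc, hψdef, pderiv_weight hη,
        pderiv_coeff_weight hη _ (hda _), pderiv_sq hη, (hasFDerivAt_regFun hε _).fderiv,
        regFunDeriv_apply, regFun, energyWeight, if_true]
    · have hS0 : ∀ j, S j x = 0 := fun j => by
        have : ∀ k, pderiv k (ψc j) x = 0 := fun k =>
          image_eq_zero_of_notMem_tsupport fun h => hx (hψct j (tsupport_pderiv_subset _ _ h))
        simp [hS, this]
      have hS'0 : S' x = 0 := by
        simp [hS', pderiv_sq hη, image_eq_zero_of_notMem_tsupport hx]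
      have hT0 : T x = 0 := by simp [hTdef, hVK x hx, fun i => hWK i x hx]
      simp only [hlhs, hf, hS0, hS'0, hT0, image_eq_zero_of_notMem_tsupport hx]
      simpa using hbd0 x
  have hlhsm : AEStronglyMeasurable lhs volume := by
    have hm1 : Measurable η := hη.continuous.measurable
    have hm4 : Measurable fun x : Space d => x 0 := by fun_prop
    have hm5 := hU.measurable_grad
    exact (by fun_prop : Measurable lhs).aestronglyMeasurable
  have hlhsi : Integrable lhs volume := by
    refine (hfi.add hbdi).mono' hlhsm ?_
    filter_upwards [hpt] with x hx
    rw [Real.norm_of_nonneg (hlhs0 x)]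
    exact hx
  rw [← ofReal_integral_eq_lintegral_ofReal hlhsi (.of_forall hlhs0),
    ← ofReal_integral_eq_lintegral_ofReal hbdi (.of_forall hbd0)]
  refine ENNReal.ofReal_le_ofReal ?_
  calc ∫ x, lhs x ≤ ∫ x, (f x + bd x) := integral_mono_ae hlhsi (hfi.add hbdi) hpt
    _ = ∫ x, bd x := by rw [integral_add hfi hbdi, hfz, zero_add]

end IsExtendedSolution

/-! ### Removal of the regularisation -/

/-- The limit is taken in [0, ∞] so that z = 0 is included: there it is ∞ for p < 2. Multiplied by a
vanishing gradient this still gives 0, in line with the convention for |∇u|²|u|^{p-2}. -/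
theorem tendsto_ofReal_regPow (p : ℝ) (z : ℂ) :
    Tendsto (fun ε => ENNReal.ofReal (regPow p ε (‖z‖ ^ 2))) (𝓝[>] 0) (𝓝 (‖z‖ₑ ^ (p - 2))) := by
  have h1 : Tendsto (fun ε : ℝ => (ε + ‖z‖ ^ 2) / (1 + ε * (ε + ‖z‖ ^ 2))) (𝓝[>] 0)
      (𝓝 (‖z‖ ^ 2)) := by
    have : ContinuousAt (fun ε : ℝ => (ε + ‖z‖ ^ 2) / (1 + ε * (ε + ‖z‖ ^ 2))) 0 := by
      refine ContinuousAt.div (by fun_prop) (by fun_prop) (by simp)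
    have h := this.tendsto.mono_left (nhdsWithin_le_nhds (s := Ioi 0))
    simpa using h
  have h2 := ((ENNReal.continuous_rpow_const (y := (p - 2) / 2)).tendsto _).comp
    ((ENNReal.continuous_ofReal.tendsto _).comp h1)
  have h3 : ENNReal.ofReal (‖z‖ ^ 2) ^ ((p - 2) / 2) = ‖z‖ₑ ^ (p - 2) := by
    rw [ENNReal.ofReal_pow (norm_nonneg _), ofReal_norm, ← ENNReal.rpow_natCast,
      ← ENNReal.rpow_mul]
    congr 1; push_cast; ring
  rw [h3] at h2
  refine h2.congr' ?_
  filter_upwards [self_mem_nhdsWithin] with ε (hε : 0 < ε)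
  simp only [Function.comp, regPow]
  rw [ENNReal.ofReal_rpow_of_pos (by positivity)]

theorem tendsto_mul_regPow {p : ℝ} (hp : 0 < p) (z : ℂ) :
    Tendsto (fun ε => regPow p ε (‖z‖ ^ 2) * ‖z‖ ^ 2) (𝓝[>] 0) (𝓝 (‖z‖ ^ p)) := by
  rcases eq_or_ne z 0 with rfl | hz
  · simp [Real.zero_rpow hp.ne']
  · have hz' : 0 < ‖z‖ := norm_pos_iff.2 hz
    have h := (tendsto_regPow (p := p) (sq_pos_of_pos hz')).mul_const (‖z‖ ^ 2)
    convert h using 2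
    rw [← Real.rpow_natCast, ← Real.rpow_mul hz'.le, ← Real.rpow_add hz']
    congr 1; push_cast; ring

/-- The majorant for dominated convergence. Against a bounded, compactly supported weight it is
integrable once |u|^p is, because u is locally in L². -/
theorem regPow_mul_le {p ε : ℝ} (hp : 1 < p) (hε : 0 < ε) (hε1 : ε ≤ 1) (z : ℂ) :
    regPow p ε (‖z‖ ^ 2) * ‖z‖ ^ 2 ≤ (1 + 2 ^ (p / 2)) + ‖z‖ ^ 2 + 2 ^ (p / 2) * ‖z‖ ^ p := by
  have h := mul_regPow_le hp hε hε1 (sq_nonneg ‖z‖)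
  have h2 : (1 + ‖z‖ ^ 2) ^ (p / 2) ≤ 2 ^ (p / 2) * (1 + ‖z‖ ^ p) := by
    have h3 : (‖z‖ ^ 2) ^ (p / 2) = ‖z‖ ^ p := by
      rw [← Real.rpow_natCast, ← Real.rpow_mul (norm_nonneg _)]
      congr 1; push_cast; ring
    rcases le_total (‖z‖ ^ 2) 1 with h1 | h1
    · calc (1 + ‖z‖ ^ 2) ^ (p / 2) ≤ 2 ^ (p / 2) :=
          Real.rpow_le_rpow (by positivity) (by linarith) (by linarith)
        _ ≤ _ := le_mul_of_one_le_right (by positivity)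
          (le_add_of_nonneg_right (Real.rpow_nonneg (norm_nonneg _) _))
    · calc (1 + ‖z‖ ^ 2) ^ (p / 2) ≤ (2 * ‖z‖ ^ 2) ^ (p / 2) :=
          Real.rpow_le_rpow (by positivity) (by linarith) (by linarith)
        _ = 2 ^ (p / 2) * ‖z‖ ^ p := by rw [Real.mul_rpow (by norm_num) (sq_nonneg _), h3]
        _ ≤ _ := by gcongr; linarith
  linarith

theorem energyWeight_nonneg {A : Space d → Matrix (Fin (d + 1)) (Fin (d + 1)) ℂ}
    {B : Space d → Fin (d + 1) → ℂ} {lam Lam : ℝ} (hlam : 0 < lam) {η : Space d → ℝ}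
    (hηΩ : tsupport η ⊆ halfSpace d) (x : Space d) : 0 ≤ energyWeight A B lam Lam η x := by
  by_cases hx : x ∈ tsupport η
  · have : 0 < x 0 := hηΩ hx
    unfold energyWeight
    positivity
  · have : fderiv ℝ η x = 0 :=
      image_eq_zero_of_notMem_tsupport fun h => hx (tsupport_fderiv_subset ℝ h)
    simp [energyWeight, this, image_eq_zero_of_notMem_tsupport hx]

theorem continuous_energyWeight {A : Space d → Matrix (Fin (d + 1)) (Fin (d + 1)) ℂ}
    {B : Space d → Fin (d + 1) → ℂ} (hA : ∀ i j, ContDiffOn ℝ ∞ (fun x => A x i j) (halfSpace d))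
    (hB : ∀ i, ContDiffOn ℝ ∞ (fun x => B x i) (halfSpace d)) (lam Lam : ℝ) {η : Space d → ℝ}
    (hη : ContDiff ℝ ∞ η) (hηΩ : tsupport η ⊆ halfSpace d) :
    Continuous (energyWeight A B lam Lam η) := by
  rw [continuous_iff_continuousAt]
  intro x
  by_cases hx : x ∈ tsupport η
  · have hc := (continuousOn_coeffSize hA hB).continuousAt (isOpen_halfSpace.mem_nhds (hηΩ hx))
    have hc' : ContinuousAt (fun x => √(coeffSize A B x).toReal) x :=
      Real.continuous_sqrt.continuousAt.comp
        ((ENNReal.tendsto_toReal (coeffSize_ne_top A B x)).comp hc)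
    have h1 : Continuous fun x => ‖fderiv ℝ η x‖ := (hη.continuous_fderiv (by simp)).norm
    have h2 := hη.continuous
    have h3 := h1.continuousAt (x := x)
    have h4 := h2.continuousAt (x := x)
    unfold energyWeight
    have h5 : ContinuousAt (fun x : Space d => x 0) x := by fun_prop
    exact (continuousAt_const.mul (h5.mul ((h3.pow 2).add ((hc'.pow 2).mul (h4.pow 2))))).add
      ((continuousAt_const.mul h4.abs).mul h3)
  · have : energyWeight A B lam Lam η =ᶠ[𝓝 x] fun _ => 0 := by
      filter_upwards [(isClosed_tsupport η).isOpen_compl.mem_nhds hx] with y hy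
      have : fderiv ℝ η y = 0 :=
        image_eq_zero_of_notMem_tsupport fun h => hy (tsupport_fderiv_subset ℝ h)
      simp [energyWeight, this, image_eq_zero_of_notMem_tsupport hy]
    exact continuousAt_const.congr this.symm

theorem hasCompactSupport_energyWeight (A : Space d → Matrix (Fin (d + 1)) (Fin (d + 1)) ℂ)
    (B : Space d → Fin (d + 1) → ℂ) (lam Lam : ℝ) {η : Space d → ℝ} (hηs : HasCompactSupport η) :
    HasCompactSupport (energyWeight A B lam Lam η) := by
  refine HasCompactSupport.intro hηs fun x hx => ?_
  have : fderiv ℝ η x = 0 :=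
    image_eq_zero_of_notMem_tsupport fun h => hx (tsupport_fderiv_subset ℝ h)
  simp [energyWeight, this, image_eq_zero_of_notMem_tsupport hx]

/-- The `p`-adapted energy inequality. -/
theorem IsExtendedSolution.lintegral_energy_le
    {A : Space d → Matrix (Fin (d + 1)) (Fin (d + 1)) ℂ} {B : Space d → Fin (d + 1) → ℂ}
    {h p lam Lam : ℝ} {U : Space d → ℂ} {G : Space d → CVec d}
    (hU : IsExtendedSolution A B h U G) (hp : 1 < p) (hell : IsPElliptic p lam Lam A)
    (hA : ∀ x ∈ halfSpace d, A x 0 0 = 1 ∧ ∀ j, (A x 0 j).im = 0) {η : Space d → ℝ}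
    (hη : ContDiff ℝ ∞ η) (hηs : HasCompactSupport η) (hηΩ : tsupport η ⊆ halfSpace d) :
    ∫⁻ x, ‖G x‖ₑ ^ 2 * ‖U x‖ₑ ^ (p - 2) * ENNReal.ofReal (x 0 * η x ^ 2) ≤
      ENNReal.ofReal (2 / lam) *
        ∫⁻ x, ‖U x‖ₑ ^ p * ENNReal.ofReal (energyWeight A B lam Lam η x) := by
  have hlam := hell.pos
  set W := energyWeight A B lam Lam η with hW
  have hW0 : ∀ x, 0 ≤ W x := energyWeight_nonneg hlam hηΩ
  have hWc : Continuous W := continuous_energyWeight hU.contDiffOn_A hU.contDiffOn_B lam Lam hη hηΩ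
  have hWs : HasCompactSupport W := hasCompactSupport_energyWeight A B lam Lam hηs
  have hUp : ∀ x, ENNReal.ofReal (‖U x‖ ^ p) = ‖U x‖ₑ ^ p := fun x => by
    rw [← ofReal_norm, ENNReal.ofReal_rpow_of_nonneg (norm_nonneg _) (by linarith)]
  rcases eq_or_ne (∫⁻ x, ‖U x‖ₑ ^ p * ENNReal.ofReal (W x)) ⊤ with htop | htop
  · rw [htop, ENNReal.mul_top (by simpa using hlam)]; exact le_top
  set e : ℕ → ℝ := fun n => 1 / ((n : ℝ) + 1) with he
  have he0 : ∀ n, 0 < e n := fun n => by positivity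
  have he1 : ∀ n, e n ≤ 1 := fun n => by
    rw [he]; simp only; rw [div_le_one (by positivity)]; linarith [n.cast_nonneg (α := ℝ)]
  have het : Tendsto e atTop (𝓝[>] 0) :=
    tendsto_nhdsWithin_iff.2 ⟨tendsto_one_div_add_atTop_nhds_zero_nat,
      .of_forall fun n => he0 n⟩
  have hRm : ∀ n, Measurable fun x => regPow p (e n) (‖U x‖ ^ 2) := fun n =>
    ((continuousOn_regPow (he0 n)).comp_continuous (f := fun z : ℂ => ‖z‖ ^ 2)
      (by fun_prop) fun z => sq_nonneg ‖z‖).measurable.comp hU.measurable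
  have hUm := hU.measurable
  have hGm := hU.measurable_grad
  have hηm := hη.continuous.measurable
  have hx0m : Measurable fun x : Space d => x 0 := by fun_prop
  set L : ℕ → Space d → ℝ≥0∞ := fun n x => ENNReal.ofReal
    (lam / 2 * (regPow p (e n) (‖U x‖ ^ 2) * ‖G x‖ ^ 2 * (x 0 * η x ^ 2))) with hL
  set R : ℕ → Space d → ℝ≥0∞ := fun n x => ENNReal.ofReal
    (regPow p (e n) (‖U x‖ ^ 2) * ‖U x‖ ^ 2 * W x) with hR
  have hLR : ∀ n, ∫⁻ x, L n x ≤ ∫⁻ x, R n x := fun n =>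
    hU.lintegral_energy_regularised hp hell hA (he0 n) hη hηs hηΩ
  have hRt : Tendsto (fun n => ∫⁻ x, R n x) atTop
      (𝓝 (∫⁻ x, ‖U x‖ₑ ^ p * ENNReal.ofReal (W x))) := by
    set K : ℝ := 2 ^ (p / 2) with hK
    have hK0 : 0 ≤ K := by positivity
    refine tendsto_lintegral_of_dominated_convergence
      (fun x => ENNReal.ofReal (1 + K) * ENNReal.ofReal (W x) + ‖U x‖ₑ ^ 2 * ENNReal.ofReal (W x) +
        ENNReal.ofReal K * (‖U x‖ₑ ^ p * ENNReal.ofReal (W x)))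
      (fun n => (((hRm n).mul (hUm.norm.pow_const 2)).mul hWc.measurable).ennreal_ofReal)
      (fun n => .of_forall fun x => ?_) ?_ (.of_forall fun x => ?_)
    · have h1 := mul_le_mul_of_nonneg_right (regPow_mul_le hp (he0 n) (he1 n) (U x)) (hW0 x)
      refine (ENNReal.ofReal_le_ofReal h1).trans_eq ?_
      rw [ENNReal.ofReal_mul (by positivity), ENNReal.ofReal_add (by positivity) (by positivity),
        ENNReal.ofReal_add (by positivity) (by positivity), ENNReal.ofReal_mul hK0, hUp,
        ENNReal.ofReal_pow (norm_nonneg _), ofReal_norm, add_mul, add_mul, mul_assoc]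
    · have hWm := hWc.measurable
      have hWi : ∫⁻ x, ENNReal.ofReal (W x) ≠ ⊤ := by
        have := (hWc.integrable_of_hasCompactSupport (μ := volume) hWs).2
        rw [hasFiniteIntegral_iff_ofReal (.of_forall hW0)] at this
        exact this.ne
      rw [lintegral_add_left (by fun_prop), lintegral_add_left (by fun_prop),
        lintegral_const_mul _ (by fun_prop), lintegral_const_mul _ (by fun_prop)]
      refine ENNReal.add_ne_top.2 ⟨ENNReal.add_ne_top.2 ⟨ENNReal.mul_ne_top (by simp) hWi, ?_⟩,
        ENNReal.mul_ne_top (by simp) htop⟩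
      obtain ⟨Rr, hRr⟩ := hWs.isCompact.isBounded.subset_ball (0 : Space d)
      obtain ⟨c, hc⟩ := hWs.exists_bound_of_continuous hWc
      have h2 : ∀ x, ‖U x‖ₑ ^ 2 * ENNReal.ofReal (W x) ≤
          ENNReal.ofReal c * (ball 0 Rr).indicator (fun x => ‖U x‖ₑ ^ 2) x := by
        intro x
        by_cases hx : x ∈ tsupport W
        · rw [indicator_of_mem (hRr hx), mul_comm]
          gcongr
          exact (le_abs_self _).trans (hc x)
        · simp [image_eq_zero_of_notMem_tsupport hx]
      refine ne_top_of_le_ne_top ?_ (lintegral_mono h2)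
      rw [lintegral_const_mul _ ((hUm.enorm.pow_const 2).indicator measurableSet_ball),
        lintegral_indicator measurableSet_ball]
      refine ENNReal.mul_ne_top (by simp) ?_
      have := (hU.memLp_loc Rr).2
      rw [eLpNorm_lt_top_iff_lintegral_rpow_enorm_lt_top (by simp) (by simp)] at this
      simpa using this.ne
    · have h1 := ((tendsto_mul_regPow (by linarith : 0 < p) (U x)).comp het).mul_const (W x)
      have h2 := (ENNReal.continuous_ofReal.tendsto _).comp h1
      rw [ENNReal.ofReal_mul (by positivity), hUp] at h2
      exact h2
  have hLt : ∀ x, Tendsto (fun n => L n x) atTop (𝓝 (ENNReal.ofReal (lam / 2) *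
      (‖G x‖ₑ ^ 2 * ‖U x‖ₑ ^ (p - 2) * ENNReal.ofReal (x 0 * η x ^ 2)))) := by
    intro x
    have h1 := ENNReal.Tendsto.const_mul (a := ENNReal.ofReal (lam / 2) *
      (‖G x‖ₑ ^ 2 * ENNReal.ofReal (x 0 * η x ^ 2))) ((tendsto_ofReal_regPow p (U x)).comp het)
      (.inr (ENNReal.mul_ne_top (by simp) (ENNReal.mul_ne_top (by simp) (by simp))))
    have e1 : ENNReal.ofReal (lam / 2) * (‖G x‖ₑ ^ 2 * ENNReal.ofReal (x 0 * η x ^ 2)) *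
        ‖U x‖ₑ ^ (p - 2) = ENNReal.ofReal (lam / 2) *
      (‖G x‖ₑ ^ 2 * ‖U x‖ₑ ^ (p - 2) * ENNReal.ofReal (x 0 * η x ^ 2)) := by ring
    rw [e1] at h1
    refine h1.congr fun n => ?_
    simp only [hL, Function.comp]
    have h3 := (regPow_pos (p := p) (he0 n) (sq_nonneg ‖U x‖)).le
    rw [ENNReal.ofReal_mul (by positivity : 0 ≤ lam / 2),
      ENNReal.ofReal_mul (mul_nonneg h3 (sq_nonneg _)), ENNReal.ofReal_mul h3, ENNReal.ofReal_pow (norm_nonneg _), ofReal_norm]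
    ring
  -- On the left no integrability is known beforehand, and Fatou's lemma suffices. On the right
  -- convergence is dominated.
  have hfatou : ∫⁻ x, ENNReal.ofReal (lam / 2) *
      (‖G x‖ₑ ^ 2 * ‖U x‖ₑ ^ (p - 2) * ENNReal.ofReal (x 0 * η x ^ 2)) ≤
      ∫⁻ x, ‖U x‖ₑ ^ p * ENNReal.ofReal (W x) := by
    calc _ = ∫⁻ x, liminf (fun n => L n x) atTop :=
          lintegral_congr fun x => (hLt x).liminf_eq.symm
      _ ≤ liminf (fun n => ∫⁻ x, L n x) atTop := lintegral_liminf_le fun n => by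
          have := hRm n
          fun_prop
      _ ≤ liminf (fun n => ∫⁻ x, R n x) atTop := liminf_le_liminf (.of_forall hLR)
      _ = _ := hRt.liminf_eq
  rw [lintegral_const_mul _ (by fun_prop)] at hfatou
  calc _ = ENNReal.ofReal (2 / lam) * (ENNReal.ofReal (lam / 2) *
      ∫⁻ x, ‖G x‖ₑ ^ 2 * ‖U x‖ₑ ^ (p - 2) * ENNReal.ofReal (x 0 * η x ^ 2)) := by
        rw [← mul_assoc, ← ENNReal.ofReal_mul (by positivity)]
        have : 2 / lam * (lam / 2) = 1 := by field_simp
        rw [this, ENNReal.ofReal_one, one_mul]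
    _ ≤ _ := by gcongr

/-! ### Layer cake formulas -/

theorem setLIntegral_Ioo_rpow {r t : ℝ} (hr : 0 < r) (ht : 0 ≤ t) :
    ∫⁻ l in Ioo 0 t, ENNReal.ofReal (r * l ^ (r - 1)) = ENNReal.ofReal (t ^ r) := by
  have h1 : IntervalIntegrable (fun l : ℝ => l ^ (r - 1)) volume 0 t :=
    intervalIntegral.intervalIntegrable_rpow' (by linarith)
  have h2 := h1.const_mul r
  rw [intervalIntegrable_iff_integrableOn_Ioo_of_le ht] at h2
  rw [← ofReal_integral_eq_lintegral_ofReal h2 ((ae_restrict_iff' measurableSet_Ioo).2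
    (.of_forall fun l hl => mul_nonneg hr.le (Real.rpow_nonneg hl.1.le _)))]
  congr 1
  rw [← integral_Ioc_eq_integral_Ioo, ← intervalIntegral.integral_of_le ht,
    intervalIntegral.integral_const_mul, integral_rpow (.inl (by linarith))]
  simp [Real.zero_rpow hr.ne']
  field_simp

theorem lintegral_indicator_lt_rpow {r : ℝ} (hr : 0 < r) (s : ℝ≥0∞) :
    ∫⁻ l in Ioi (0 : ℝ), {l : ℝ | ENNReal.ofReal l < s}.indicator
      (fun l => ENNReal.ofReal (r * l ^ (r - 1))) l = s ^ r := by
  have hm : MeasurableSet {l : ℝ | ENNReal.ofReal l < s} :=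
    measurableSet_lt ENNReal.measurable_ofReal measurable_const
  rw [setLIntegral_indicator hm]
  rcases eq_or_ne s ⊤ with rfl | hs
  · rw [ENNReal.top_rpow_of_pos hr, eq_top_iff]
    refine ENNReal.le_of_forall_nnreal_lt fun k _ => ?_
    have h1 : Ioo (0 : ℝ) ((k : ℝ) ^ (1 / r)) ⊆ {l : ℝ | ENNReal.ofReal l < ⊤} ∩ Ioi 0 :=
      fun l hl => ⟨by simp, hl.1⟩
    refine le_trans ?_ (lintegral_mono_set h1)
    rw [setLIntegral_Ioo_rpow hr (by positivity), ← Real.rpow_mul k.coe_nonneg, one_div,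
      inv_mul_cancel₀ hr.ne', Real.rpow_one, ENNReal.ofReal_coe_nnreal]
  · lift s to ℝ≥0 using hs
    have h1 : {l : ℝ | ENNReal.ofReal l < s} ∩ Ioi 0 = Ioo (0 : ℝ) s := by
      ext l
      simp only [mem_inter_iff, mem_ofPred_eq, mem_Ioi, mem_Ioo, and_comm (a := 0 < l)]
      refine and_congr_left fun hl => ?_
      rw [← ENNReal.ofReal_coe_nnreal, ENNReal.ofReal_lt_ofReal_iff_of_nonneg hl.le]
    rw [h1, setLIntegral_Ioo_rpow hr s.coe_nonneg,
      ← ENNReal.ofReal_rpow_of_nonneg s.coe_nonneg hr.le, ENNReal.ofReal_coe_nnreal]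

theorem lintegral_rpow_eq_lintegral_meas {α : Type*} [MeasurableSpace α] {μ : Measure α} [SFinite μ]
    {g : α → ℝ≥0∞} (hg : Measurable g) {r : ℝ} (hr : 0 < r) :
    ∫⁻ x, g x ^ r ∂μ =
      ∫⁻ l in Ioi (0 : ℝ), ENNReal.ofReal (r * l ^ (r - 1)) * μ {x | ENNReal.ofReal l < g x} := by
  have h1 : ∫⁻ x, g x ^ r ∂μ = ∫⁻ x, (∫⁻ l in Ioi (0 : ℝ),
      {l : ℝ | ENNReal.ofReal l < g x}.indicator
        (fun l => ENNReal.ofReal (r * l ^ (r - 1))) l) ∂μ := by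
    simp_rw [lintegral_indicator_lt_rpow hr]
  have hS : MeasurableSet {z : α × ℝ | ENNReal.ofReal z.2 < g z.1} :=
    measurableSet_lt (ENNReal.measurable_ofReal.comp measurable_snd) (hg.comp measurable_fst)
  rw [h1, lintegral_lintegral_swap]
  · refine lintegral_congr fun l => ?_
    have hS' : MeasurableSet {x : α | ENNReal.ofReal l < g x} := measurableSet_lt measurable_const hg
    rw [← lintegral_indicator_const hS']
    refine lintegral_congr fun x => ?_
    by_cases h : ENNReal.ofReal l < g x <;> simp [h]
  · refine Measurable.aemeasurable ?_
    have : Function.uncurry (fun (x : α) (l : ℝ) => {l : ℝ | ENNReal.ofReal l < g x}.indicator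
        (fun l => ENNReal.ofReal (r * l ^ (r - 1))) l) =
        {z : α × ℝ | ENNReal.ofReal z.2 < g z.1}.indicator
          (fun z => ENNReal.ofReal (r * z.2 ^ (r - 1))) := by
      ext ⟨x, l⟩
      by_cases h : ENNReal.ofReal l < g x <;> simp [Function.uncurry, h]
    rw [this]
    exact (by fun_prop : Measurable fun z : α × ℝ => ENNReal.ofReal (r * z.2 ^ (r - 1))).indicator hS

theorem lintegral_rpow_le_of_meas_le {α β : Type*} [MeasurableSpace α] [MeasurableSpace β]
    {μ : Measure α} [SFinite μ] {ρ : Measure β} [SFinite ρ] {f : α → ℝ≥0∞} {g : β → ℝ≥0∞}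
    (hf : Measurable f) (hg : Measurable g) {C : ℝ≥0∞} (hC : C ≠ ⊤) {r : ℝ} (hr : 0 < r)
    (h : ∀ l : ℝ, 0 < l → μ {x | ENNReal.ofReal l < f x} ≤ C * ρ {x | ENNReal.ofReal l < g x}) :
    ∫⁻ x, f x ^ r ∂μ ≤ C * ∫⁻ x, g x ^ r ∂ρ := by
  rw [lintegral_rpow_eq_lintegral_meas hf hr, lintegral_rpow_eq_lintegral_meas hg hr,
    ← lintegral_const_mul' _ _ hC]
  refine setLIntegral_mono' measurableSet_Ioi fun l hl => ?_
  rw [mul_left_comm]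
  gcongr
  exact h l hl

/-! ### Covering -/

/-- A comparison of measures through the Vitali covering lemma. -/
theorem measure_biUnion_le_of_vitali {X ι : Type*} [MeasurableSpace X] {ν : Measure X}
    {ρ : Measure (Bdry d)} {t : Set ι} {x : ι → Bdry d} {r : ι → ℝ} {P A : ι → Set X}
    (hr : ∀ i ∈ t, 0 < r i)
    (hPA : ∀ i ∈ t, ∀ j ∈ t, (ball (x i) (r i) ∩ ball (x j) (r j)).Nonempty → r i ≤ 2 * r j →
      P i ⊆ A j)
    (hν : ∀ j ∈ t, ν (A j) ≤ ρ (ball (x j) (r j))) :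
    ν (⋃ i ∈ t, P i) ≤ ρ (⋃ i ∈ t, ball (x i) (r i)) := by
  -- The covering lemma requires bounded radii. The restriction r ≤ n is lifted by continuity from
  -- below along the increasing union.
  have key : ∀ n : ℕ, ν (⋃ i ∈ t ∩ {i | r i ≤ n}, P i) ≤ ρ (⋃ i ∈ t, ball (x i) (r i)) := by
    intro n
    obtain ⟨u, hut, hdisj, hcov⟩ := Vitali.exists_disjoint_subfamily_covering_enlargement
      (fun i => ball (x i) (r i)) (t ∩ {i | r i ≤ n}) r 2 one_lt_two (fun i hi => (hr i hi.1).le) n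
      (fun i hi => hi.2) (fun i hi => ⟨x i, mem_ball_self (hr i hi.1)⟩)
    have hc : u.Countable := hdisj.countable_of_isOpen (fun i _ => isOpen_ball)
      fun i hi => ⟨x i, mem_ball_self (hr i (hut hi).1)⟩
    calc ν (⋃ i ∈ t ∩ {i | r i ≤ n}, P i) ≤ ν (⋃ j ∈ u, A j) := by
          refine measure_mono (iUnion₂_subset fun i hi => ?_)
          obtain ⟨j, hj, hne, hle⟩ := hcov i hi
          exact (hPA i hi.1 j (hut hj).1 hne hle).trans (subset_biUnion_of_mem (u := A) hj)
      _ ≤ ∑' j : u, ν (A j) := measure_biUnion_le ν hc A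
      _ ≤ ∑' j : u, ρ (ball (x j) (r j)) := ENNReal.tsum_le_tsum fun j => hν j (hut j.2).1
      _ = ρ (⋃ j ∈ u, ball (x j) (r j)) :=
          (measure_biUnion hc hdisj fun _ _ => measurableSet_ball).symm
      _ ≤ _ := measure_mono (biUnion_subset_biUnion_left fun i hi => (hut hi).1)
  have hU : (⋃ i ∈ t, P i) = ⋃ n : ℕ, ⋃ i ∈ t ∩ {i | r i ≤ n}, P i := by
    ext z
    simp only [mem_iUnion, exists_prop, mem_inter_iff, mem_ofPred_eq]
    constructor
    · rintro ⟨i, hi, hz⟩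
      obtain ⟨n, hn⟩ := exists_nat_ge (r i)
      exact ⟨n, i, ⟨hi, hn⟩, hz⟩
    · rintro ⟨n, i, hi, hz⟩
      exact ⟨i, hi.1, hz⟩
  rw [hU, Directed.measure_iUnion]
  · exact iSup_le key
  · refine Monotone.directed_le fun m n hmn => ?_
    exact biUnion_subset_biUnion_left fun i hi => ⟨hi.1,
      le_trans (show r i ≤ m from hi.2) (by exact_mod_cast hmn)⟩

theorem volume_ball_eq (x : Bdry d) {r : ℝ} (hr : 0 < r) :
    volume (ball x r) = ENNReal.ofReal (r ^ d) * volume (ball (0 : Bdry d) 1) := by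
  have := Measure.addHaar_ball_of_pos (volume : Measure (Bdry d)) x hr
  simpa using this

theorem volume_ball_mul (x y : Bdry d) {r k : ℝ} (hr : 0 < r) (hk : 0 < k) :
    volume (ball x (k * r)) = ENNReal.ofReal (k ^ d) * volume (ball y r) := by
  rw [volume_ball_eq x (mul_pos hk hr), volume_ball_eq y hr, mul_pow,
    ENNReal.ofReal_mul (by positivity), mul_assoc]

/-- If two of the balls meet and r_i ≤ 2r_j, a point of the k-fold dilate of the first is within k
r_i + r_i + r_j ≤ (2k+3) r_j of the centre of the second. Volume serves as ρ for changes of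
aperture, and a density as ρ for the maximal theorem. -/
theorem measure_biUnion_ball_mul_le {ι : Type*} {t : Set ι} {x : ι → Bdry d} {r : ι → ℝ} {k : ℝ}
    (hk : 0 < k) (hr : ∀ i ∈ t, 0 < r i) {ρ : Measure (Bdry d)}
    (hρ : ∀ i ∈ t, volume (ball (x i) (r i)) ≤ ρ (ball (x i) (r i))) :
    volume (⋃ i ∈ t, ball (x i) (k * r i)) ≤
      ENNReal.ofReal ((2 * k + 3) ^ d) * ρ (⋃ i ∈ t, ball (x i) (r i)) := by
  have h := measure_biUnion_le_of_vitali (ν := volume)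
    (ρ := ENNReal.ofReal ((2 * k + 3) ^ d) • ρ) (x := x) (P := fun i => ball (x i) (k * r i))
    (A := fun i => ball (x i) ((2 * k + 3) * r i)) hr ?_ ?_
  · simpa using h
  · rintro i hi j hj ⟨z, hz1, hz2⟩ hij y hy
    rw [mem_ball] at *
    have h1 := dist_triangle4 y (x i) z (x j)
    rw [dist_comm (x i) z] at h1
    nlinarith [hr i hi, hr j hj]
  · intro j hj
    rw [volume_ball_mul _ (x j) (hr j hj) (by positivity)]
    simp only [Measure.smul_apply, smul_eq_mul]
    exact mul_le_mul_right (hρ j hj) _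

/-! ### The maximal function -/

/-- The uncentred Hardy--Littlewood maximal function. -/
noncomputable def maximalFn (f : Bdry d → ℝ≥0∞) (y : Bdry d) : ℝ≥0∞ :=
  ⨆ (b : Bdry d × ℝ) (_ : 0 < b.2 ∧ y ∈ ball b.1 b.2),
    (∫⁻ z in ball b.1 b.2, f z) / volume (ball b.1 b.2)

theorem setOf_lt_maximalFn (f : Bdry d → ℝ≥0∞) (l : ℝ≥0∞) :
    {y | l < maximalFn f y} = ⋃ b ∈ {b : Bdry d × ℝ | 0 < b.2 ∧
      l < (∫⁻ z in ball b.1 b.2, f z) / volume (ball b.1 b.2)}, ball b.1 b.2 := by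
  ext y
  simp only [maximalFn, lt_iSup_iff, mem_ofPred_eq, mem_iUnion, exists_prop]
  constructor
  · rintro ⟨b, ⟨h1, h2⟩, h3⟩; exact ⟨b, ⟨h1, h3⟩, h2⟩
  · rintro ⟨b, ⟨h1, h2⟩, h3⟩; exact ⟨b, ⟨h1, h3⟩, h2⟩

theorem measurable_maximalFn (f : Bdry d → ℝ≥0∞) : Measurable (maximalFn f) := by
  refine measurable_of_Ioi fun l => ?_
  have : maximalFn f ⁻¹' Ioi l = {y | l < maximalFn f y} := rfl
  rw [this, setOf_lt_maximalFn]
  exact (isOpen_biUnion fun b _ => isOpen_ball).measurableSet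

/-- On a ball where f has average above l, the part of f below l/2 accounts for at most half of the
integral. The rest of f therefore has average at least l/2. The covering lemma with k = 1 gives 5^d.
-/
theorem meas_lt_maximalFn_le {f : Bdry d → ℝ≥0∞} (hf : Measurable f) {l : ℝ} (hl : 0 < l) :
    volume {y | ENNReal.ofReal l < maximalFn f y} ≤ ENNReal.ofReal (5 ^ d) *
      (ENNReal.ofReal (2 / l) * ∫⁻ z in {z | ENNReal.ofReal (l / 2) < f z}, f z) := by
  set S := {z | ENNReal.ofReal (l / 2) < f z} with hS
  have hSm : MeasurableSet S := measurableSet_lt measurable_const hf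
  set ρ : Measure (Bdry d) := ENNReal.ofReal (2 / l) • (volume.restrict S).withDensity f with hρ
  have h := measure_biUnion_ball_mul_le (t := {b : Bdry d × ℝ | 0 < b.2 ∧
      ENNReal.ofReal l < (∫⁻ z in ball b.1 b.2, f z) / volume (ball b.1 b.2)})
      (x := fun b => b.1) (r := fun b => b.2) (k := 1) one_pos (fun b hb => hb.1) (ρ := ρ) ?_
  · rw [setOf_lt_maximalFn]
    simp only [one_mul] at h
    refine h.trans ?_
    norm_num
    gcongr
    refine (measure_mono (subset_univ _)).trans ?_
    simp [hρ, withDensity_apply]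
  · rintro ⟨x, r⟩ ⟨hr, hb⟩
    simp only at hr hb ⊢
    have hv0 := (measure_ball_pos volume x hr).ne'
    have hvt : volume (ball x r) ≠ ⊤ := measure_ball_lt_top.ne
    have h1 : ENNReal.ofReal l * volume (ball x r) ≤ ∫⁻ z in ball x r, f z := by
      have := hb.le
      rwa [ENNReal.le_div_iff_mul_le (.inl hv0) (.inl hvt)] at this
    have h2 : ∫⁻ z in ball x r, f z ≤
        ENNReal.ofReal (l / 2) * volume (ball x r) + ∫⁻ z in ball x r, S.indicator f z := by
      rw [← setLIntegral_const, ← lintegral_add_left measurable_const]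
      refine lintegral_mono fun z => ?_
      by_cases hz : z ∈ S
      · simp [hz]
      · simpa [hz] using le_of_not_gt hz
    have h3 : ENNReal.ofReal l = ENNReal.ofReal (l / 2) + ENNReal.ofReal (l / 2) := by
      rw [← ENNReal.ofReal_add (by positivity) (by positivity)]; congr 1; ring
    rw [h3, add_mul] at h1
    have h4 := (ENNReal.add_le_add_iff_left (ENNReal.mul_ne_top ENNReal.ofReal_ne_top hvt)).1
      (h1.trans h2)
    rw [hρ, Measure.smul_apply, withDensity_apply _ measurableSet_ball, smul_eq_mul,
      Measure.restrict_restrict measurableSet_ball]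
    calc volume (ball x r) = ENNReal.ofReal (2 / l) * (ENNReal.ofReal (l / 2) * volume (ball x r)) := by
          rw [← mul_assoc, ← ENNReal.ofReal_mul (by positivity)]
          have : 2 / l * (l / 2) = 1 := by field_simp
          simp [this]
      _ ≤ _ := by
          rw [setLIntegral_indicator hSm, inter_comm] at h4
          exact mul_le_mul_right h4 _

theorem setOf_ofReal_half_lt {α : Type*} (f : α → ℝ≥0∞) (l : ℝ) :
    {z | ENNReal.ofReal (l / 2) < f z} = {z | ENNReal.ofReal l < 2 * f z} := by
  ext z
  have h : ENNReal.ofReal (l / 2) = ENNReal.ofReal l / 2 := by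
    rw [ENNReal.ofReal_div_of_pos two_pos]; simp
  simp only [mem_ofPred_eq, h]
  rw [ENNReal.div_lt_iff (.inl two_ne_zero) (.inl ENNReal.ofNat_ne_top), mul_comm]

/-- The truncated weak-type bound is integrated in l. Its right-hand side is the distribution
function of 2f under the measure f dx, so the layer cake formula with exponent r − 1 returns f ·
(2f)^{r−1}. -/
theorem exists_lintegral_maximalFn_rpow_le (d : ℕ) {r : ℝ} (hr : 1 < r) :
    ∃ C : ℝ≥0∞, C ≠ ⊤ ∧ ∀ f : Bdry d → ℝ≥0∞, Measurable f →
      ∫⁻ y, maximalFn f y ^ r ≤ C * ∫⁻ y, f y ^ r := by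
  refine ⟨ENNReal.ofReal (5 ^ d * (2 * r / (r - 1))) * 2 ^ (r - 1),
    ENNReal.mul_ne_top ENNReal.ofReal_ne_top (ENNReal.rpow_ne_top_of_nonneg (by linarith) (by simp)),
    fun f hf => ?_⟩
  have hr' : 0 < r - 1 := by linarith
  rw [lintegral_rpow_eq_lintegral_meas (measurable_maximalFn f) (by linarith)]
  have h1 := lintegral_rpow_eq_lintegral_meas (μ := volume.withDensity f)
    (g := fun z => 2 * f z) (by fun_prop) hr'
  have h2 : ∀ l : ℝ, (volume.withDensity f) {z | ENNReal.ofReal l < 2 * f z} =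
      ∫⁻ z in {z | ENNReal.ofReal (l / 2) < f z}, f z := fun l => by
    rw [setOf_ofReal_half_lt, withDensity_apply _ (measurableSet_lt measurable_const (by fun_prop))]
  calc _ ≤ ∫⁻ l in Ioi (0 : ℝ), ENNReal.ofReal (5 ^ d * (2 * r / (r - 1))) *
        (ENNReal.ofReal ((r - 1) * l ^ (r - 1 - 1)) *
          (volume.withDensity f) {z | ENNReal.ofReal l < 2 * f z}) := by
        refine setLIntegral_mono' measurableSet_Ioi fun l (hl : 0 < l) => ?_
        have hl1 : 0 ≤ l ^ (r - 1) := Real.rpow_nonneg hl.le _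
        have hl2 : 0 ≤ l ^ (r - 1 - 1) := Real.rpow_nonneg hl.le _
        refine (mul_le_mul_right (meas_lt_maximalFn_le hf hl) _).trans_eq ?_
        rw [h2, ← mul_assoc, ← mul_assoc, ← mul_assoc, ← ENNReal.ofReal_mul (by positivity),
          ← ENNReal.ofReal_mul (by positivity), ← ENNReal.ofReal_mul (by positivity)]
        congr 2
        rw [Real.rpow_sub_one hl.ne' (r - 1)]
        field_simp
    _ = ENNReal.ofReal (5 ^ d * (2 * r / (r - 1))) *
        ∫⁻ z, (2 * f z) ^ (r - 1) ∂(volume.withDensity f) := by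
        rw [lintegral_const_mul' _ _ ENNReal.ofReal_ne_top, h1]
    _ = _ := by
        rw [lintegral_withDensity_eq_lintegral_mul _ hf (by fun_prop), mul_assoc]
        congr 1
        rw [← lintegral_const_mul _ (by fun_prop)]
        refine lintegral_congr fun z => ?_
        rw [Pi.mul_apply, ENNReal.mul_rpow_of_nonneg _ _ hr'.le, mul_left_comm]
        congr 1
        have := ENNReal.rpow_add_of_nonneg (x := f z) 1 (r - 1) zero_le_one hr'.le
        rw [add_sub_cancel, ENNReal.rpow_one] at this
        exact this.symm

/-- The integral is split at l = s. Below, the integrand is q l^{q−1}; above, it is q s^p l^{q−1−p},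
integrable at infinity because q < p. -/
theorem lintegral_rpow_mul_min_rpow_le {p q : ℝ} (hq : 0 < q) (hqp : q < p) (s : ℝ≥0∞) :
    ∫⁻ l in Ioi (0 : ℝ), ENNReal.ofReal (q * l ^ (q - 1 - p)) * min s (ENNReal.ofReal l) ^ p ≤
      ENNReal.ofReal (1 + q / (p - q)) * s ^ q := by
  have hpq : 0 < p - q := by linarith
  rcases eq_or_ne s ⊤ with rfl | hs
  · rw [ENNReal.top_rpow_of_pos hq, ENNReal.mul_top]
    · exact le_top
    · have : 0 < 1 + q / (p - q) := by positivity
      simpa using this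
  lift s to ℝ≥0 using hs
  rcases eq_or_ne s 0 with rfl | hs0
  · simp [ENNReal.zero_rpow_of_pos (hq.trans hqp)]
  have hs' : 0 < (s : ℝ) := by positivity
  have hsq : (s : ℝ≥0∞) ^ q = ENNReal.ofReal ((s : ℝ) ^ q) := by
    rw [← ENNReal.ofReal_rpow_of_nonneg hs'.le hq.le, ENNReal.ofReal_coe_nnreal]
  have h1 : ∫⁻ l in Ioo (0 : ℝ) s, ENNReal.ofReal (q * l ^ (q - 1 - p)) *
      min (s : ℝ≥0∞) (ENNReal.ofReal l) ^ p ≤ (s : ℝ≥0∞) ^ q := by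
    rw [hsq, ← setLIntegral_Ioo_rpow hq hs'.le]
    refine setLIntegral_mono' measurableSet_Ioo fun l hl => ?_
    have hl' : 0 ≤ l ^ (q - 1 - p) := Real.rpow_nonneg hl.1.le _
    calc _ ≤ ENNReal.ofReal (q * l ^ (q - 1 - p)) * ENNReal.ofReal l ^ p := by
          gcongr
          · linarith
          · exact min_le_right _ _
      _ = _ := by
          rw [ENNReal.ofReal_rpow_of_pos hl.1, ← ENNReal.ofReal_mul (by positivity), mul_assoc,
            ← Real.rpow_add hl.1]
          congr 3; ring
  have h2 : ∫⁻ l in Ioi (s : ℝ), ENNReal.ofReal (q * l ^ (q - 1 - p)) *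
      min (s : ℝ≥0∞) (ENNReal.ofReal l) ^ p ≤ ENNReal.ofReal (q / (p - q)) * (s : ℝ≥0∞) ^ q := by
    calc _ ≤ ∫⁻ l in Ioi (s : ℝ), ENNReal.ofReal (q * l ^ (q - 1 - p)) * (s : ℝ≥0∞) ^ p := by
          gcongr with l
          · linarith
          · exact min_le_left _ _
      _ = ENNReal.ofReal (∫ l in Ioi (s : ℝ), q * l ^ (q - 1 - p)) * (s : ℝ≥0∞) ^ p := by
          rw [lintegral_mul_const _ (by fun_prop), ofReal_integral_eq_lintegral_ofReal]
          · exact (integrableOn_Ioi_rpow_of_lt (by linarith) hs').const_mul q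
          · exact (ae_restrict_iff' measurableSet_Ioi).2 (.of_forall fun l hl =>
              mul_nonneg hq.le (Real.rpow_nonneg (hs'.trans hl).le _))
      _ = _ := by
          rw [integral_const_mul, integral_Ioi_rpow_of_lt (by linarith) hs', hsq,
            ← ENNReal.ofReal_coe_nnreal (p := s), ENNReal.ofReal_rpow_of_pos hs',
            ← ENNReal.ofReal_mul, ← ENNReal.ofReal_mul (by positivity)]
          · congr 1
            have e1 : (s : ℝ) ^ q = (s : ℝ) ^ (q - 1 - p + 1) * (s : ℝ) ^ p := by
              rw [← Real.rpow_add hs']; congr 1; ring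
            have e2 : q - 1 - p + 1 = -(p - q) := by ring
            rw [e1, e2]
            field_simp
          · have e2 : q - 1 - p + 1 = -(p - q) := by ring
            rw [e2, neg_div_neg_eq]
            positivity
  have hu : Ioi (0 : ℝ) = Ioo 0 (s : ℝ) ∪ Ici (s : ℝ) := (Ioo_union_Ici_eq_Ioi hs').symm
  rw [hu]
  refine (lintegral_union_le _ _ _).trans ?_
  rw [setLIntegral_congr (Ioi_ae_eq_Ici (a := (s : ℝ))).symm,
    ENNReal.ofReal_add zero_le_one (by positivity), add_mul, ENNReal.ofReal_one, one_mul]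
  exact add_le_add h1 h2

/-- Layer cake and Tonelli, with the preceding integral for the truncated term. S does not occur on
the right of the distributional inequality, so there is nothing to absorb. -/
theorem lintegral_rpow_le_of_meas_le_add {α : Type*} [MeasurableSpace α] {μ : Measure α} [SFinite μ]
    {S N : α → ℝ≥0∞} (hS : Measurable S) (hN : Measurable N) {p q : ℝ} (hq : 0 < q) (hqp : q < p)
    {C : ℝ≥0∞} (hC : C ≠ ⊤)
    (h : ∀ l : ℝ, 0 < l → μ {x | ENNReal.ofReal l < S x} ≤ μ {x | ENNReal.ofReal l < N x} +
      ENNReal.ofReal (l ^ (-p)) * (C * ∫⁻ x, min (N x) (ENNReal.ofReal l) ^ p ∂μ)) :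
    ∫⁻ x, S x ^ q ∂μ ≤ (1 + C * ENNReal.ofReal (1 + q / (p - q))) * ∫⁻ x, N x ^ q ∂μ := by
  rw [lintegral_rpow_eq_lintegral_meas hS hq]
  calc _ ≤ ∫⁻ l in Ioi (0 : ℝ), (ENNReal.ofReal (q * l ^ (q - 1)) * μ {x | ENNReal.ofReal l < N x} +
        C * ∫⁻ x, ENNReal.ofReal (q * l ^ (q - 1 - p)) * min (N x) (ENNReal.ofReal l) ^ p ∂μ) := by
        refine setLIntegral_mono' measurableSet_Ioi fun l (hl : 0 < l) => ?_
        refine (mul_le_mul_right (h l hl) _).trans_eq ?_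
        have hl' : 0 ≤ l ^ (q - 1) := Real.rpow_nonneg hl.le _
        rw [mul_add, lintegral_const_mul' _ _ (by simp), ← mul_assoc (ENNReal.ofReal _),
          ← ENNReal.ofReal_mul (by positivity), mul_assoc q, ← Real.rpow_add hl, ← sub_eq_add_neg,
          mul_left_comm]
    _ ≤ _ := by
        rw [lintegral_add_left' , ← lintegral_rpow_eq_lintegral_meas hN hq,
          lintegral_const_mul' _ _ hC, add_mul, one_mul, lintegral_lintegral_swap, mul_assoc]
        · gcongr
          rw [← lintegral_const_mul' _ _ (by simp)]
          exact lintegral_mono fun x => lintegral_rpow_mul_min_rpow_le hq hqp _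
        · exact Measurable.aemeasurable (by unfold Function.uncurry; fun_prop)
        · refine Measurable.aemeasurable (Measurable.mul (by fun_prop) ?_)
          refine Antitone.measurable fun l m hlm => measure_mono fun x hx => ?_
          exact lt_of_le_of_lt (ENNReal.ofReal_le_ofReal hlm) hx

/-! ### Coordinates -/

@[simp] theorem atHeight_zero (t : ℝ) (y : Bdry d) : atHeight t y 0 = t := rfl

@[simp] theorem horiz_atHeight (t : ℝ) (y : Bdry d) : horiz (atHeight t y) = y := rfl

@[simp] theorem horiz_sub (x y : Space d) : horiz (x - y) = horiz x - horiz y := rfl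

theorem norm_sq_eq_add_horiz (x : Space d) : ‖x‖ ^ 2 = x 0 ^ 2 + ‖horiz x‖ ^ 2 := by
  simp [EuclideanSpace.norm_sq_eq, Fin.sum_univ_succ, horiz]

theorem abs_zero_le_norm (x : Space d) : |x 0| ≤ ‖x‖ :=
  abs_le_of_sq_le_sq (by nlinarith [norm_sq_eq_add_horiz x, sq_nonneg ‖horiz x‖]) (norm_nonneg _)

theorem norm_horiz_le (x : Space d) : ‖horiz x‖ ≤ ‖x‖ :=
  le_of_sq_le_sq (by nlinarith [norm_sq_eq_add_horiz x, sq_nonneg (x 0)]) (norm_nonneg _)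

theorem norm_le_abs_add_norm_horiz (x : Space d) : ‖x‖ ≤ |x 0| + ‖horiz x‖ := by
  refine le_of_sq_le_sq ?_ (by positivity)
  rw [norm_sq_eq_add_horiz, add_sq, sq_abs]
  have : 0 ≤ 2 * |x 0| * ‖horiz x‖ := by positivity
  linarith

theorem continuous_horiz : Continuous (horiz : Space d → Bdry d) := by
  unfold horiz; fun_prop

theorem continuous_atHeight : Continuous fun z : ℝ × Bdry d => atHeight z.1 z.2 := by
  unfold atHeight
  refine (PiLp.continuous_toLp 2 _).comp (continuous_pi fun i => ?_)
  refine Fin.cases ?_ (fun j => ?_) i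
  · exact continuous_fst
  · simp only [Fin.cons_succ]
    fun_prop

theorem measurePreserving_atHeight :
    MeasurePreserving (fun z : ℝ × Bdry d => atHeight z.1 z.2) (volume.prod volume) volume := by
  have h1 : MeasurePreserving (fun z : ℝ × Bdry d => ((z.1, WithLp.ofLp z.2) : ℝ × (Fin d → ℝ)))
      (volume.prod volume) (volume.prod volume) :=
    (MeasurePreserving.id volume).prod (PiLp.volume_preserving_ofLp (Fin d))
  have h2 := (volume_preserving_piFinSuccAbove (fun _ : Fin (d + 1) => ℝ) 0).symm
  have h3 := PiLp.volume_preserving_toLp (Fin (d + 1))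
  have h4 := h3.comp (h2.comp h1)
  have e : (fun z : ℝ × Bdry d => atHeight z.1 z.2) = WithLp.toLp 2 ∘
      (MeasurableEquiv.piFinSuccAbove (fun _ : Fin (d + 1) => ℝ) 0).symm ∘
      fun z => (z.1, WithLp.ofLp z.2) := by
    ext z i
    simp [atHeight, MeasurableEquiv.piFinSuccAbove_symm_apply, Fin.insertNthEquiv]
  rw [e]
  exact h4

theorem lintegral_eq_lintegral_atHeight {f : Space d → ℝ≥0∞} (hf : Measurable f) :
    ∫⁻ x, f x = ∫⁻ y : Bdry d, ∫⁻ t : ℝ, f (atHeight t y) := by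
  rw [← measurePreserving_atHeight.lintegral_comp hf, lintegral_prod_symm]
  exact (hf.comp continuous_atHeight.measurable).aemeasurable

/-! ### Suprema over cones -/

/-- The nontangential supremum of `V`. -/
noncomputable def coneSup (b : ℝ) (V : Space d → ℝ≥0∞) (Q : Bdry d) : ℝ≥0∞ := ⨆ x ∈ cone b Q, V x

theorem mem_cone_iff {b : ℝ} {Q : Bdry d} {x : Space d} :
    x ∈ cone b Q ↔ 0 < x 0 ∧ Q ∈ ball (horiz x) (b * x 0) := by
  rw [mem_ball, dist_comm, dist_eq_norm]; rfl

theorem le_coneSup {b : ℝ} {V : Space d → ℝ≥0∞} {Q : Bdry d} {x : Space d} (hx : 0 < x 0)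
    (hQ : Q ∈ ball (horiz x) (b * x 0)) : V x ≤ coneSup b V Q :=
  le_iSup₂_of_le x (mem_cone_iff.2 ⟨hx, hQ⟩) le_rfl

theorem coneSup_mono {b : ℝ} {V W : Space d → ℝ≥0∞} (h : ∀ x, V x ≤ W x) (Q : Bdry d) :
    coneSup b V Q ≤ coneSup b W Q := iSup₂_mono fun x _ => h x

theorem setOf_lt_coneSup (b : ℝ) (V : Space d → ℝ≥0∞) (l : ℝ≥0∞) :
    {Q | l < coneSup b V Q} = ⋃ x ∈ {x : Space d | 0 < x 0 ∧ l < V x}, ball (horiz x) (b * x 0) := by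
  ext Q
  simp only [coneSup, lt_iSup_iff, mem_cone_iff, mem_ofPred_eq, mem_iUnion, exists_prop]
  constructor
  · rintro ⟨x, ⟨h1, h2⟩, h3⟩; exact ⟨x, ⟨h1, h3⟩, h2⟩
  · rintro ⟨x, ⟨h1, h2⟩, h3⟩; exact ⟨x, ⟨h1, h3⟩, h2⟩

theorem measurable_coneSup (b : ℝ) (V : Space d → ℝ≥0∞) : Measurable (coneSup b V) := by
  refine measurable_of_Ioi fun l => ?_
  have : coneSup b V ⁻¹' Ioi l = {Q | l < coneSup b V Q} := rfl
  rw [this, setOf_lt_coneSup]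
  exact (isOpen_biUnion fun b _ => isOpen_ball).measurableSet

/-- For each aperture the superlevel set is the union of the shadows of the points where V exceeds
l. The shadows for b are the dilates by b/a of those for a. -/
theorem volume_lt_coneSup_le {a b : ℝ} (ha : 0 < a) (hb : 0 < b) (V : Space d → ℝ≥0∞) (l : ℝ≥0∞) :
    volume {Q | l < coneSup b V Q} ≤
      ENNReal.ofReal ((2 * (b / a) + 3) ^ d) * volume {Q | l < coneSup a V Q} := by
  rw [setOf_lt_coneSup, setOf_lt_coneSup]
  have := measure_biUnion_ball_mul_le (t := {x : Space d | 0 < x 0 ∧ l < V x}) (x := horiz)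
    (r := fun x => a * x 0) (k := b / a) (by positivity) (fun x hx => mul_pos ha hx.1)
    (ρ := volume) (fun _ _ => le_rfl)
  convert this using 6
  field_simp

/-- Nontangential maximal functions of different apertures are comparable. -/
theorem lintegral_coneSup_rpow_le {a b q : ℝ} (ha : 0 < a) (hb : 0 < b) (hq : 0 < q)
    (V : Space d → ℝ≥0∞) :
    ∫⁻ Q, coneSup b V Q ^ q ≤ ENNReal.ofReal ((2 * (b / a) + 3) ^ d) * ∫⁻ Q, coneSup a V Q ^ q :=
  lintegral_rpow_le_of_meas_le (measurable_coneSup b V) (measurable_coneSup a V) (by simp) hq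
    fun _ _ => volume_lt_coneSup_le ha hb V _

/-- The Carleson embedding theorem. -/
theorem setLIntegral_halfSpace_le_lintegral_coneSup {b : ℝ} (hb : 0 < b) {ν : Measure (Space d)}
    [SFinite ν] {ρ : Measure (Bdry d)} [SFinite ρ]
    (hν : ∀ (Q : Bdry d) (r : ℝ), 0 < r →
      ν (halfSpace d ∩ ball (atHeight 0 Q) ((3 * b + 3) * r)) ≤ ρ (ball Q (b * r)))
    {V : Space d → ℝ≥0∞} (hV : Measurable V) :
    ∫⁻ x in halfSpace d, V x ∂ν ≤ ∫⁻ Q, coneSup b V Q ∂ρ := by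
  have h := lintegral_rpow_le_of_meas_le (μ := ν.restrict (halfSpace d)) (ρ := ρ) hV
    (measurable_coneSup b V) ENNReal.one_ne_top one_pos (fun l _ => ?_)
  · simpa using h
  rw [one_mul, Measure.restrict_apply (measurableSet_lt measurable_const hV), setOf_lt_coneSup]
  -- Each point is covered through its shadow. A point of height at most 2y₀ whose shadow meets that
  -- of y is within 2y₀ + b · 2y₀ + b y₀ ≤ (3b+3)y₀ of the boundary point below y.
  have := measure_biUnion_le_of_vitali (ν := ν) (ρ := ρ)
    (t := {x : Space d | 0 < x 0 ∧ ENNReal.ofReal l < V x}) (x := horiz)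
    (r := fun x => b * x 0) (P := fun x => {x})
    (A := fun x => halfSpace d ∩ ball (atHeight 0 (horiz x)) ((3 * b + 3) * x 0))
    (fun x hx => mul_pos hb hx.1) ?_ (fun x hx => hν _ _ hx.1)
  · refine (measure_mono ?_).trans this
    rintro x ⟨hx, hx0⟩
    exact mem_biUnion (show x ∈ {x : Space d | 0 < x 0 ∧ ENNReal.ofReal l < V x} from ⟨hx0, hx⟩)
      rfl
  · rintro x hx y hy ⟨z, hz1, hz2⟩ hxy z' rfl
    have hx0 : 0 < z' 0 := hx.1
    have hy0 : 0 < y 0 := hy.1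
    refine ⟨hx0, ?_⟩
    rw [mem_ball] at *
    have hle : z' 0 ≤ 2 * y 0 := by
      by_contra! h
      nlinarith
    have h1 := norm_le_abs_add_norm_horiz (z' - atHeight 0 (horiz y))
    rw [horiz_sub, horiz_atHeight, PiLp.sub_apply, atHeight_zero, sub_zero, abs_of_pos hx0] at h1
    have h2 := dist_triangle_left (horiz z') (horiz y) z
    rw [dist_eq_norm (horiz z')] at h2
    rw [dist_eq_norm]
    nlinarith

/-! ### Averages over Whitney balls -/

/-- The average of `f` over the ball `B(x, x₀ / 2)`. -/
noncomputable def whitneyAverage (f : Space d → ℝ≥0∞) (x : Space d) : ℝ≥0∞ :=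
  (∫⁻ z in ball x (x 0 / 2), f z) / volume (ball x (x 0 / 2))

theorem volume_ball_space (x : Space d) {r : ℝ} (hr : 0 < r) :
    volume (ball x r) = ENNReal.ofReal (r ^ (d + 1)) * volume (ball (0 : Space d) 1) := by
  have := Measure.addHaar_ball_of_pos (volume : Measure (Space d)) x hr
  simpa using this

theorem measurableSet_dist_lt_mul (κ : ℝ) :
    MeasurableSet {z : Space d × Space d | dist z.1 z.2 < κ * z.1 0} :=
  (isOpen_lt (by fun_prop) (by fun_prop)).measurableSet

theorem measurable_lintegral_whitney {f : Space d → ℝ≥0∞} (hf : Measurable f) :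
    Measurable fun x : Space d => ∫⁻ z in ball x (x 0 / 2), f z := by
  have h1 : ∀ x : Space d, ∫⁻ z in ball x (x 0 / 2), f z =
      ∫⁻ z, {z : Space d × Space d | dist z.1 z.2 < 1 / 2 * z.1 0}.indicator (fun z => f z.2) (x, z) := by
    intro x
    rw [← lintegral_indicator measurableSet_ball]
    refine lintegral_congr fun z => ?_
    have : z ∈ ball x (x 0 / 2) ↔ (x, z) ∈ {z : Space d × Space d | dist z.1 z.2 < 1 / 2 * z.1 0} := by
      rw [mem_ball, dist_comm, mem_ofPred_eq, one_div_mul_eq_div]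
    by_cases h : z ∈ ball x (x 0 / 2)
    · rw [indicator_of_mem h, indicator_of_mem (this.1 h)]
    · rw [indicator_of_notMem h, indicator_of_notMem fun h' => h (this.2 h')]
  simp_rw [h1]
  exact ((hf.comp measurable_snd).indicator (measurableSet_dist_lt_mul _)).lintegral_prod_right'

theorem measurable_whitneyAverage {f : Space d → ℝ≥0∞} (hf : Measurable f) :
    Measurable (whitneyAverage f) := by
  refine (measurable_lintegral_whitney hf).div ?_
  simpa using measurable_lintegral_whitney (d := d) (f := fun _ => 1) measurable_const

theorem whitney_comparable {x z : Space d} {κ : ℝ} (hκ : κ ≤ 1 / 4) (hz : 0 < z 0)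
    (hx : dist z x < κ * z 0) : 3 / 4 * z 0 < x 0 ∧ x 0 < 5 / 4 * z 0 ∧ z ∈ ball x (x 0 / 2) := by
  have h1 : |z 0 - x 0| ≤ dist z x := by
    rw [dist_eq_norm]; exact abs_zero_le_norm (z - x)
  have h2 : dist z x < 1 / 4 * z 0 := hx.trans_le (by gcongr)
  have h3 := abs_lt.1 (h1.trans_lt h2)
  refine ⟨by linarith, by linarith, ?_⟩
  rw [mem_ball]
  linarith

/-- A function may be replaced by its averages over Whitney balls, when the weight is enlarged. -/
theorem exists_setLIntegral_mul_le_whitneyAverage (d : ℕ) {κ : ℝ} (hκ : 0 < κ) (hκ1 : κ ≤ 1 / 4) :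
    ∃ C : ℝ≥0∞, C ≠ ⊤ ∧ ∀ f w ws : Space d → ℝ≥0∞, Measurable f → Measurable ws →
      (∀ z, 0 < z 0 → ∀ x, dist z x < κ * z 0 → w z ≤ ws x) →
      ∫⁻ z in halfSpace d, f z * w z ≤ C * ∫⁻ x in halfSpace d, whitneyAverage f x * ws x := by
  refine ⟨ENNReal.ofReal (1 / κ ^ (d + 1)), by simp, fun f w ws hf hws hw => ?_⟩
  set v := volume (ball (0 : Space d) 1) with hv
  have hv0 : v ≠ 0 := (measure_ball_pos volume _ one_pos).ne'
  have hvt : v ≠ ⊤ := measure_ball_lt_top.ne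
  set c : Space d → ℝ≥0∞ := fun z => (ENNReal.ofReal ((κ * z 0) ^ (d + 1)) * v)⁻¹ with hc
  set D : Set (Space d × Space d) := {z | dist z.1 z.2 < κ * z.1 0} with hD
  have hDm : MeasurableSet D := measurableSet_dist_lt_mul κ
  set k : Space d × Space d → ℝ≥0∞ := D.indicator fun z => f z.1 * c z.1 * ws z.2 with hk
  have hkm : Measurable k := Measurable.indicator (by fun_prop) hDm
  have hH := (isOpen_halfSpace (d := d)).measurableSet
  -- w(z) is at most the mean of ws over B(z, κz₀). Tonelli moves this mean onto f, and z ∈ B(x,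
  -- x₀/2) for every x in that ball, so a Whitney average of f appears. The comparison of volumes
  -- costs κ^{−(d+1)}.
  have step1 : ∫⁻ z in halfSpace d, f z * w z ≤ ∫⁻ z in halfSpace d, ∫⁻ x, k (z, x) := by
    refine setLIntegral_mono' hH fun z (hz : 0 < z 0) => ?_
    have hb : volume (ball z (κ * z 0)) = ENNReal.ofReal ((κ * z 0) ^ (d + 1)) * v :=
      volume_ball_space z (by positivity)
    have h1 : w z * volume (ball z (κ * z 0)) ≤ ∫⁻ x in ball z (κ * z 0), ws x := by
      rw [← setLIntegral_const]
      refine setLIntegral_mono' measurableSet_ball fun x hx => hw z hz x ?_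
      rwa [dist_comm]
    have h2 : w z ≤ c z * ∫⁻ x in ball z (κ * z 0), ws x := by
      have e : w z = c z * (w z * volume (ball z (κ * z 0))) := by
        rw [mul_left_comm, hb, hc]
        simp only
        rw [ENNReal.inv_mul_cancel, mul_one]
        · refine mul_ne_zero ?_ hv0
          have : 0 < (κ * z 0) ^ (d + 1) := by positivity
          simpa using this
        · exact ENNReal.mul_ne_top (by simp) hvt
      rw [e]; gcongr
    calc f z * w z ≤ f z * (c z * ∫⁻ x in ball z (κ * z 0), ws x) := by gcongr
      _ = ∫⁻ x in ball z (κ * z 0), f z * c z * ws x := by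
          rw [lintegral_const_mul _ hws, mul_assoc]
      _ = _ := by
          rw [← lintegral_indicator measurableSet_ball]
          refine lintegral_congr fun x => ?_
          by_cases h : x ∈ ball z (κ * z 0)
          · have h' : (z, x) ∈ D := by rw [mem_ball'] at h; exact h
            rw [hk, indicator_of_mem h, indicator_of_mem h']
          · have h' : (z, x) ∉ D := fun h' => h (by rw [mem_ball']; exact h')
            rw [hk, indicator_of_notMem h, indicator_of_notMem h']
  refine step1.trans ?_
  rw [lintegral_lintegral_swap (f := fun z x => k (z, x)) hkm.aemeasurable,
    ← lintegral_const_mul' _ _ (by simp), ← lintegral_indicator hH]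
  refine lintegral_mono fun x => ?_
  have hzero : ∀ z ∈ halfSpace d, (z, x) ∈ D → x ∈ halfSpace d ∧ z ∈ ball x (x 0 / 2) ∧
      c z ≤ ENNReal.ofReal (1 / κ ^ (d + 1)) * (volume (ball x (x 0 / 2)))⁻¹ := by
    intro z hz hzx
    obtain ⟨h1, h2, h3⟩ := whitney_comparable hκ1 hz hzx
    have hz0 : 0 < z 0 := hz
    have hx0 : 0 < x 0 := by linarith
    refine ⟨hx0, h3, ?_⟩
    rw [volume_ball_space x (by positivity), ← hv, hc]
    simp only
    have hle : ENNReal.ofReal (κ ^ (d + 1)) * (ENNReal.ofReal ((x 0 / 2) ^ (d + 1)) * v) ≤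
        ENNReal.ofReal ((κ * z 0) ^ (d + 1)) * v := by
      rw [← mul_assoc, ← ENNReal.ofReal_mul (by positivity), ← mul_pow]
      gcongr
      linarith
    refine (ENNReal.inv_le_inv.2 hle).trans_eq ?_
    rw [ENNReal.mul_inv (.inl (by simpa using pow_pos hκ _)) (.inl (by simp)), one_div,
      ENNReal.ofReal_inv_of_pos (by positivity)]
  by_cases hx : x ∈ halfSpace d
  · rw [indicator_of_mem hx]
    calc ∫⁻ z in halfSpace d, k (z, x) ≤
          ∫⁻ z in halfSpace d, (ball x (x 0 / 2)).indicator (fun z => f z *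
            (ENNReal.ofReal (1 / κ ^ (d + 1)) * (volume (ball x (x 0 / 2)))⁻¹ * ws x)) z := by
          refine setLIntegral_mono' hH fun z hz => ?_
          by_cases h : (z, x) ∈ D
          · obtain ⟨_, h2, h3⟩ := hzero z hz h
            rw [hk, indicator_of_mem h, indicator_of_mem h2, mul_assoc]
            gcongr
          · rw [hk, indicator_of_notMem h]; exact zero_le
      _ ≤ ∫⁻ z, (ball x (x 0 / 2)).indicator (fun z => f z *
            (ENNReal.ofReal (1 / κ ^ (d + 1)) * (volume (ball x (x 0 / 2)))⁻¹ * ws x)) z :=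
          setLIntegral_le_lintegral _ _
      _ = _ := by
          rw [lintegral_indicator measurableSet_ball, lintegral_mul_const _ hf]
          simp only [whitneyAverage, div_eq_mul_inv]
          ac_rfl
  · rw [indicator_of_notMem hx, nonpos_iff_eq_zero]
    refine (setLIntegral_eq_zero_iff hH (by fun_prop)).2 (.of_forall fun z hz => ?_)
    rw [hk, indicator_of_notMem]
    exact fun h => hx (hzero z hz h).1

/-- A weight with bounded integrals over vertical lines is Carleson. -/
theorem setLIntegral_mul_le_of_vertical {b : ℝ} (hb : 0 < b) {V T : Space d → ℝ≥0∞}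
    (hV : Measurable V) (hT : Measurable T) {K : ℝ≥0∞}
    (hK : ∀ y : Bdry d, ∫⁻ t in Ioi (0 : ℝ), T (atHeight t y) ≤ K) :
    ∫⁻ x in halfSpace d, V x * T x ≤ K * ∫⁻ Q, coneSup b V Q := by
  have hH := (isOpen_halfSpace (d := d)).measurableSet
  rw [← lintegral_indicator hH, lintegral_eq_lintegral_atHeight (Measurable.indicator (by fun_prop) hH),
    ← lintegral_const_mul _ (measurable_coneSup b V)]
  refine lintegral_mono fun y => ?_
  calc _ ≤ ∫⁻ t in Ioi (0 : ℝ), coneSup b V y * T (atHeight t y) := by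
        rw [← lintegral_indicator measurableSet_Ioi]
        refine lintegral_mono fun t => ?_
        by_cases ht : 0 < t
        · have h1 : atHeight t y ∈ halfSpace d := ht
          rw [indicator_of_mem h1, indicator_of_mem (mem_Ioi.2 ht)]
          gcongr
          exact le_coneSup h1 (mem_ball_self (mul_pos hb ht))
        · have h1 : atHeight t y ∉ halfSpace d := ht
          rw [indicator_of_notMem h1]; exact zero_le
    _ = coneSup b V y * ∫⁻ t in Ioi (0 : ℝ), T (atHeight t y) :=
        lintegral_const_mul _ (hT.comp (continuous_atHeight.comp
          (continuous_id.prodMk continuous_const)).measurable)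
    _ ≤ _ := by rw [mul_comm]; gcongr; exact hK y

theorem setLIntegral_Icc_one_div_le {α k : ℝ} (hα : 0 < α) :
    ∫⁻ t in Icc α (k * α), ENNReal.ofReal (1 / t) ≤ ENNReal.ofReal k := by
  calc _ ≤ ∫⁻ _ in Icc α (k * α), ENNReal.ofReal (1 / α) := by
        refine setLIntegral_mono' measurableSet_Icc fun t ht => ?_
        gcongr
        exact ht.1
    _ = ENNReal.ofReal (1 / α * (k * α - α)) := by
        rw [setLIntegral_const, Real.volume_Icc, ENNReal.ofReal_mul (by positivity)]
    _ ≤ _ := by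
        refine ENNReal.ofReal_le_ofReal ?_
        have : 1 / α * (k * α - α) = k - 1 := by field_simp
        linarith

/-! ### The coefficient measure -/

/-- The supremum of `|∇A|² + |B|²` over a Whitney ball. -/
noncomputable def coeffSup (A : Space d → Matrix (Fin (d + 1)) (Fin (d + 1)) ℂ)
    (B : Space d → Fin (d + 1) → ℂ) (x : Space d) : ℝ≥0∞ :=
  ⨆ y ∈ ball x (x 0 / 2), coeffSize A B y

theorem measurable_coeffSup (A : Space d → Matrix (Fin (d + 1)) (Fin (d + 1)) ℂ)
    (B : Space d → Fin (d + 1) → ℂ) : Measurable (coeffSup A B) := by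
  refine measurable_of_Ioi fun l => IsOpen.measurableSet ?_
  have : coeffSup A B ⁻¹' Ioi l =
      ⋃ y ∈ {y | l < coeffSize A B y}, {x : Space d | dist y x < x 0 / 2} := by
    ext x
    simp only [coeffSup, mem_preimage, mem_Ioi, lt_iSup_iff, mem_iUnion, mem_ball, mem_ofPred_eq,
      exists_prop]
    exact exists_congr fun y => and_comm
  rw [this]
  exact isOpen_biUnion fun y _ => isOpen_lt (by fun_prop) (by fun_prop)

theorem coeffMeasure_eq (A : Space d → Matrix (Fin (d + 1)) (Fin (d + 1)) ℂ)
    (B : Space d → Fin (d + 1) → ℂ) : coeffMeasure A B = (volume.restrict (halfSpace d)).withDensity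
      (fun x => coeffSup A B x * ENNReal.ofReal (x 0)) := rfl

/-- The norm is an infimum, and the additional 1 guarantees an admissible constant below M + 1
whether or not the infimum is attained. -/
theorem coeffMeasure_le_of_carlesonNorm_le {A : Space d → Matrix (Fin (d + 1)) (Fin (d + 1)) ℂ}
    {B : Space d → Fin (d + 1) → ℂ} {M : ℝ≥0} (hM : carlesonNorm (coeffMeasure A B) ≤ M)
    (Q : Bdry d) {r : ℝ} (hr : 0 < r) :
    coeffMeasure A B (halfSpace d ∩ ball (atHeight 0 Q) r) ≤ (M + 1) * volume (ball Q r) := by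
  have h1 : carlesonNorm (coeffMeasure A B) < M + 1 :=
    hM.trans_lt (ENNReal.lt_add_right ENNReal.coe_ne_top one_ne_zero)
  obtain ⟨C, hC, hC'⟩ := sInf_lt_iff.1 h1
  exact (hC Q r hr).trans (by gcongr)

theorem setLIntegral_mul_coeffSup_le {A : Space d → Matrix (Fin (d + 1)) (Fin (d + 1)) ℂ}
    {B : Space d → Fin (d + 1) → ℂ} {M : ℝ≥0} (hM : carlesonNorm (coeffMeasure A B) ≤ M)
    {b : ℝ} (hb : 0 < b) {V : Space d → ℝ≥0∞} (hV : Measurable V) :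
    ∫⁻ x in halfSpace d, V x * (coeffSup A B x * ENNReal.ofReal (x 0)) ≤
      (M + 1) * ENNReal.ofReal (((3 * b + 3) / b) ^ d) * ∫⁻ Q, coneSup b V Q := by
  have hm := measurable_coeffSup A B
  have hS : SFinite (coeffMeasure A B) := by rw [coeffMeasure_eq]; infer_instance
  have h := setLIntegral_halfSpace_le_lintegral_coneSup hb (ν := coeffMeasure A B)
    (ρ := ((M + 1) * ENNReal.ofReal (((3 * b + 3) / b) ^ d)) • volume) (fun Q r hr => ?_) hV
  · rw [lintegral_smul_measure, smul_eq_mul, coeffMeasure_eq,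
      restrict_withDensity (isOpen_halfSpace (d := d)).measurableSet,
      Measure.restrict_restrict (isOpen_halfSpace (d := d)).measurableSet, inter_self,
      lintegral_withDensity_eq_lintegral_mul _ (by fun_prop) hV] at h
    refine le_trans (lintegral_mono fun x => ?_) h
    rw [Pi.mul_apply, mul_comm]
  · refine (coeffMeasure_le_of_carlesonNorm_le hM Q (by positivity)).trans_eq ?_
    have e : (3 * b + 3) * r = (3 * b + 3) / b * (b * r) := by field_simp
    rw [e, volume_ball_mul Q Q (by positivity) (by positivity), Measure.smul_apply, smul_eq_mul,
      mul_assoc]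

/-! ### Cutoff functions adapted to Lipschitz graphs -/

/-- Averaging translates preserves the Lipschitz constant, and averaging over radius δ/(L+1) moves
values by at most δ. The denominator L + 1 also covers L = 0. -/
theorem exists_smooth_lipschitz_approx {φ₀ : Bdry d → ℝ} {L : ℝ≥0} (h : LipschitzWith L φ₀) {δ : ℝ}
    (hδ : 0 < δ) :
    ∃ φ : Bdry d → ℝ, ContDiff ℝ ∞ φ ∧ LipschitzWith L φ ∧ ∀ y, |φ y - φ₀ y| ≤ δ := by
  set ρ : ℝ := δ / (L + 1) with hρ
  have hρ0 : 0 < ρ := by positivity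
  let f : ContDiffBump (0 : Bdry d) := ⟨ρ / 2, ρ, by positivity, by linarith⟩
  set φ : Bdry d → ℝ := f.normed volume ⋆[ContinuousLinearMap.lsmul ℝ ℝ, volume] φ₀ with hφ
  have hloc : LocallyIntegrable φ₀ (volume : Measure (Bdry d)) := h.continuous.locallyIntegrable
  have hex : ConvolutionExists (f.normed volume) φ₀ (ContinuousLinearMap.lsmul ℝ ℝ) volume :=
    f.hasCompactSupport_normed.convolutionExists_left _ f.continuous_normed hloc
  refine ⟨φ, f.hasCompactSupport_normed.contDiff_convolution_left _ f.contDiff_normed hloc, ?_, ?_⟩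
  · refine LipschitzWith.of_dist_le_mul fun y z => ?_
    have e : φ y - φ z = ∫ t, f.normed volume t * (φ₀ (y - t) - φ₀ (z - t)) := by
      rw [hφ, convolution_def, convolution_def, ← integral_sub (hex y) (hex z)]
      simp [mul_sub]
    rw [Real.dist_eq, e]
    calc |∫ t, f.normed volume t * (φ₀ (y - t) - φ₀ (z - t))|
        ≤ ∫ t, f.normed volume t * (L * dist y z) := by
          rw [← Real.norm_eq_abs]
          have hi : Integrable (f.normed volume) volume := f.integrable_normed
          refine norm_integral_le_of_norm_le (hi.mul_const _) (.of_forall fun t => ?_)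
          rw [norm_mul, Real.norm_of_nonneg (f.nonneg_normed t)]
          refine mul_le_mul_of_nonneg_left ?_ (f.nonneg_normed t)
          have := h.dist_le_mul (y - t) (z - t)
          rwa [dist_sub_right, dist_eq_norm] at this
      _ = L * dist y z := by rw [integral_mul_const, f.integral_normed, one_mul]
  · intro y
    rw [← Real.dist_eq]
    refine ContDiffBump.dist_normed_convolution_le (μ := volume) h.continuous.aestronglyMeasurable fun z hz => ?_
    refine (h.dist_le_mul z y).trans ?_
    have h1 : dist z y ≤ ρ := (mem_ball.1 hz).le
    calc (L : ℝ) * dist z y ≤ (L + 1) * ρ := by gcongr; linarith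
      _ = δ := by rw [hρ]; field_simp

theorem exists_deriv_smoothTransition_le : ∃ K, 0 ≤ K ∧ ∀ t, |deriv Real.smoothTransition t| ≤ K := by
  have hs : HasCompactSupport (deriv Real.smoothTransition) := by
    refine HasCompactSupport.intro (isCompact_Icc (a := (0 : ℝ)) (b := 1)) fun t ht => ?_
    rw [mem_Icc, not_and_or, not_le, not_le] at ht
    rcases ht with ht | ht
    · have : Real.smoothTransition =ᶠ[𝓝 t] fun _ => 0 := by
        filter_upwards [Iio_mem_nhds ht] with s hs
        exact Real.smoothTransition.zero_of_nonpos (le_of_lt hs)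
      rw [this.deriv_eq, deriv_const]
    · have : Real.smoothTransition =ᶠ[𝓝 t] fun _ => 1 := by
        filter_upwards [Ioi_mem_nhds ht] with s hs
        exact Real.smoothTransition.one_of_one_le (le_of_lt hs)
      rw [this.deriv_eq, deriv_const]
  obtain ⟨K, hK⟩ := hs.exists_bound_of_continuous
    ((Real.smoothTransition.contDiff (n := 1)).continuous_deriv le_rfl)
  exact ⟨K, (norm_nonneg _).trans (hK 0), hK⟩

/-- A function equal to `1` below the graph of `φ` and vanishing above the graph of `2 φ`. -/
noncomputable def graphCutoff (φ : Bdry d → ℝ) (x : Space d) : ℝ :=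
  Real.smoothTransition (2 - x 0 / φ (horiz x))

noncomputable def horizL (d : ℕ) : Space d →L[ℝ] Bdry d :=
  LinearMap.toContinuousLinearMap
    { toFun := horiz, map_add' := fun _ _ => rfl, map_smul' := fun _ _ => rfl }

theorem norm_horizL_le (d : ℕ) : ‖horizL d‖ ≤ 1 :=
  ContinuousLinearMap.opNorm_le_bound _ zero_le_one fun x => by
    rw [one_mul]; exact norm_horiz_le x

section graphCutoff

variable {φ : Bdry d → ℝ}

theorem graphCutoff_nonneg (x : Space d) : 0 ≤ graphCutoff φ x := Real.smoothTransition.nonneg _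

theorem graphCutoff_le_one (x : Space d) : graphCutoff φ x ≤ 1 := Real.smoothTransition.le_one _

theorem graphCutoff_eq_one (hφ : ∀ y, 0 < φ y) {x : Space d} (hx : x 0 ≤ φ (horiz x)) :
    graphCutoff φ x = 1 := by
  refine Real.smoothTransition.one_of_one_le ?_
  have := (div_le_one (hφ (horiz x))).2 hx
  linarith

theorem graphCutoff_eq_zero (hφ : ∀ y, 0 < φ y) {x : Space d} (hx : 2 * φ (horiz x) ≤ x 0) :
    graphCutoff φ x = 0 := by
  refine Real.smoothTransition.zero_of_nonpos ?_
  have := (le_div_iff₀ (hφ (horiz x))).2 hx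
  linarith

theorem contDiff_graphCutoff (hφ : ∀ y, 0 < φ y) (hs : ContDiff ℝ ∞ φ) :
    ContDiff ℝ ∞ (graphCutoff φ) := by
  refine Real.smoothTransition.contDiff.comp (contDiff_const.sub (ContDiff.div (by fun_prop)
    (hs.comp (horizL d).contDiff) fun x => (hφ _).ne'))

theorem fderiv_graphCutoff_eq_zero (hφ : ∀ y, 0 < φ y) (hc : Continuous φ) {x : Space d}
    (hx : ¬(φ (horiz x) ≤ x 0 ∧ x 0 ≤ 2 * φ (horiz x))) : fderiv ℝ (graphCutoff φ) x = 0 := by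
  have hc' : Continuous fun x : Space d => φ (horiz x) := hc.comp continuous_horiz
  rw [not_and_or, not_le, not_le] at hx
  rcases hx with hx | hx
  · have : graphCutoff φ =ᶠ[𝓝 x] fun _ => 1 := by
      filter_upwards [(isOpen_lt (f := fun x : Space d => x 0) (by fun_prop) hc').mem_nhds hx] with z hz
      exact graphCutoff_eq_one hφ (le_of_lt hz)
    rw [this.fderiv_eq]; simp
  · have : graphCutoff φ =ᶠ[𝓝 x] fun _ => 0 := by
      filter_upwards [(isOpen_lt (g := fun x : Space d => x 0) (hc'.const_mul 2) (by fun_prop)).mem_nhds hx] with z hz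
      exact graphCutoff_eq_zero hφ (le_of_lt hz)
    rw [this.fderiv_eq]; simp

/-- The gradient of x₀/φ is at most 1/φ + L x₀/φ². On the transition layer x₀ ≤ 2φ, which bounds
this by (2 + 4L)/x₀. -/
theorem norm_fderiv_graphCutoff_le {K : ℝ} (hK0 : 0 ≤ K)
    (hK : ∀ t, |deriv Real.smoothTransition t| ≤ K) {L : ℝ≥0} (hφ : ∀ y, 0 < φ y)
    (hs : ContDiff ℝ ∞ φ) (hL : LipschitzWith L φ) {x : Space d} (hx0 : 0 < x 0) :
    ‖fderiv ℝ (graphCutoff φ) x‖ ≤ {x : Space d | φ (horiz x) ≤ x 0 ∧ x 0 ≤ 2 * φ (horiz x)}.indicator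
      (fun x => K * (2 + 4 * L) / x 0) x := by
  by_cases hx : φ (horiz x) ≤ x 0 ∧ x 0 ≤ 2 * φ (horiz x)
  swap
  · rw [fderiv_graphCutoff_eq_zero hφ hs.continuous hx, norm_zero, indicator_of_notMem
      (s := {x : Space d | φ (horiz x) ≤ x 0 ∧ x 0 ≤ 2 * φ (horiz x)}) hx]
  rw [indicator_of_mem (show x ∈ {x : Space d | φ (horiz x) ≤ x 0 ∧ x 0 ≤ 2 * φ (horiz x)} from hx)]
  set s := φ (horiz x) with hsdef
  have hs0 : 0 < s := hφ _
  set e0 : Space d →L[ℝ] ℝ := EuclideanSpace.proj (𝕜 := ℝ) (0 : Fin (d + 1)) with he0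
  have he0n : ‖e0‖ ≤ 1 := ContinuousLinearMap.opNorm_le_bound _ zero_le_one fun v => by
    rw [one_mul]; exact abs_zero_le_norm v
  have h1 : HasFDerivAt (fun x : Space d => φ (horiz x)) ((fderiv ℝ φ (horiz x)).comp (horizL d)) x :=
    ((hs.differentiable (by simp)) (horiz x)).hasFDerivAt.comp x (horizL d).hasFDerivAt
  have h0 : HasFDerivAt (fun x : Space d => x 0) e0 x := e0.hasFDerivAt
  have h2 := h0.mul ((hasDerivAt_inv (hφ (horiz x)).ne').comp_hasFDerivAt x h1)
  have h3 : HasDerivAt Real.smoothTransition (deriv Real.smoothTransition (2 - x 0 * s⁻¹))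
      (2 - x 0 * s⁻¹) :=
    ((Real.smoothTransition.contDiff (n := 1)).differentiable one_ne_zero _).hasDerivAt
  have h4 := h3.comp_hasFDerivAt x (h2.const_sub 2)
  have h5 : fderiv ℝ (graphCutoff φ) x = _ := h4.fderiv
  rw [h5, norm_smul, norm_neg, Real.norm_eq_abs, mul_div_assoc]
  refine mul_le_mul (hK _) ?_ (norm_nonneg _) hK0
  have hD : ‖(fderiv ℝ φ (horiz x)).comp (horizL d)‖ ≤ L :=
    (ContinuousLinearMap.opNorm_comp_le _ _).trans ((mul_le_of_le_one_right (norm_nonneg _)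
      (norm_horizL_le d)).trans (norm_fderiv_le_of_lipschitz ℝ hL))
  have hL0 : (0 : ℝ) ≤ L := L.2
  have e1 : s * x 0 ≤ 2 * s ^ 2 := by nlinarith [hx.2]
  have e2 : x 0 * x 0 ≤ 4 * s ^ 2 := by nlinarith [hx.2]
  calc _ ≤ x 0 * ((s ^ 2)⁻¹ * L) + s⁻¹ * 1 := by
        refine (norm_add_le _ _).trans (add_le_add ?_ ?_)
        · rw [norm_smul, norm_smul, Real.norm_of_nonneg hx0.le, norm_neg,
            Real.norm_of_nonneg (by positivity)]
          gcongr
        · rw [norm_smul]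
          simp only [Function.comp, Real.norm_eq_abs]
          rw [abs_of_pos (inv_pos.2 hs0)]
          gcongr
    _ = (s + x 0 * L) / s ^ 2 := by field_simp; ring
    _ ≤ (2 + 4 * L) / x 0 := by
      rw [div_le_div_iff₀ (by positivity) hx0]
      nlinarith [mul_le_mul_of_nonneg_right e2 hL0]

end graphCutoff

/-- The region in which `graphCutoff φ` is not locally constant. -/
def transition (φ : Bdry d → ℝ) : Set (Space d) :=
  {x | φ (horiz x) ≤ x 0 ∧ x 0 ≤ 2 * φ (horiz x)}

/-- A neighbourhood of `transition φ`. -/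
def wideTransition (φ : Bdry d → ℝ) : Set (Space d) :=
  {x | φ (horiz x) ≤ 2 * x 0 ∧ x 0 ≤ 5 * φ (horiz x)}

/-- A cutoff to the region between two graphs. -/
noncomputable def bandCutoff (φ₁ φ₂ : Bdry d → ℝ) (x : Space d) : ℝ :=
  (1 - graphCutoff φ₁ x) * graphCutoff φ₂ x

/-- A closed set containing the support of `bandCutoff φ₁ φ₂`. -/
def band (φ₁ φ₂ : Bdry d → ℝ) : Set (Space d) := {x | φ₁ (horiz x) ≤ x 0 ∧ x 0 ≤ 2 * φ₂ (horiz x)}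

theorem isClosed_band {φ₁ φ₂ : Bdry d → ℝ} (h1 : Continuous φ₁) (h2 : Continuous φ₂) :
    IsClosed (band φ₁ φ₂) :=
  (isClosed_le (h1.comp continuous_horiz) (by fun_prop)).inter
    (isClosed_le (by fun_prop) ((h2.comp continuous_horiz).const_mul 2))

theorem measurableSet_wideTransition {φ : Bdry d → ℝ} (h : Continuous φ) :
    MeasurableSet (wideTransition φ) :=
  ((isClosed_le (h.comp continuous_horiz) (by fun_prop)).inter
    (isClosed_le (by fun_prop) ((h.comp continuous_horiz).const_mul 5))).measurableSet

/-- The radius 1/(4(1+L)) · z₀ is small enough that both x₀ and φ change by at most z₀/4, so the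
layer is preserved up to enlarging its constants. -/
theorem mem_wideTransition {φ : Bdry d → ℝ} {L : ℝ≥0} (hL : LipschitzWith L φ) {x z : Space d}
    (hz : 0 < z 0) (hzx : dist z x < 1 / (4 * (1 + L)) * z 0) (h : z ∈ transition φ) :
    x ∈ wideTransition φ := by
  have hL0 : (0 : ℝ) ≤ L := L.2
  have h4 : 1 / (4 * (1 + (L : ℝ))) ≤ 1 / 4 := by
    apply one_div_le_one_div_of_le <;> linarith
  obtain ⟨h1, h2, -⟩ := whitney_comparable h4 hz hzx
  have h3 : |φ (horiz z) - φ (horiz x)| ≤ L * dist z x := by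
    rw [← Real.dist_eq]
    refine (hL.dist_le_mul _ _).trans ?_
    gcongr
    rw [dist_eq_norm, dist_eq_norm, ← horiz_sub]
    exact norm_horiz_le _
  have h5 : L * dist z x ≤ 1 / 4 * z 0 := by
    calc (L : ℝ) * dist z x ≤ (1 + L) * (1 / (4 * (1 + L)) * z 0) := by
          gcongr
          linarith
      _ = _ := by field_simp
  have h6 := abs_le.1 (h3.trans h5)
  obtain ⟨h7, h8⟩ := h
  constructor <;> linarith

/-- On a vertical line the layer is contained in an interval [α, 10α] with α = φ(y)/2. -/
theorem lintegral_wideTransition_le {φ : Bdry d → ℝ} (hφ : ∀ y, 0 < φ y) (y : Bdry d) :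
    ∫⁻ t in Ioi (0 : ℝ), (wideTransition φ).indicator (fun x => ENNReal.ofReal (1 / x 0))
      (atHeight t y) ≤ 10 := by
  have h := setLIntegral_Icc_one_div_le (α := φ y / 2) (k := 10) (half_pos (hφ y))
  have e : ENNReal.ofReal 10 = 10 := by simp
  rw [e] at h
  refine le_trans ?_ h
  rw [← lintegral_indicator measurableSet_Icc]
  refine (setLIntegral_le_lintegral _ _).trans (lintegral_mono fun t => ?_)
  by_cases ht : atHeight t y ∈ wideTransition φ
  · have h2 : t ∈ Icc (φ y / 2) (10 * (φ y / 2)) := by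
      obtain ⟨h3, h4⟩ := ht
      rw [atHeight_zero, horiz_atHeight] at *
      constructor <;> linarith
    rw [indicator_of_mem ht, indicator_of_mem h2, atHeight_zero]
  · rw [indicator_of_notMem ht]; exact zero_le

section bandCutoff

variable {φ₁ φ₂ : Bdry d → ℝ}

theorem bandCutoff_nonneg (x : Space d) : 0 ≤ bandCutoff φ₁ φ₂ x :=
  mul_nonneg (sub_nonneg.2 (graphCutoff_le_one x)) (graphCutoff_nonneg x)

theorem bandCutoff_le_one (x : Space d) : bandCutoff φ₁ φ₂ x ≤ 1 :=
  mul_le_one₀ (by linarith [graphCutoff_nonneg (φ := φ₁) x]) (graphCutoff_nonneg x)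
    (graphCutoff_le_one x)

theorem bandCutoff_eq_one (h1 : ∀ y, 0 < φ₁ y) (h2 : ∀ y, 0 < φ₂ y) {x : Space d}
    (hx : 2 * φ₁ (horiz x) ≤ x 0) (hx' : x 0 ≤ φ₂ (horiz x)) : bandCutoff φ₁ φ₂ x = 1 := by
  simp [bandCutoff, graphCutoff_eq_zero h1 hx, graphCutoff_eq_one h2 hx']

theorem contDiff_bandCutoff (h1 : ∀ y, 0 < φ₁ y) (h2 : ∀ y, 0 < φ₂ y) (hs1 : ContDiff ℝ ∞ φ₁)
    (hs2 : ContDiff ℝ ∞ φ₂) : ContDiff ℝ ∞ (bandCutoff φ₁ φ₂) :=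
  (contDiff_const.sub (contDiff_graphCutoff h1 hs1)).mul (contDiff_graphCutoff h2 hs2)

theorem tsupport_bandCutoff_subset (h1 : ∀ y, 0 < φ₁ y) (h2 : ∀ y, 0 < φ₂ y) (hc1 : Continuous φ₁)
    (hc2 : Continuous φ₂) : tsupport (bandCutoff φ₁ φ₂) ⊆ band φ₁ φ₂ := by
  refine closure_minimal (fun x hx => ?_) (isClosed_band hc1 hc2)
  by_contra hx'
  refine hx ?_
  rw [band, mem_ofPred_eq, not_and_or, not_le, not_le] at hx'
  rcases hx' with hx' | hx'
  · simp [bandCutoff, graphCutoff_eq_one h1 hx'.le]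
  · simp [bandCutoff, graphCutoff_eq_zero h2 hx'.le]

theorem norm_fderiv_bandCutoff_le (h1 : ∀ y, 0 < φ₁ y) (h2 : ∀ y, 0 < φ₂ y) (hs1 : ContDiff ℝ ∞ φ₁)
    (hs2 : ContDiff ℝ ∞ φ₂) (x : Space d) : ‖fderiv ℝ (bandCutoff φ₁ φ₂) x‖ ≤
      ‖fderiv ℝ (graphCutoff φ₁) x‖ + ‖fderiv ℝ (graphCutoff φ₂) x‖ := by
  have e1 := ((contDiff_graphCutoff h1 hs1).differentiable (by simp) x).hasFDerivAt
  have e2 := ((contDiff_graphCutoff h2 hs2).differentiable (by simp) x).hasFDerivAt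
  have e3 : fderiv ℝ (bandCutoff φ₁ φ₂) x = _ := ((e1.const_sub 1).mul e2).fderiv
  rw [e3, add_comm (‖_‖)]
  refine (norm_add_le _ _).trans (add_le_add ?_ ?_)
  · rw [norm_smul]
    refine mul_le_of_le_one_left (norm_nonneg _) ?_
    rw [Real.norm_of_nonneg (sub_nonneg.2 (graphCutoff_le_one x))]
    linarith [graphCutoff_nonneg (φ := φ₁) x]
  · rw [norm_smul, norm_neg]
    refine mul_le_of_le_one_left (norm_nonneg _) ?_
    rw [Real.norm_of_nonneg (graphCutoff_nonneg x)]
    exact graphCutoff_le_one x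

end bandCutoff

/-- Both x₀|∇η|² and |η||∇η| are of order 1/x₀ and live on the two transition layers. The
coefficients contribute wherever η does. -/
theorem ofReal_energyWeight_bandCutoff_le {A : Space d → Matrix (Fin (d + 1)) (Fin (d + 1)) ℂ}
    {B : Space d → Fin (d + 1) → ℂ} {lam Lam K : ℝ} (hlam : 0 < lam) (hK0 : 0 ≤ K)
    (hK : ∀ t, |deriv Real.smoothTransition t| ≤ K) {L : ℝ≥0} {φ₁ φ₂ : Bdry d → ℝ}
    (h1 : ∀ y, 0 < φ₁ y) (h2 : ∀ y, 0 < φ₂ y) (hs1 : ContDiff ℝ ∞ φ₁) (hs2 : ContDiff ℝ ∞ φ₂)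
    (hL1 : LipschitzWith L φ₁) (hL2 : LipschitzWith L φ₂) {z : Space d} (hz : 0 < z 0) :
    ENNReal.ofReal (energyWeight A B lam Lam (bandCutoff φ₁ φ₂) z) ≤
      (band φ₁ φ₂).indicator (fun z =>
        ENNReal.ofReal (2 * ((6 * (d + 1) * (Lam + 1)) ^ 2 / lam * (K * (2 + 4 * L)) ^ 2 +
          K * (2 + 4 * L))) *
          ((transition φ₁).indicator (fun z => ENNReal.ofReal (1 / z 0)) z +
            (transition φ₂).indicator (fun z => ENNReal.ofReal (1 / z 0)) z) +
        ENNReal.ofReal ((6 * (d + 1) * (Lam + 1)) ^ 2 / lam * z 0) * coeffSize A B z) z := by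
  set η := bandCutoff φ₁ φ₂ with hη
  by_cases hzb : z ∈ band φ₁ φ₂
  swap
  · have hzt : z ∉ tsupport η := fun h =>
      hzb (tsupport_bandCutoff_subset h1 h2 hs1.continuous hs2.continuous h)
    have : fderiv ℝ η z = 0 :=
      image_eq_zero_of_notMem_tsupport fun h => hzt (tsupport_fderiv_subset ℝ h)
    simp [energyWeight, this, image_eq_zero_of_notMem_tsupport hzt]
  rw [indicator_of_mem hzb]
  set K₁ : ℝ := (6 * (d + 1) * (Lam + 1)) ^ 2 / lam with hK₁
  have hK₁0 : 0 ≤ K₁ := by positivity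
  set K₂ : ℝ := K * (2 + 4 * L) with hK₂
  have hK₂0 : 0 ≤ K₂ := by positivity
  have hind : ∀ φ : Bdry d → ℝ, (∀ y, 0 < φ y) → ContDiff ℝ ∞ φ → LipschitzWith L φ →
      ‖fderiv ℝ (graphCutoff φ) z‖ ≤ K₂ * (1 / z 0) * (transition φ).indicator (fun _ => 1) z := by
    intro φ hφ hs hL
    refine (norm_fderiv_graphCutoff_le hK0 hK hφ hs hL hz).trans_eq ?_
    change (transition φ).indicator (fun x => K₂ / x 0) z = _
    by_cases h : z ∈ transition φ
    · rw [indicator_of_mem h, indicator_of_mem h]; ring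
    · rw [indicator_of_notMem h, indicator_of_notMem h]; ring
  have hofR : ∀ φ : Bdry d → ℝ, (transition φ).indicator (fun z => ENNReal.ofReal (1 / z 0)) z =
      ENNReal.ofReal (1 / z 0 * (transition φ).indicator (fun _ => 1) z) := by
    intro φ
    by_cases h : z ∈ transition φ
    · rw [indicator_of_mem h, indicator_of_mem h, mul_one]
    · rw [indicator_of_notMem h, indicator_of_notMem h]; simp
  have hi0 : ∀ φ : Bdry d → ℝ, 0 ≤ (transition φ).indicator (fun _ => (1 : ℝ)) z ∧
      (transition φ).indicator (fun _ => (1 : ℝ)) z ≤ 1 := fun φ =>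
    ⟨indicator_nonneg (fun _ _ => zero_le_one) _, indicator_le_self' (fun _ _ => zero_le_one) _⟩
  have hD := (norm_fderiv_bandCutoff_le h1 h2 hs1 hs2 z).trans
    (add_le_add (hind φ₁ h1 hs1 hL1) (hind φ₂ h2 hs2 hL2))
  rw [hofR φ₁, hofR φ₂]
  obtain ⟨ha0, ha1⟩ := hi0 φ₁
  obtain ⟨hb0, hb1⟩ := hi0 φ₂
  set n₁ := (transition φ₁).indicator (fun _ => (1 : ℝ)) z
  set n₂ := (transition φ₂).indicator (fun _ => (1 : ℝ)) z
  set D := ‖fderiv ℝ η z‖ with hDdef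
  have hD0 : 0 ≤ D := norm_nonneg _
  have hη0 : 0 ≤ η z := bandCutoff_nonneg z
  have hη1 : η z ≤ 1 := bandCutoff_le_one z
  have hcs : ENNReal.ofReal ((√(coeffSize A B z).toReal) ^ 2) = coeffSize A B z := by
    rw [Real.sq_sqrt ENNReal.toReal_nonneg, ENNReal.ofReal_toReal (coeffSize_ne_top A B z)]
  set c := (√(coeffSize A B z).toReal) ^ 2 with hc
  have hc0 : 0 ≤ c := sq_nonneg _
  rw [← ENNReal.ofReal_add (by positivity) (by positivity), ← ENNReal.ofReal_mul (by positivity),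
    ← hcs, ← ENNReal.ofReal_mul (by positivity), ← ENNReal.ofReal_add (by positivity) (by positivity)]
  refine ENNReal.ofReal_le_ofReal ?_
  have hn : (n₁ + n₂) ^ 2 ≤ 2 * (n₁ + n₂) := by nlinarith
  have hD' : D ≤ K₂ * (1 / z 0) * (n₁ + n₂) := by rw [mul_add]; exact hD
  have hD2 : z 0 * D ^ 2 ≤ K₂ ^ 2 * (1 / z 0) * (2 * (n₁ + n₂)) := by
    calc z 0 * D ^ 2 ≤ z 0 * (K₂ * (1 / z 0) * (n₁ + n₂)) ^ 2 := by gcongr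
      _ = K₂ ^ 2 * (1 / z 0) * (n₁ + n₂) ^ 2 := by field_simp
      _ ≤ _ := by gcongr
  have hη2 : c * η z ^ 2 ≤ c * 1 := by
    gcongr
    exact pow_le_one₀ hη0 hη1
  have hηD : |η z| * D ≤ 1 * (K₂ * (1 / z 0) * (n₁ + n₂)) := by
    rw [abs_of_nonneg hη0]; gcongr
  have e : energyWeight A B lam Lam η z = K₁ * (z 0 * D ^ 2) + K₁ * z 0 * (c * η z ^ 2) +
      2 * (|η z| * D) := by
    simp only [energyWeight, ← hK₁, ← hDdef, ← hc]; ring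
  rw [e]
  calc _ ≤ K₁ * (K₂ ^ 2 * (1 / z 0) * (2 * (n₁ + n₂))) + K₁ * z 0 * (c * 1) +
        2 * (1 * (K₂ * (1 / z 0) * (n₁ + n₂))) := by gcongr
    _ = _ := by ring

/-! ### Energy estimates over sawtooth regions -/

/-- The energy between two Lipschitz graphs is controlled by nontangential suprema of averages
near this region. -/
theorem exists_lintegral_energy_band_le (d : ℕ) {p lam Lam b : ℝ} (hp : 1 < p) (hlam : 0 < lam)
    (hb : 0 < b) (M L : ℝ≥0) :
    ∃ C : ℝ≥0∞, C ≠ ⊤ ∧ ∀ (A : Space d → Matrix (Fin (d + 1)) (Fin (d + 1)) ℂ)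
      (B : Space d → Fin (d + 1) → ℂ) (h : ℝ) (U : Space d → ℂ) (G : Space d → CVec d),
      IsPElliptic p lam Lam A →
      (∀ x ∈ halfSpace d, A x 0 0 = 1 ∧ ∀ j, (A x 0 j).im = 0) →
      carlesonNorm (coeffMeasure A B) ≤ M → IsExtendedSolution A B h U G →
      ∀ φ₁ φ₂ : Bdry d → ℝ, (∀ y, 0 < φ₁ y) → (∀ y, 0 < φ₂ y) → ContDiff ℝ ∞ φ₁ → ContDiff ℝ ∞ φ₂ →
      LipschitzWith L φ₁ → LipschitzWith L φ₂ → Bornology.IsBounded (band φ₁ φ₂) →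
      ∀ E : Set (Space d), MeasurableSet E →
      (∀ z ∈ band φ₁ φ₂, ∀ x, dist z x < 1 / (4 * (1 + L)) * z 0 → x ∈ E) →
      ∫⁻ x in {x : Space d | 2 * φ₁ (horiz x) ≤ x 0 ∧ x 0 ≤ φ₂ (horiz x)},
        ‖G x‖ₑ ^ 2 * ‖U x‖ₑ ^ (p - 2) * ENNReal.ofReal (x 0) ≤
      C * ∫⁻ Q, coneSup b (E.indicator (whitneyAverage fun x => ‖U x‖ₑ ^ p)) Q := by
  obtain ⟨K, hK0, hK⟩ := exists_deriv_smoothTransition_le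
  set κ : ℝ := 1 / (4 * (1 + L)) with hκ
  have hL0 : (0 : ℝ) ≤ L := L.2
  have hκ0 : 0 < κ := by positivity
  have hκ1 : κ ≤ 1 / 4 := by
    apply one_div_le_one_div_of_le <;> linarith
  obtain ⟨C₀, hC₀, hav⟩ := exists_setLIntegral_mul_le_whitneyAverage d hκ0 hκ1
  set K₁ : ℝ := (6 * (d + 1) * (Lam + 1)) ^ 2 / lam with hK₁
  have hK₁0 : 0 ≤ K₁ := by positivity
  set K₂ : ℝ := 2 * (K₁ * (K * (2 + 4 * L)) ^ 2 + K * (2 + 4 * L)) with hK₂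
  have hK₂0 : 0 ≤ K₂ := by positivity
  refine ⟨ENNReal.ofReal (2 / lam) * (C₀ * (ENNReal.ofReal (2 * K₂) * 20 + ENNReal.ofReal (2 * K₁) *
    ((M + 1) * ENNReal.ofReal (((3 * b + 3) / b) ^ d)))), ?_, ?_⟩
  · refine ENNReal.mul_ne_top (by simp) (ENNReal.mul_ne_top hC₀ (ENNReal.add_ne_top.2
      ⟨ENNReal.mul_ne_top ENNReal.ofReal_ne_top (by simp), ENNReal.mul_ne_top ENNReal.ofReal_ne_top
        (ENNReal.mul_ne_top (by simp) (by simp))⟩))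
  intro A B h U G hell hA hM hU φ₁ φ₂ h1 h2 hs1 hs2 hL1 hL2 hbd E hE hbE
  have hH := (isOpen_halfSpace (d := d)).measurableSet
  set η := bandCutoff φ₁ φ₂ with hη
  have hηb : tsupport η ⊆ band φ₁ φ₂ :=
    tsupport_bandCutoff_subset h1 h2 hs1.continuous hs2.continuous
  have hηΩ : tsupport η ⊆ halfSpace d := fun x hx => (h1 _).trans_le (hηb hx).1
  have hηs : HasCompactSupport η :=
    Metric.isCompact_of_isClosed_isBounded (isClosed_tsupport η) (hbd.subset hηb)
  have henergy := hU.lintegral_energy_le hp hell hA (contDiff_bandCutoff h1 h2 hs1 hs2) hηs hηΩ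
  have hUm := hU.measurable
  set V := E.indicator (whitneyAverage fun x => ‖U x‖ₑ ^ p) with hV
  have hWm : Measurable (whitneyAverage fun x => ‖U x‖ₑ ^ p) :=
    measurable_whitneyAverage (by fun_prop)
  have hVm : Measurable V := hWm.indicator hE
  set T : Space d → ℝ≥0∞ := fun x =>
    (wideTransition φ₁).indicator (fun x => ENNReal.ofReal (1 / x 0)) x +
      (wideTransition φ₂).indicator (fun x => ENNReal.ofReal (1 / x 0)) x with hT
  have hrec : Measurable fun x : Space d => ENNReal.ofReal (1 / x 0) := by fun_prop
  have hTm1 := hrec.indicator (measurableSet_wideTransition hs1.continuous)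
  have hTm2 := hrec.indicator (measurableSet_wideTransition hs2.continuous)
  have hTm : Measurable T := hTm1.add hTm2
  have hcs := measurable_coeffSup A B
  -- The weight after transfer from z to a point x at Whitney distance. The indicator of E records
  -- where such x can lie, which localises the maximal function on the right.
  set ws : Space d → ℝ≥0∞ := fun x => E.indicator (fun _ => 1) x * (ENNReal.ofReal (2 * K₂) * T x +
    ENNReal.ofReal (2 * K₁) * (coeffSup A B x * ENNReal.ofReal (x 0))) with hws
  have hE1 : Measurable (E.indicator fun _ => (1 : ℝ≥0∞)) := measurable_const.indicator hE
  have hwsm : Measurable ws := by fun_prop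
  -- In passing from z to x, 1/z₀ becomes at most 2/x₀, z₀ at most 2x₀, the layers widen, and the
  -- coefficients at z are bounded by their supremum over B(x, x₀/2). The supremum in the definition
  -- of μ is what permits this last step.
  have hstep1 : ∫⁻ x, ‖U x‖ₑ ^ p * ENNReal.ofReal (energyWeight A B lam Lam η x) ≤
      C₀ * ∫⁻ x in halfSpace d, whitneyAverage (fun x => ‖U x‖ₑ ^ p) x * ws x := by
    rw [← setLIntegral_eq_of_support_subset (s := halfSpace d)]
    · refine hav _ _ ws (by fun_prop) hwsm fun z hz x hzx => ?_
      refine (ofReal_energyWeight_bandCutoff_le hlam hK0 hK h1 h2 hs1 hs2 hL1 hL2 hz).trans ?_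
      by_cases hzb : z ∈ band φ₁ φ₂
      swap
      · rw [indicator_of_notMem hzb]; exact zero_le
      obtain ⟨hw1, hw2, hw3⟩ := whitney_comparable hκ1 hz hzx
      have hx0 : 0 < x 0 := by linarith
      have hrec2 : ENNReal.ofReal (1 / z 0) ≤ ENNReal.ofReal 2 * ENNReal.ofReal (1 / x 0) := by
        rw [← ENNReal.ofReal_mul two_pos.le]
        refine ENNReal.ofReal_le_ofReal ?_
        rw [mul_one_div, div_le_div_iff₀ hz hx0]
        linarith
      have htr : ∀ φ : Bdry d → ℝ, LipschitzWith L φ →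
          (transition φ).indicator (fun z => ENNReal.ofReal (1 / z 0)) z ≤
          ENNReal.ofReal 2 * (wideTransition φ).indicator (fun x => ENNReal.ofReal (1 / x 0)) x := by
        intro φ hφ
        by_cases hzt : z ∈ transition φ
        · rw [indicator_of_mem hzt, indicator_of_mem (mem_wideTransition hφ hz hzx hzt)]
          exact hrec2
        · rw [indicator_of_notMem hzt]; exact zero_le
      rw [indicator_of_mem hzb]
      simp only [hws, hT]
      rw [indicator_of_mem (hbE z hzb x hzx), one_mul]
      refine add_le_add ?_ ?_
      · rw [mul_comm 2 K₂, ENNReal.ofReal_mul hK₂0, mul_assoc (ENNReal.ofReal K₂)]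
        refine mul_le_mul_right ?_ _
        rw [mul_add]
        exact add_le_add (htr φ₁ hL1) (htr φ₂ hL2)
      · rw [mul_comm (coeffSup A B x), ← mul_assoc, ← ENNReal.ofReal_mul (by positivity)]
        refine mul_le_mul' (ENNReal.ofReal_le_ofReal ?_) ?_
        · nlinarith
        · exact le_iSup₂_of_le z hw3 le_rfl
    · intro x hx
      by_contra hx'
      refine hx ?_
      have hxt : x ∉ tsupport η := fun h => hx' (hηΩ h)
      have : fderiv ℝ η x = 0 :=
        image_eq_zero_of_notMem_tsupport fun h => hxt (tsupport_fderiv_subset ℝ h)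
      simp [energyWeight, this, image_eq_zero_of_notMem_tsupport hxt]
  have hVT : ∫⁻ x in halfSpace d, V x * T x ≤ 20 * ∫⁻ Q, coneSup b V Q := by
    refine setLIntegral_mul_le_of_vertical hb hVm hTm fun y => ?_
    have hmy : Measurable fun t : ℝ => atHeight t y :=
      (continuous_atHeight.comp (continuous_id.prodMk continuous_const)).measurable
    simp only [hT]
    rw [lintegral_add_left (f := fun t => (wideTransition φ₁).indicator
      (fun x => ENNReal.ofReal (1 / x 0)) (atHeight t y)) (hTm1.comp hmy)]
    refine (add_le_add (lintegral_wideTransition_le h1 y) (lintegral_wideTransition_le h2 y)).trans ?_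
    norm_num
  have hVc := setLIntegral_mul_coeffSup_le hM hb hVm
  have hstep2 : ∫⁻ x in halfSpace d, whitneyAverage (fun x => ‖U x‖ₑ ^ p) x * ws x ≤
      (ENNReal.ofReal (2 * K₂) * 20 + ENNReal.ofReal (2 * K₁) *
        ((M + 1) * ENNReal.ofReal (((3 * b + 3) / b) ^ d))) * ∫⁻ Q, coneSup b V Q := by
    have e : ∀ x, whitneyAverage (fun x => ‖U x‖ₑ ^ p) x * ws x =
        ENNReal.ofReal (2 * K₂) * (V x * T x) +
          ENNReal.ofReal (2 * K₁) * (V x * (coeffSup A B x * ENNReal.ofReal (x 0))) := by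
      intro x
      by_cases hx : x ∈ E
      · simp only [hws, hV, indicator_of_mem hx]; ring
      · simp only [hws, hV, indicator_of_notMem hx]; ring
    simp_rw [e]
    rw [lintegral_add_left (by fun_prop), lintegral_const_mul _ (by fun_prop),
      lintegral_const_mul _ (by fun_prop), add_mul, mul_assoc, mul_assoc (ENNReal.ofReal (2 * K₁))]
    gcongr
  calc _ ≤ ∫⁻ x, ‖G x‖ₑ ^ 2 * ‖U x‖ₑ ^ (p - 2) * ENNReal.ofReal (x 0 * η x ^ 2) := by
        have hm : MeasurableSet {x : Space d | 2 * φ₁ (horiz x) ≤ x 0 ∧ x 0 ≤ φ₂ (horiz x)} :=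
          ((isClosed_le ((hs1.continuous.comp continuous_horiz).const_mul 2) (by fun_prop)).inter
            (isClosed_le (by fun_prop) (hs2.continuous.comp continuous_horiz))).measurableSet
        refine (setLIntegral_mono' hm fun x hx => ?_).trans (setLIntegral_le_lintegral _ _)
        rw [hη, bandCutoff_eq_one h1 h2 hx.1 hx.2, one_pow, mul_one]
    _ ≤ _ := henergy
    _ ≤ ENNReal.ofReal (2 / lam) * (C₀ * (_ * ∫⁻ Q, coneSup b V Q)) := by
        gcongr
        exact hstep1.trans (by gcongr)
    _ = _ := by ring

/-- The part of the sawtooth region above `F` with aperture `a` in the ball of radius `r` centred at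
the boundary point `Q`. -/
def localSawtooth (a : ℝ) (F : Set (Bdry d)) (Q : Bdry d) (r : ℝ) : Set (Space d) :=
  {x | 0 < x 0 ∧ infDist (horiz x) F < a * x 0 ∧ dist x (atHeight 0 Q) < r}

theorem measurableSet_localSawtooth (a : ℝ) (F : Set (Bdry d)) (Q : Bdry d) (r : ℝ) :
    MeasurableSet (localSawtooth a F Q r) := by
  have h1 : IsOpen {x : Space d | infDist (horiz x) F < a * x 0} :=
    isOpen_lt ((continuous_infDist_pt F).comp continuous_horiz) (by fun_prop)
  exact (isOpen_halfSpace.inter (h1.inter isOpen_ball)).measurableSet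

/-- φ₁ is a smoothing of max(dist(y, F)/(4a), ε) and φ₂ one of max(4r − |y − Q|, ε/8). Where φ₂ has
been clipped at ε/8, 2φ₂ ≤ 3ε/8 is below φ₁ ≥ 15ε/16. The band is empty there, hence bounded
altogether. The factor 4 in 4a and 4ε leaves room for the factor 2 in the cutoff and for the
smoothing error ε/16. -/
theorem exists_lipschitz_graphs {a : ℝ} (ha : 0 < a) (F : Set (Bdry d)) (Q : Bdry d) {r ε : ℝ}
    (hr : 0 < r) (hε : 0 < ε) (hεr : ε ≤ r) :
    ∃ φ₁ φ₂ : Bdry d → ℝ, (∀ y, 0 < φ₁ y) ∧ (∀ y, 0 < φ₂ y) ∧ ContDiff ℝ ∞ φ₁ ∧ ContDiff ℝ ∞ φ₂ ∧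
      LipschitzWith (1 + 1 / (4 * a)).toNNReal φ₁ ∧ LipschitzWith (1 + 1 / (4 * a)).toNNReal φ₂ ∧
      (∀ x ∈ band φ₁ φ₂, infDist (horiz x) F ≤ 14 / 3 * a * x 0 ∧ x 0 ≤ 9 * r ∧
        dist x (atHeight 0 Q) ≤ 13 * r) ∧
      ∀ x ∈ localSawtooth a F Q r, 4 * ε ≤ x 0 →
        2 * φ₁ (horiz x) ≤ x 0 ∧ x 0 ≤ φ₂ (horiz x) := by
  set L : ℝ≥0 := (1 + 1 / (4 * a)).toNNReal with hL
  have hLc : (L : ℝ) = 1 + 1 / (4 * a) := Real.coe_toNNReal _ (by positivity)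
  have l1 : LipschitzWith L fun y : Bdry d => max (infDist y F / (4 * a)) ε := by
    refine LipschitzWith.max_const (LipschitzWith.of_dist_le_mul fun y z => ?_) ε
    have := (lipschitz_infDist_pt F).dist_le_mul y z
    rw [NNReal.coe_one, one_mul] at this
    rw [Real.dist_eq, ← sub_div, abs_div, abs_of_pos (by positivity : 0 < 4 * a), hLc,
      ← Real.dist_eq, add_mul, one_mul, one_div_mul_eq_div]
    have h2 : dist (infDist y F) (infDist z F) / (4 * a) ≤ dist y z / (4 * a) := by gcongr
    linarith [dist_nonneg (x := y) (y := z)]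
  have l2 : LipschitzWith L fun y : Bdry d => max (4 * r - dist y Q) (ε / 8) := by
    refine LipschitzWith.max_const (LipschitzWith.of_dist_le_mul fun y z => ?_) _
    have h1 := abs_dist_sub_le y z Q
    have h2 : 0 ≤ 1 / (4 * a) * dist y z := by positivity
    rw [Real.dist_eq, sub_sub_sub_cancel_left, abs_sub_comm, hLc, add_mul, one_mul]
    linarith
  obtain ⟨φ₁, s1, L1, a1⟩ := exists_smooth_lipschitz_approx l1 (by positivity : 0 < ε / 16)
  obtain ⟨φ₂, s2, L2, a2⟩ := exists_smooth_lipschitz_approx l2 (by positivity : 0 < ε / 16)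
  have b1 := fun y => abs_le.1 (a1 y)
  have b2 := fun y => abs_le.1 (a2 y)
  refine ⟨φ₁, φ₂, fun y => ?_, fun y => ?_, s1, s2, L1, L2, ?_, ?_⟩
  · linarith [(b1 y).1, le_max_right (infDist y F / (4 * a)) ε]
  · linarith [(b2 y).1, le_max_right (4 * r - dist y Q) (ε / 8)]
  · rintro x ⟨hx1, hx2⟩
    have e1 := (b1 (horiz x)).1
    have e2 := (b2 (horiz x)).2
    have e3 := le_max_right (infDist (horiz x) F / (4 * a)) ε
    have e4 := le_max_left (infDist (horiz x) F / (4 * a)) ε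
    have hx0 : 15 / 16 * ε ≤ x 0 := by linarith
    have h5 : max (4 * r - dist (horiz x) Q) (ε / 8) = 4 * r - dist (horiz x) Q := by
      rcases max_choice (4 * r - dist (horiz x) Q) (ε / 8) with h | h
      · exact h
      · rw [h] at e2; linarith
    rw [h5] at e2
    have h6 : 0 ≤ dist (horiz x) Q := dist_nonneg
    have h7 : infDist (horiz x) F / (4 * a) ≤ 16 / 15 * x 0 := by linarith
    rw [div_le_iff₀ (by positivity)] at h7
    have hx9 : x 0 ≤ 9 * r := by linarith
    refine ⟨?_, hx9, ?_⟩
    · have : 0 ≤ a * x 0 := mul_nonneg ha.le (by linarith)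
      nlinarith
    · have h8 := norm_le_abs_add_norm_horiz (x - atHeight 0 Q)
      rw [horiz_sub, horiz_atHeight, PiLp.sub_apply, atHeight_zero, sub_zero,
        abs_of_pos (by linarith), ← dist_eq_norm, ← dist_eq_norm] at h8
      linarith
  · rintro x ⟨hx0, hx1, hx2⟩ hx3
    have h1 : infDist (horiz x) F / (4 * a) ≤ x 0 / 4 := by
      rw [div_le_div_iff₀ (by positivity) (by norm_num)]
      nlinarith
    have h2 : max (infDist (horiz x) F / (4 * a)) ε ≤ x 0 / 4 := max_le h1 (by linarith)
    rw [dist_eq_norm] at hx2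
    have h3 := (abs_zero_le_norm (x - atHeight 0 Q)).trans_lt hx2
    have h4 := (norm_horiz_le (x - atHeight 0 Q)).trans_lt hx2
    rw [PiLp.sub_apply, atHeight_zero, sub_zero, abs_of_pos hx0] at h3
    rw [horiz_sub, horiz_atHeight, ← dist_eq_norm] at h4
    have h5 := le_max_left (4 * r - dist (horiz x) Q) (ε / 8)
    constructor
    · linarith [(b1 (horiz x)).2]
    · linarith [(b2 (horiz x)).1]

/-- The local sawtooth is exhausted by its parts at height at least 4ε. Each is caught between two
graphs whose Lipschitz constant does not depend on ε, F, Q or r, so the band estimate passes to the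
limit with one constant. -/
theorem exists_lintegral_energy_localSawtooth_le (d : ℕ) {p lam Lam a b : ℝ} (hp : 1 < p)
    (hlam : 0 < lam) (ha : 0 < a) (hb : 0 < b) (M : ℝ≥0) :
    ∃ C : ℝ≥0∞, C ≠ ⊤ ∧ ∀ (A : Space d → Matrix (Fin (d + 1)) (Fin (d + 1)) ℂ)
      (B : Space d → Fin (d + 1) → ℂ) (h : ℝ) (U : Space d → ℂ) (G : Space d → CVec d),
      IsPElliptic p lam Lam A →
      (∀ x ∈ halfSpace d, A x 0 0 = 1 ∧ ∀ j, (A x 0 j).im = 0) →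
      carlesonNorm (coeffMeasure A B) ≤ M → IsExtendedSolution A B h U G →
      ∀ (F : Set (Bdry d)) (Q : Bdry d) (r : ℝ), 0 < r →
      ∫⁻ x in localSawtooth a F Q r, ‖G x‖ₑ ^ 2 * ‖U x‖ₑ ^ (p - 2) * ENNReal.ofReal (x 0) ≤
      C * ∫⁻ y, coneSup b ((localSawtooth (8 * a) F Q (16 * r)).indicator
        (whitneyAverage fun x => ‖U x‖ₑ ^ p)) y := by
  set L : ℝ≥0 := (1 + 1 / (4 * a)).toNNReal with hL
  have hLc : (L : ℝ) = 1 + 1 / (4 * a) := Real.coe_toNNReal _ (by positivity)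
  obtain ⟨C, hC, hmain⟩ := exists_lintegral_energy_band_le d (Lam := Lam) hp hlam hb M L
  refine ⟨C, hC, fun A B h U G hell hA hM hU F Q r hr => ?_⟩
  set e : ℕ → ℝ := fun n => r / ((n : ℝ) + 1) with he
  have he0 : ∀ n, 0 < e n := fun n => by positivity
  have her : ∀ n, e n ≤ r := fun n => div_le_self hr.le (by linarith [n.cast_nonneg (α := ℝ)])
  have hset : localSawtooth a F Q r =
      ⋃ n, localSawtooth a F Q r ∩ {x : Space d | 4 * e n ≤ x 0} := by
    rw [← inter_iUnion, eq_comm, inter_eq_left]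
    intro x hx
    have hx0 : 0 < x 0 := hx.1
    obtain ⟨n, hn⟩ := exists_nat_gt (4 * r / x 0)
    refine mem_iUnion.2 ⟨n, ?_⟩
    rw [div_lt_iff₀ hx0] at hn
    change 4 * (r / ((n : ℝ) + 1)) ≤ x 0
    rw [mul_div_assoc', div_le_iff₀ (by positivity)]
    linarith
  rw [hset]
  rw [setLIntegral_iUnion_of_directed _ (Monotone.directed_le ?_)]
  swap
  · intro m n hmn x hx
    refine ⟨hx.1, le_trans ?_ (show 4 * e m ≤ x 0 from hx.2)⟩
    have : e n ≤ e m := by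
      simp only [he]
      gcongr
    linarith
  refine iSup_le fun n => ?_
  obtain ⟨φ₁, φ₂, p1, p2, s1, s2, L1, L2, hband, hsub⟩ :=
    exists_lipschitz_graphs ha F Q hr (he0 n) (her n)
  have hbdd : Bornology.IsBounded (band φ₁ φ₂) :=
    (isBounded_closedBall (x := atHeight 0 Q) (r := 13 * r)).subset fun x hx => (hband x hx).2.2
  refine le_trans (lintegral_mono_set fun x hx => ?_) (hmain A B h U G hell hA hM hU φ₁ φ₂ p1 p2 s1
    s2 L1 L2 hbdd _ (measurableSet_localSawtooth _ _ _ _) fun z hz x hzx => ?_)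
  · exact hsub x hx.1 hx.2
  · obtain ⟨h1, h2, h3⟩ := hband z hz
    have hz0 : 0 < z 0 := (p1 _).trans_le hz.1
    have hκ : 1 / (4 * (1 + (L : ℝ))) ≤ 1 / 4 := by
      have := L.coe_nonneg
      apply one_div_le_one_div_of_le <;> linarith
    -- With κ ≤ a, moving from z to x adds at most a z₀ to the distance from F: (14/3 + 1) a z₀ < 8a
    -- · (3/4) z₀ < 8a x₀. Similarly 13r + 9r/4 < 16r for the distance from (0, Q).
    have hκa : 1 / (4 * (1 + (L : ℝ))) ≤ a := by
      rw [hLc, div_le_iff₀ (by positivity)]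
      have : a * (4 * (1 + (1 + 1 / (4 * a)))) = 8 * a + 1 := by field_simp; ring
      linarith
    obtain ⟨w1, w2, -⟩ := whitney_comparable hκ hz0 hzx
    have hda : dist z x < a * z 0 := hzx.trans_le (by gcongr)
    have hd4 : dist z x < 1 / 4 * z 0 := hzx.trans_le (by gcongr)
    refine ⟨by linarith, ?_, ?_⟩
    · have h4 := infDist_le_infDist_add_dist (s := F) (x := horiz x) (y := horiz z)
      have h5 : dist (horiz x) (horiz z) ≤ dist z x := by
        rw [dist_comm, dist_eq_norm, dist_eq_norm, ← horiz_sub]; exact norm_horiz_le _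
      have h6 : a * (3 / 4 * z 0) < a * x 0 := by gcongr
      have h7 : 0 < a * z 0 := by positivity
      nlinarith
    · have h4 := dist_triangle_left x (atHeight 0 Q) z
      linarith

/-! ### Conical integrals -/

/-- The conical integral of `g`. -/
noncomputable def coneIntegral (a : ℝ) (g : Space d → ℝ≥0∞) (Q : Bdry d) : ℝ≥0∞ :=
  ∫⁻ x in cone a Q, g x * ENNReal.ofReal (x 0 ^ (2 - ((d : ℝ) + 1)))

theorem isOpen_setOf_mem_cone (a : ℝ) : IsOpen {z : Bdry d × Space d | z.2 ∈ cone a z.1} :=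
  (isOpen_lt (f := fun _ => (0 : ℝ)) (g := fun z : Bdry d × Space d => z.2 0) continuous_const
    (by fun_prop)).inter (isOpen_lt (f := fun z : Bdry d × Space d => ‖horiz z.2 - z.1‖)
      (g := fun z : Bdry d × Space d => a * z.2 0)
      ((continuous_horiz.comp continuous_snd).sub continuous_fst).norm (by fun_prop))

theorem measurableSet_cone (a : ℝ) (Q : Bdry d) : MeasurableSet (cone a Q) :=
  ((isOpen_setOf_mem_cone a).preimage (f := fun x : Space d => (Q, x)) (by fun_prop)).measurableSet

theorem measurable_coneIntegral (a : ℝ) {g : Space d → ℝ≥0∞} (hg : Measurable g) :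
    Measurable (coneIntegral a g) := by
  have h : ∀ Q, coneIntegral a g Q = ∫⁻ x, {z : Bdry d × Space d | z.2 ∈ cone a z.1}.indicator
      (fun z => g z.2 * ENNReal.ofReal (z.2 0 ^ (2 - ((d : ℝ) + 1)))) (Q, x) := by
    intro Q
    rw [coneIntegral, ← lintegral_indicator (measurableSet_cone a Q)]
    rfl
  rw [show coneIntegral a g = _ from funext h]
  exact Measurable.lintegral_prod_right'
    (Measurable.indicator (by fun_prop) (isOpen_setOf_mem_cone a).measurableSet)

theorem measurable_lintegral_ball_horiz (a : ℝ) {H : Bdry d → ℝ≥0∞} (hH : Measurable H) :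
    Measurable fun x : Space d => ∫⁻ Q in ball (horiz x) (a * x 0), H Q := by
  have hS : MeasurableSet {z : Space d × Bdry d | dist z.2 (horiz z.1) < a * z.1 0} :=
    (isOpen_lt (continuous_snd.dist (continuous_horiz.comp continuous_fst))
      (by fun_prop)).measurableSet
  have h : ∀ x : Space d, ∫⁻ Q in ball (horiz x) (a * x 0), H Q =
      ∫⁻ Q, {z : Space d × Bdry d | dist z.2 (horiz z.1) < a * z.1 0}.indicator
        (fun z => H z.2) (x, Q) := by
    intro x
    rw [← lintegral_indicator measurableSet_ball]
    rfl
  simp_rw [h]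
  exact ((hH.comp measurable_snd).indicator hS).lintegral_prod_right'

/-- Tonelli, as x lies in the cone at Q exactly when Q lies in the shadow of x. -/
theorem lintegral_mul_coneIntegral (a : ℝ) {g : Space d → ℝ≥0∞} (hg : Measurable g)
    {H : Bdry d → ℝ≥0∞} (hH : Measurable H) :
    ∫⁻ Q, H Q * coneIntegral a g Q = ∫⁻ x in halfSpace d,
      g x * ENNReal.ofReal (x 0 ^ (2 - ((d : ℝ) + 1))) * ∫⁻ Q in ball (horiz x) (a * x 0), H Q := by
  set k : Bdry d × Space d → ℝ≥0∞ := {z : Bdry d × Space d | z.2 ∈ cone a z.1}.indicator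
    (fun z => H z.1 * (g z.2 * ENNReal.ofReal (z.2 0 ^ (2 - ((d : ℝ) + 1))))) with hk
  have hkm : Measurable k :=
    Measurable.indicator (by fun_prop) (isOpen_setOf_mem_cone a).measurableSet
  have h1 : ∀ Q, H Q * coneIntegral a g Q = ∫⁻ x, k (Q, x) := fun Q => by
    rw [coneIntegral, ← lintegral_const_mul _ (by fun_prop),
      ← lintegral_indicator (measurableSet_cone a Q)]
    rfl
  simp_rw [h1]
  rw [lintegral_lintegral_swap (f := fun Q x => k (Q, x)) hkm.aemeasurable,
    ← lintegral_indicator (isOpen_halfSpace (d := d)).measurableSet]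
  refine lintegral_congr fun x => ?_
  by_cases hx : x ∈ halfSpace d
  · rw [indicator_of_mem hx, ← lintegral_const_mul _ hH, ← lintegral_indicator measurableSet_ball]
    refine lintegral_congr fun Q => ?_
    by_cases hQ : Q ∈ ball (horiz x) (a * x 0)
    · have : (Q, x) ∈ {z : Bdry d × Space d | z.2 ∈ cone a z.1} := mem_cone_iff.2 ⟨hx, hQ⟩
      rw [hk, indicator_of_mem this, indicator_of_mem hQ, mul_comm]
    · have : (Q, x) ∉ {z : Bdry d × Space d | z.2 ∈ cone a z.1} := fun h => hQ (mem_cone_iff.1 h).2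
      rw [hk, indicator_of_notMem this, indicator_of_notMem hQ]
  · rw [indicator_of_notMem hx]
    have : ∀ Q, k (Q, x) = 0 := fun Q => by
      have hn : (Q, x) ∉ {z : Bdry d × Space d | z.2 ∈ cone a z.1} :=
        fun h => hx (mem_cone_iff.1 h).1
      rw [hk, indicator_of_notMem hn]
    simp [this]

theorem ofReal_rpow_mul_volume_ball {a : ℝ} (ha : 0 < a) {x : Space d} (hx : 0 < x 0) :
    ENNReal.ofReal (x 0 ^ (2 - ((d : ℝ) + 1))) * volume (ball (horiz x) (a * x 0)) =
      volume (ball (0 : Bdry d) a) * ENNReal.ofReal (x 0) := by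
  rw [mul_comm a, volume_ball_mul _ 0 ha hx, ← mul_assoc, ← ENNReal.ofReal_mul (by positivity),
    mul_comm (volume _), ← Real.rpow_natCast, ← Real.rpow_add hx]
  congr 2
  have : 2 - ((d : ℝ) + 1) + d = 1 := by ring
  rw [this, Real.rpow_one]

/-- The shadow of x meets F only if x belongs to the sawtooth region over F, and its volume times
x₀^{1−d} is a constant multiple of x₀. -/
theorem setLIntegral_coneIntegral_le {a : ℝ} (ha : 0 < a) {g : Space d → ℝ≥0∞} (hg : Measurable g)
    {F : Set (Bdry d)} (hF : MeasurableSet F) :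
    ∫⁻ Q in F, coneIntegral a g Q ≤ volume (ball (0 : Bdry d) a) *
      ∫⁻ x in {x : Space d | 0 < x 0 ∧ infDist (horiz x) F < a * x 0}, g x * ENNReal.ofReal (x 0) := by
  have hS : MeasurableSet {x : Space d | infDist (horiz x) F < a * x 0} :=
    (isOpen_lt ((continuous_infDist_pt F).comp continuous_horiz) (by fun_prop)).measurableSet
  have hH := (isOpen_halfSpace (d := d)).measurableSet
  have e : {x : Space d | 0 < x 0 ∧ infDist (horiz x) F < a * x 0} =
    {x : Space d | infDist (horiz x) F < a * x 0} ∩ halfSpace d := by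
    ext x; exact and_comm
  have h := lintegral_mul_coneIntegral a hg (H := F.indicator fun _ => 1)
    (measurable_const.indicator hF)
  have h1 : ∫⁻ Q in F, coneIntegral a g Q =
      ∫⁻ Q, F.indicator (fun _ => 1) Q * coneIntegral a g Q := by
    rw [← lintegral_indicator hF]
    refine lintegral_congr fun Q => ?_
    by_cases hQ : Q ∈ F <;> simp [hQ]
  rw [h1, h, e, ← setLIntegral_indicator hS, ← lintegral_const_mul _ (Measurable.indicator
    (by fun_prop) hS)]
  refine setLIntegral_mono' hH fun x (hx : 0 < x 0) => ?_
  rw [setLIntegral_indicator hF, setLIntegral_const, one_mul]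
  by_cases hxS : x ∈ {x : Space d | infDist (horiz x) F < a * x 0}
  · rw [indicator_of_mem hxS, mul_left_comm, ← ofReal_rpow_mul_volume_ball ha hx, mul_assoc]
    gcongr
    exact inter_subset_right
  · have : F ∩ ball (horiz x) (a * x 0) = ∅ := by
      refine eq_empty_of_forall_notMem fun Q hQ => hxS ?_
      refine (infDist_le_dist_of_mem hQ.1).trans_lt ?_
      rw [dist_comm]; exact hQ.2
    rw [this, measure_empty, mul_zero]
    exact zero_le

/-! ### Duality -/

/-- The test function is T^{s−1}, with T the truncation of S in size and to a ball. Then ∫ T^s is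
finite and may be divided out; Fatou's lemma removes the truncation. -/
theorem lintegral_rpow_le_of_duality {s s' : ℝ} (hs : s.HolderConjugate s') {S : Bdry d → ℝ≥0∞}
    (hS : Measurable S) {K : ℝ≥0∞}
    (h : ∀ H : Bdry d → ℝ≥0∞, Measurable H →
      ∫⁻ Q, H Q * S Q ≤ K * (∫⁻ Q, H Q ^ s') ^ (1 / s')) :
    ∫⁻ Q, S Q ^ s ≤ K ^ s := by
  have hs0 := hs.pos
  have hs0' := hs.symm.pos
  have hs1 : 0 < s - 1 := hs.sub_one_pos
  set T : ℕ → Bdry d → ℝ≥0∞ := fun k => (ball 0 (k : ℝ)).indicator fun Q => min (S Q) k with hT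
  have hTm : ∀ k, Measurable (T k) := fun k =>
    (hS.min measurable_const).indicator measurableSet_ball
  have key : ∀ k, ∫⁻ Q, T k Q ^ s ≤ K ^ s := by
    intro k
    have hfin : ∫⁻ Q, T k Q ^ s ≠ ⊤ := by
      have h1 : ∀ Q, T k Q ^ s ≤ (ball (0 : Bdry d) (k : ℝ)).indicator (fun _ => (k : ℝ≥0∞) ^ s) Q := by
        intro Q
        by_cases hQ : Q ∈ ball (0 : Bdry d) (k : ℝ)
        · simp only [hT, indicator_of_mem hQ]
          gcongr
          exact min_le_right _ _
        · simp only [hT, indicator_of_notMem hQ]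
          rw [ENNReal.zero_rpow_of_pos hs0]
      refine ne_top_of_le_ne_top ?_ (lintegral_mono h1)
      rw [lintegral_indicator measurableSet_ball, setLIntegral_const]
      exact ENNReal.mul_ne_top (ENNReal.rpow_ne_top_of_nonneg hs0.le (by simp))
        measure_ball_lt_top.ne
    have h1 := h (fun Q => T k Q ^ (s - 1)) ((hTm k).pow_const _)
    have e1 : ∀ Q, (T k Q ^ (s - 1)) ^ s' = T k Q ^ s := fun Q => by
      rw [← ENNReal.rpow_mul, hs.sub_one_mul_conj]
    simp_rw [e1] at h1
    have h2 : ∫⁻ Q, T k Q ^ s ≤ ∫⁻ Q, T k Q ^ (s - 1) * S Q := by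
      refine lintegral_mono fun Q => ?_
      have e2 := ENNReal.rpow_add_of_nonneg (x := T k Q) (s - 1) 1 hs1.le zero_le_one
      rw [sub_add_cancel, ENNReal.rpow_one] at e2
      rw [e2]
      gcongr
      refine indicator_le_self' (fun _ _ => zero_le) _ |>.trans (min_le_left _ _)
    have h3 := h2.trans h1
    rcases eq_or_ne (∫⁻ Q, T k Q ^ s) 0 with h0 | h0
    · rw [h0]; exact zero_le
    set I := ∫⁻ Q, T k Q ^ s
    have hI : I = I ^ (1 / s) * I ^ (1 / s') := by
      rw [← ENNReal.rpow_add _ _ h0 hfin, one_div, one_div, hs.inv_add_inv_eq_one, ENNReal.rpow_one]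
    have hI' : I ^ (1 / s) ≤ K := by
      rw [hI] at h3
      have hne : I ^ (1 / s') ≠ 0 := by
        rw [Ne, ENNReal.rpow_eq_zero_iff]; simp [h0, hfin]
      have hne' : I ^ (1 / s') ≠ ⊤ := ENNReal.rpow_ne_top_of_nonneg (by positivity) hfin
      have h4 : I ^ (1 / s) * I ^ (1 / s') ≤ K * I ^ (1 / s') := by
        rwa [← hI] at h3 ⊢
      exact (ENNReal.mul_le_mul_iff_left hne hne').1 h4
    calc I = (I ^ (1 / s)) ^ s := by
          rw [← ENNReal.rpow_mul, one_div_mul_cancel hs0.ne', ENNReal.rpow_one]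
      _ ≤ K ^ s := by gcongr
  have hlim : ∀ Q, Tendsto (fun k => T k Q ^ s) atTop (𝓝 (S Q ^ s)) := by
    intro Q
    have h1 : Tendsto (fun k : ℕ => min (S Q) (k : ℝ≥0∞)) atTop (𝓝 (S Q)) := by
      have := (tendsto_const_nhds (x := S Q)).min ENNReal.tendsto_nat_nhds_top
      rwa [min_eq_left le_top] at this
    refine ((ENNReal.continuous_rpow_const.tendsto _).comp h1).congr' ?_
    obtain ⟨n, hn⟩ := exists_nat_gt (dist Q 0)
    filter_upwards [eventually_ge_atTop n] with k hk
    have : Q ∈ ball (0 : Bdry d) (k : ℝ) := mem_ball.2 (hn.trans_le (by exact_mod_cast hk))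
    simp only [hT, Function.comp, indicator_of_mem this]
  calc ∫⁻ Q, S Q ^ s = ∫⁻ Q, liminf (fun k => T k Q ^ s) atTop :=
        lintegral_congr fun Q => (hlim Q).liminf_eq.symm
    _ ≤ liminf (fun k => ∫⁻ Q, T k Q ^ s) atTop := lintegral_liminf_le fun k => (hTm k).pow_const _
    _ ≤ liminf (fun _ : ℕ => K ^ s) atTop := liminf_le_liminf (.of_forall key)
    _ = K ^ s := by simp

/-! ### From sawtooth estimates to L^s bounds -/

/-- `g` satisfies the local energy estimates with respect to `W`, with apertures `a` and `8 a`. -/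
def SawtoothBound (a : ℝ) (C : ℝ≥0∞) (g W : Space d → ℝ≥0∞) : Prop :=
  ∀ (F : Set (Bdry d)) (Q : Bdry d) (r : ℝ), 0 < r →
    ∫⁻ x in localSawtooth a F Q r, g x * ENNReal.ofReal (x 0) ≤
      C * ∫⁻ y, coneSup (8 * a) ((localSawtooth (8 * a) F Q (16 * r)).indicator W) y

namespace SawtoothBound

variable {a : ℝ} {C : ℝ≥0∞} {g W : Space d → ℝ≥0∞}

theorem setLIntegral_sawtooth_le (h : SawtoothBound a C g W) (F : Set (Bdry d)) :
    ∫⁻ x in {x : Space d | 0 < x 0 ∧ infDist (horiz x) F < a * x 0}, g x * ENNReal.ofReal (x 0) ≤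
      C * ∫⁻ y, coneSup (8 * a)
        ({x : Space d | 0 < x 0 ∧ infDist (horiz x) F < 8 * a * x 0}.indicator W) y := by
  have e : {x : Space d | 0 < x 0 ∧ infDist (horiz x) F < a * x 0} =
      ⋃ n : ℕ, localSawtooth a F 0 ((n : ℝ) + 1) := by
    ext x
    rw [mem_iUnion]
    constructor
    · intro hx
      obtain ⟨n, hn⟩ := exists_nat_gt (dist x (atHeight 0 0))
      exact ⟨n, hx.1, hx.2, by linarith⟩
    · rintro ⟨n, hx⟩
      exact ⟨hx.1, hx.2.1⟩
  rw [e, setLIntegral_iUnion_of_directed _ (Monotone.directed_le ?_)]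
  · refine iSup_le fun n => (h F 0 _ (by positivity)).trans ?_
    gcongr with y
    refine coneSup_mono (fun x => ?_) y
    exact indicator_le_indicator_of_subset (s := localSawtooth (8 * a) F 0 (16 * ((n : ℝ) + 1)))
      (t := {x : Space d | 0 < x 0 ∧ infDist (horiz x) F < 8 * a * x 0})
      (fun x hx => ⟨hx.1, hx.2.1⟩) (fun _ => zero_le) x
  · intro m n hmn x hx
    refine ⟨hx.1, hx.2.1, hx.2.2.trans_le ?_⟩
    have : (m : ℝ) ≤ n := by exact_mod_cast hmn
    linarith

/-- The sawtooth region over the whole boundary is the half-space. This settles s = 1. -/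
theorem lintegral_coneIntegral_le (ha : 0 < a) (hg : Measurable g) (h : SawtoothBound a C g W) :
    ∫⁻ Q, coneIntegral a g Q ≤ volume (ball (0 : Bdry d) a) * C * ∫⁻ Q, coneSup (8 * a) W Q := by
  have h1 := setLIntegral_coneIntegral_le ha hg (F := univ) MeasurableSet.univ
  rw [setLIntegral_univ] at h1
  refine h1.trans ?_
  rw [mul_assoc]
  gcongr
  refine (h.setLIntegral_sawtooth_le univ).trans ?_
  gcongr with y
  exact coneSup_mono (fun x => indicator_le_self' (fun _ _ => zero_le) x) y

/-- Let F be the set where the maximal function is at most l. Every point of the sawtooth region of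
aperture 8a over F lies in a cone with vertex in F, so W ≤ l there and the restricted supremum is at
most min(N, l). Chebyshev's inequality on F concludes; the complement of F gives the first term. -/
theorem measure_lt_coneIntegral_le (ha : 0 < a) (hg : Measurable g) (h : SawtoothBound a C g W)
    {l : ℝ} (hl : 0 < l) :
    volume {Q | ENNReal.ofReal l < coneIntegral a g Q} ≤
      volume {Q | ENNReal.ofReal l < coneSup (8 * a) W Q} +
        ENNReal.ofReal (l ^ (-1 : ℝ)) * (volume (ball (0 : Bdry d) a) * C *
          ∫⁻ Q, min (coneSup (8 * a) W Q) (ENNReal.ofReal l) ^ (1 : ℝ)) := by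
  set F := {Q : Bdry d | coneSup (8 * a) W Q ≤ ENNReal.ofReal l} with hF
  have hFm : MeasurableSet F := measurableSet_le (measurable_coneSup _ _) measurable_const
  have h1 : ∫⁻ Q in F, coneIntegral a g Q ≤ volume (ball (0 : Bdry d) a) * C *
      ∫⁻ Q, min (coneSup (8 * a) W Q) (ENNReal.ofReal l) := by
    rcases F.eq_empty_or_nonempty with hE | hne
    · simp [hE]
    refine (setLIntegral_coneIntegral_le ha hg hFm).trans ?_
    rw [mul_assoc]
    gcongr
    refine (h.setLIntegral_sawtooth_le F).trans ?_
    gcongr with y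
    refine le_min (coneSup_mono (fun x => indicator_le_self' (fun _ _ => zero_le) x) y) ?_
    refine iSup₂_le fun x _ => indicator_le (g := fun _ => ENNReal.ofReal l) (fun x hx => ?_) x
    obtain ⟨Q, hQ, hxQ⟩ := (infDist_lt_iff hne).1 hx.2
    refine (le_coneSup hx.1 ?_).trans hQ
    rwa [mem_ball, dist_comm]
  have h2 : volume {Q ∈ F | ENNReal.ofReal l < coneIntegral a g Q} ≤
      ENNReal.ofReal (l ^ (-1 : ℝ)) * ∫⁻ Q in F, coneIntegral a g Q := by
    have hm : MeasurableSet {Q | ENNReal.ofReal l < coneIntegral a g Q} :=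
      measurableSet_lt measurable_const (measurable_coneIntegral a hg)
    have h3 := mul_meas_ge_le_lintegral (μ := volume.restrict F) (measurable_coneIntegral a hg)
      (ENNReal.ofReal l)
    have h4 : volume {Q ∈ F | ENNReal.ofReal l < coneIntegral a g Q} ≤
        volume.restrict F {Q | ENNReal.ofReal l ≤ coneIntegral a g Q} := by
      have hsub : {Q | ENNReal.ofReal l < coneIntegral a g Q} ⊆
        {Q | ENNReal.ofReal l ≤ coneIntegral a g Q} := ofPred_subset_ofPred.2 fun Q hQ => hQ.le
      refine le_trans ?_ (measure_mono hsub)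
      rw [Measure.restrict_apply hm, inter_comm]
      exact le_rfl
    calc _ ≤ ENNReal.ofReal (l ^ (-1 : ℝ)) * (ENNReal.ofReal l *
          volume.restrict F {Q | ENNReal.ofReal l ≤ coneIntegral a g Q}) := by
          rw [← mul_assoc, ← ENNReal.ofReal_mul (by positivity), Real.rpow_neg_one,
            inv_mul_cancel₀ hl.ne', ENNReal.ofReal_one, one_mul]
          exact h4
      _ ≤ _ := by gcongr
  have hsub : {Q | ENNReal.ofReal l < coneIntegral a g Q} ⊆
      {Q | ENNReal.ofReal l < coneSup (8 * a) W Q} ∪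
        {Q ∈ F | ENNReal.ofReal l < coneIntegral a g Q} := by
    intro Q hQ
    by_cases hQF : Q ∈ F
    · exact .inr ⟨hQF, hQ⟩
    · exact .inl (show ENNReal.ofReal l < _ from lt_of_not_ge hQF)
  refine (measure_mono hsub).trans ((measure_union_le _ _).trans ?_)
  simp only [ENNReal.rpow_one]
  gcongr
  exact h2.trans (by gcongr)

/-- With F the whole boundary the local sawtooth is a half-ball of radius r. A cone of aperture 8a
reaching the half-ball of radius 16r has its vertex within 16r + 8a · 16r of Q. -/
theorem setLIntegral_ball_le (ha : 0 < a) (h : SawtoothBound a C g W) (Q : Bdry d) {r : ℝ}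
    (hr : 0 < r) :
    ∫⁻ x in halfSpace d ∩ ball (atHeight 0 Q) r, g x * ENNReal.ofReal (x 0) ≤
      C * ∫⁻ y in ball Q ((16 + 128 * a) * r), coneSup (8 * a) W y := by
  have h1 := h univ Q r hr
  have hinf : ∀ y : Bdry d, infDist y univ = 0 := fun y => infDist_zero_of_mem (mem_univ y)
  have e : localSawtooth a univ Q r = halfSpace d ∩ ball (atHeight 0 Q) r := by
    ext x
    simp only [localSawtooth, hinf, mem_ofPred_eq, mem_inter_iff, mem_ball, halfSpace]
    exact ⟨fun h => ⟨h.1, h.2.2⟩, fun h => ⟨h.1, mul_pos ha h.1, h.2⟩⟩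
  rw [e] at h1
  refine h1.trans ?_
  rw [← lintegral_indicator measurableSet_ball]
  gcongr with y
  refine iSup₂_le fun x hx => ?_
  by_cases hxs : x ∈ localSawtooth (8 * a) univ Q (16 * r)
  · have hx0 : 0 < x 0 := hx.1
    have hxy : ‖horiz x - y‖ < 8 * a * x 0 := hx.2
    have hd : dist x (atHeight 0 Q) < 16 * r := hxs.2.2
    rw [dist_eq_norm] at hd
    have h3 := (abs_zero_le_norm (x - atHeight 0 Q)).trans_lt hd
    have h4 := (norm_horiz_le (x - atHeight 0 Q)).trans_lt hd
    rw [PiLp.sub_apply, atHeight_zero, sub_zero, abs_of_pos hx0] at h3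
    rw [horiz_sub, horiz_atHeight, ← dist_eq_norm] at h4
    have hy : y ∈ ball Q ((16 + 128 * a) * r) := by
      rw [mem_ball]
      have h5 := dist_triangle_left y Q (horiz x)
      rw [dist_eq_norm (horiz x) y] at h5
      have h6 : 8 * a * x 0 ≤ 8 * a * (16 * r) := by gcongr
      linarith
    rw [indicator_of_mem hxs, indicator_of_mem hy]
    exact le_iSup₂_of_le x hx le_rfl
  · rw [indicator_of_notMem hxs]; exact zero_le

/-- The measure g x₀ dx gives a Carleson box at most a multiple of the integral of N over a dilated
ball, hence at most a multiple of the integral of the maximal function of N over the ball itself.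
Relative to this density it is Carleson. The embedding is applied to the averages of H over shadows,
whose nontangential supremum is at most the maximal function of H. -/
theorem lintegral_mul_coneIntegral_le (ha : 0 < a) (hg : Measurable g) (h : SawtoothBound a C g W)
    {H : Bdry d → ℝ≥0∞} (hH : Measurable H) :
    ∫⁻ Q, H Q * coneIntegral a g Q ≤ volume (ball (0 : Bdry d) a) *
      (C * ENNReal.ofReal (((16 + 128 * a) * (3 * a + 3) / a) ^ d)) *
        ∫⁻ Q, maximalFn H Q * maximalFn (coneSup (8 * a) W) Q := by
  have hHs := (isOpen_halfSpace (d := d)).measurableSet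
  set k : ℝ := (16 + 128 * a) * (3 * a + 3) / a with hk
  have hk0 : 0 < k := by positivity
  set N := coneSup (8 * a) W with hN
  have hMN := measurable_maximalFn N
  have hMH := measurable_maximalFn H
  set V : Space d → ℝ≥0∞ := fun x =>
    (∫⁻ Q in ball (horiz x) (a * x 0), H Q) / volume (ball (horiz x) (a * x 0)) with hV
  have hVm : Measurable V := by
    refine (measurable_lintegral_ball_horiz a hH).div ?_
    simpa using measurable_lintegral_ball_horiz (d := d) a (H := fun _ => 1) measurable_const
  set ν : Measure (Space d) := volume.withDensity fun x => g x * ENNReal.ofReal (x 0) with hν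
  have hgm : Measurable fun x : Space d => g x * ENNReal.ofReal (x 0) := by fun_prop
  set ρ : Measure (Bdry d) := (C * ENNReal.ofReal (k ^ d)) • volume.withDensity (maximalFn N) with hρ
  have hcar : ∀ (Q : Bdry d) (r : ℝ), 0 < r →
      ν (halfSpace d ∩ ball (atHeight 0 Q) ((3 * a + 3) * r)) ≤ ρ (ball Q (a * r)) := by
    intro Q r hr
    rw [hν, withDensity_apply _ (hHs.inter measurableSet_ball)]
    refine (h.setLIntegral_ball_le ha Q (by positivity)).trans ?_
    rw [hρ, Measure.smul_apply, smul_eq_mul, withDensity_apply _ measurableSet_ball, mul_assoc]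
    gcongr
    have e : (16 + 128 * a) * ((3 * a + 3) * r) = k * (a * r) := by rw [hk]; field_simp
    rw [e]
    have hk1 : 1 ≤ k := by
      rw [hk, le_div_iff₀ ha]; nlinarith
    have hvr : 0 < a * r := by positivity
    have hR : 0 < k * (a * r) := by positivity
    set I := ∫⁻ y in ball Q (k * (a * r)), N y with hI
    have h1 : ∀ y ∈ ball Q (a * r), I / volume (ball Q (k * (a * r))) ≤ maximalFn N y := by
      intro y hy
      have hy' : y ∈ ball Q (k * (a * r)) :=
        ball_subset_ball (le_mul_of_one_le_left hvr.le hk1) hy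
      exact le_iSup₂_of_le (Q, k * (a * r)) ⟨hR, hy'⟩ le_rfl
    calc I = ENNReal.ofReal (k ^ d) *
          ∫⁻ _ in ball Q (a * r), I / volume (ball Q (k * (a * r))) := by
          rw [setLIntegral_const, mul_left_comm, ← volume_ball_mul Q Q hvr hk0,
            ENNReal.div_mul_cancel (measure_ball_pos _ _ hR).ne' measure_ball_lt_top.ne]
      _ ≤ _ := by
          exact mul_le_mul_right (setLIntegral_mono' measurableSet_ball h1) _
  have hemb := setLIntegral_halfSpace_le_lintegral_coneSup ha hcar hVm
  have hVN : ∀ Q, coneSup a V Q ≤ maximalFn H Q := fun Q => by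
    refine iSup₂_le fun x hx => ?_
    obtain ⟨hx0, hQ⟩ := mem_cone_iff.1 hx
    exact le_iSup₂_of_le (horiz x, a * x 0) ⟨mul_pos ha hx0, hQ⟩ le_rfl
  rw [lintegral_mul_coneIntegral a hg hH]
  calc _ = ∫⁻ x in halfSpace d,
        volume (ball (0 : Bdry d) a) * (g x * ENNReal.ofReal (x 0) * V x) := by
        refine setLIntegral_congr_fun hHs fun x hx => ?_
        have hx0 : 0 < x 0 := hx
        have hr : 0 < a * x 0 := mul_pos ha hx0
        have e : ∫⁻ Q in ball (horiz x) (a * x 0), H Q =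
            volume (ball (horiz x) (a * x 0)) * V x := by
          simp only [hV]
          rw [ENNReal.mul_div_cancel (measure_ball_pos _ _ hr).ne' measure_ball_lt_top.ne]
        simp only [e]
        calc _ = g x * (ENNReal.ofReal (x 0 ^ (2 - ((d : ℝ) + 1))) *
              volume (ball (horiz x) (a * x 0))) * V x := by ring
          _ = _ := by rw [ofReal_rpow_mul_volume_ball ha hx0]; ring
    _ = volume (ball (0 : Bdry d) a) * ∫⁻ x in halfSpace d, V x ∂ν := by
        rw [lintegral_const_mul _ (by fun_prop), hν, restrict_withDensity hHs,
          lintegral_withDensity_eq_lintegral_mul _ hgm hVm]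
        rfl
    _ ≤ volume (ball (0 : Bdry d) a) * ∫⁻ Q, maximalFn H Q ∂ρ := by
        gcongr
        exact hemb.trans (lintegral_mono hVN)
    _ = _ := by
        rw [hρ, lintegral_smul_measure, lintegral_withDensity_eq_lintegral_mul _ hMN hMH, smul_eq_mul,
          mul_assoc]
        simp only [Pi.mul_apply]
        simp_rw [mul_comm (maximalFn N _), ← mul_assoc]

end SawtoothBound

/-- The three methods cover s < 1 (distributional inequality), s = 1 (direct) and s > 1 (duality,
Hölder and the maximal theorem for s and s'). The aperture 8a that they produce is then brought back
to a. -/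
theorem exists_lintegral_coneIntegral_rpow_le (d : ℕ) {a s : ℝ} (ha : 0 < a) (hs : 0 < s) {C : ℝ≥0∞}
    (hC : C ≠ ⊤) :
    ∃ C' : ℝ≥0∞, C' ≠ ⊤ ∧ ∀ g W : Space d → ℝ≥0∞, Measurable g → SawtoothBound a C g W →
      ∫⁻ Q, coneIntegral a g Q ^ s ≤ C' * ∫⁻ Q, coneSup a W Q ^ s := by
  suffices h : ∃ C' : ℝ≥0∞, C' ≠ ⊤ ∧ ∀ g W : Space d → ℝ≥0∞, Measurable g → SawtoothBound a C g W →
      ∫⁻ Q, coneIntegral a g Q ^ s ≤ C' * ∫⁻ Q, coneSup (8 * a) W Q ^ s by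
    obtain ⟨C', hC', h⟩ := h
    refine ⟨C' * ENNReal.ofReal ((2 * (8 * a / a) + 3) ^ d), ENNReal.mul_ne_top hC'
      ENNReal.ofReal_ne_top, fun g W hg hgW => (h g W hg hgW).trans ?_⟩
    rw [mul_assoc]
    gcongr
    exact lintegral_coneSup_rpow_le ha (by positivity) hs W
  have hv : volume (ball (0 : Bdry d) a) ≠ ⊤ := measure_ball_lt_top.ne
  rcases lt_trichotomy s 1 with hs1 | rfl | hs1
  · refine ⟨1 + volume (ball (0 : Bdry d) a) * C * ENNReal.ofReal (1 + s / (1 - s)),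
      ENNReal.add_ne_top.2 ⟨ENNReal.one_ne_top, ENNReal.mul_ne_top (ENNReal.mul_ne_top hv hC)
        ENNReal.ofReal_ne_top⟩, fun g W hg hgW => ?_⟩
    exact lintegral_rpow_le_of_meas_le_add (measurable_coneIntegral a hg) (measurable_coneSup _ _)
      hs hs1 (ENNReal.mul_ne_top hv hC) fun l hl => hgW.measure_lt_coneIntegral_le ha hg hl
  · refine ⟨volume (ball (0 : Bdry d) a) * C, ENNReal.mul_ne_top hv hC, fun g W hg hgW => ?_⟩
    simpa using hgW.lintegral_coneIntegral_le ha hg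
  · have hss := Real.HolderConjugate.conjExponent hs1
    set s' := s.conjExponent
    obtain ⟨C₁, hC₁, h₁⟩ := exists_lintegral_maximalFn_rpow_le d hs1
    obtain ⟨C₂, hC₂, h₂⟩ := exists_lintegral_maximalFn_rpow_le d hss.symm.lt
    set K := volume (ball (0 : Bdry d) a) *
      (C * ENNReal.ofReal (((16 + 128 * a) * (3 * a + 3) / a) ^ d)) with hK
    have hKt : K ≠ ⊤ := ENNReal.mul_ne_top hv (ENNReal.mul_ne_top hC ENNReal.ofReal_ne_top)
    have hs0' := hss.symm.pos
    refine ⟨(K * C₂ ^ (1 / s') * C₁ ^ (1 / s)) ^ s, ?_, fun g W hg hgW => ?_⟩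
    · refine ENNReal.rpow_ne_top_of_nonneg hs.le (ENNReal.mul_ne_top (ENNReal.mul_ne_top hKt ?_) ?_)
      · exact ENNReal.rpow_ne_top_of_nonneg (by positivity) hC₂
      · exact ENNReal.rpow_ne_top_of_nonneg (by positivity) hC₁
    set N := coneSup (8 * a) W
    have hNm : Measurable N := measurable_coneSup _ _
    have h := lintegral_rpow_le_of_duality hss (measurable_coneIntegral a hg)
      (K := K * C₂ ^ (1 / s') * C₁ ^ (1 / s) * (∫⁻ Q, N Q ^ s) ^ (1 / s)) fun H hH => ?_
    · refine h.trans_eq ?_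
      rw [ENNReal.mul_rpow_of_nonneg _ _ hs.le, ← ENNReal.rpow_mul (∫⁻ Q, N Q ^ s),
        one_div_mul_cancel hs.ne', ENNReal.rpow_one]
    · refine (hgW.lintegral_mul_coneIntegral_le ha hg hH).trans ?_
      have hhol := ENNReal.lintegral_mul_le_Lp_mul_Lq volume hss.symm
        (measurable_maximalFn H).aemeasurable (measurable_maximalFn N).aemeasurable
      calc _ ≤ K * ((C₂ * ∫⁻ Q, H Q ^ s') ^ (1 / s') * (C₁ * ∫⁻ Q, N Q ^ s) ^ (1 / s)) := by
            refine mul_le_mul_right (hhol.trans ?_) K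
            gcongr
            · exact h₂ H hH
            · exact h₁ N hNm
        _ = _ := by
            rw [ENNReal.mul_rpow_of_nonneg _ _ (by positivity),
              ENNReal.mul_rpow_of_nonneg _ _ (by positivity)]
            ring

/-! ### Return to the square function and the maximal function -/

theorem lpAverage_eq (p : ℝ) {u v : Space d → ℂ} (h : u =ᵐ[volume] v) (x : Space d) :
    lpAverage p u x = whitneyAverage (fun x => ‖v x‖ₑ ^ p) x ^ (1 / p) := by
  rw [lpAverage, setLAverage_eq, whitneyAverage]
  congr 2
  refine lintegral_congr_ae (ae_restrict_of_ae ?_)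
  filter_upwards [h] with z hz
  rw [hz]

theorem ntMax_eq {p : ℝ} (hp : 0 < p) (a : ℝ) {u v : Space d → ℂ} (h : u =ᵐ[volume] v) (Q : Bdry d) :
    ntMax p a u Q = coneSup a (whitneyAverage fun x => ‖v x‖ₑ ^ p) Q ^ (1 / p) := by
  have hp' : 0 < 1 / p := by positivity
  have h1 := (ENNReal.orderIsoRpow (1 / p) hp').map_iSup₂
    fun x (_ : x ∈ cone a Q) => whitneyAverage (fun x => ‖v x‖ₑ ^ p) x
  simp only [ENNReal.orderIsoRpow_apply] at h1
  rw [coneSup, h1, ntMax]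
  simp_rw [lpAverage_eq p h]

theorem squareFn_eq (p a : ℝ) {u v : Space d → ℂ} {G H : Space d → CVec d} (h : u =ᵐ[volume] v)
    (h' : G =ᵐ[volume] H) (Q : Bdry d) :
    squareFn p a u G Q = coneIntegral a (fun x => ‖H x‖ₑ ^ 2 * ‖v x‖ₑ ^ (p - 2)) Q ^ (1 / p) := by
  rw [squareFn, coneIntegral]
  congr 1
  refine lintegral_congr_ae (ae_restrict_of_ae ?_)
  filter_upwards [h, h'] with z hz hz'
  rw [hz, hz']

theorem eLpNorm_ofReal_rpow_one_div {p q : ℝ} (hq : 0 < q) {f g : Bdry d → ℝ≥0∞}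
    (h : ∀ Q, f Q = g Q ^ (1 / p)) :
    eLpNorm f (ENNReal.ofReal q) volume = (∫⁻ Q, g Q ^ (q / p)) ^ (1 / q) := by
  rw [eLpNorm_eq_lintegral_rpow_enorm_toReal (by simpa using hq) ENNReal.ofReal_ne_top,
    ENNReal.toReal_ofReal hq.le]
  congr 1
  refine lintegral_congr fun Q => ?_
  rw [enorm_eq_self, h, ← ENNReal.rpow_mul, one_div_mul_eq_div]

end

theorem corollaryS4 (d : ℕ) (hd : 1 ≤ d) (p q a lam Lam : ℝ) (M : ℝ≥0)
    (hp : 1 < p) (hq : 0 < q) (ha : 0 < a) :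
    ∃ C : ℝ, 0 < C ∧
      ∀ (A : Space d → Matrix (Fin (d + 1)) (Fin (d + 1)) ℂ) (B : Space d → Fin (d + 1) → ℂ)
        (h : ℝ) (u : Space d → ℂ) (G : Space d → CVec d) (f : Bdry d → ℂ),
        (∀ i j, ContDiffOn ℝ ∞ (fun x => A x i j) (halfSpace d)) →
        (∀ i, ContDiffOn ℝ ∞ (fun x => B x i) (halfSpace d)) →
        IsPElliptic p lam Lam A →
        (∀ x ∈ halfSpace d, A x 0 0 = 1 ∧ ∀ j, (A x 0 j).im = 0) →
        carlesonNorm (coeffMeasure A B) ≤ M →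
        1 < h →
        IsEnergySolution A B h u G f →
        let S := squareFn p a ((strip d h).indicator u) ((strip d h).indicator G)
        let N := ntMax p a ((strip d h).indicator u)
        (p ≤ q → eLpNorm S (ENNReal.ofReal q) volume
            ≤ ENNReal.ofReal C * eLpNorm N (ENNReal.ofReal q) volume) ∧
        (eLpNorm S (ENNReal.ofReal q) volume < ⊤ →
          eLpNorm S (ENNReal.ofReal q) volume
            ≤ ENNReal.ofReal C * eLpNorm N (ENNReal.ofReal q) volume) := by
  -- For λ_p ≤ 0 no coefficients are p-elliptic and any constant serves.
  rcases le_or_gt lam 0 with hlam | hlam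
  · exact ⟨1, one_pos, fun _ _ _ _ _ _ _ _ hell => absurd hell.pos hlam.not_gt⟩
  have hp0 : 0 < p := by linarith
  obtain ⟨C₀, hC₀, hsaw⟩ := exists_lintegral_energy_localSawtooth_le d (Lam := Lam) hp hlam ha
    (by positivity : 0 < 8 * a) M
  obtain ⟨C₁, hC₁, hmain⟩ := exists_lintegral_coneIntegral_rpow_le d ha (div_pos hq hp0) hC₀
  have hCt : C₁ ^ (1 / q) ≠ ⊤ := ENNReal.rpow_ne_top_of_nonneg (by positivity) hC₁
  -- The constant depends only on d, p, q, a, λ_p, Λ and M, all fixed before the coefficients, h and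
  -- u. Adding 1 makes it strictly positive.
  refine ⟨(C₁ ^ (1 / q)).toReal + 1, by positivity, fun A B h u G f hAs hBs hell hA hM _ hu => ?_⟩
  obtain ⟨U, H, hU, hUu, hHG⟩ := hu.exists_isExtendedSolution hAs hBs
  -- One estimate, with s = q/p, covers both cases.
  suffices key : eLpNorm (squareFn p a ((strip d h).indicator u) ((strip d h).indicator G))
      (ENNReal.ofReal q) volume ≤ ENNReal.ofReal ((C₁ ^ (1 / q)).toReal + 1) *
      eLpNorm (ntMax p a ((strip d h).indicator u)) (ENNReal.ofReal q) volume from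
    ⟨fun _ => key, fun _ => key⟩
  rw [eLpNorm_ofReal_rpow_one_div hq (squareFn_eq p a hUu.symm hHG.symm),
    eLpNorm_ofReal_rpow_one_div hq (ntMax_eq hp0 a hUu.symm)]
  have hgm : Measurable fun x => ‖H x‖ₑ ^ 2 * ‖U x‖ₑ ^ (p - 2) := by
    have h1 := hU.measurable
    have h2 := hU.measurable_grad
    fun_prop
  calc _ ≤ (C₁ * ∫⁻ Q, coneSup a (whitneyAverage fun x => ‖U x‖ₑ ^ p) Q ^ (q / p)) ^ (1 / q) := by
        gcongr
        exact hmain _ _ hgm fun F Q r hr => hsaw A B h U H hell hA hM hU F Q r hr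
    _ = C₁ ^ (1 / q) * _ := ENNReal.mul_rpow_of_nonneg _ _ (by positivity)
    _ ≤ _ := by
        gcongr
        rw [ENNReal.ofReal_add ENNReal.toReal_nonneg zero_le_one, ENNReal.ofReal_toReal hCt]
        exact le_self_add
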